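/- Let $F$ be a field and let $\mathcal Q$ be a non-empty quiver with finite vertex set $\mathcal Q_0$ and finite arrow set $\mathcal Q_1$. Put $k=F\mathcal Q_0$ and $V=F\mathcal Q_1$, let $T_k(V)$ be the path algebra of $\mathcal Q$ over $F$ (paths being composed from right to left), let $R$ be a $k$-sub-bimodule of $V\otimes_k V$, and let $A=T_k(V)/(R)$ be the corresponding quadratic quiver algebra. Write $A^e=A\otimes_F A^{op}$; $A$-bimodules (with symmetric action of $F$) are the same as left $A^e$-modules. Put $W_0=k$, $W_1=V$ and $W_p=\bigcap_{i+2+j=p}V^{\otimes_k i}\otimes_k R\otimes_k V^{\otimes_k j}\subseteq V^{\otimes_k p}$ for $p\ge 2$. The Koszul complex $K(A)$ is the complex of $A$-bimodules with $K(A)_p=A\otimes_k W_p\otimes_k A$ for $p\ge 0$ and differential $$d(a\otimes x_1\cdots x_p\otimes b)=ax_1\otimes x_2\cdots x_p\otimes b+(-1)^p\,a\otimes x_1\cdots x_{p-1}\otimes x_p b .$$ The algebra $A$ is Koszul if $H_p(K(A))=0$ for all $p>1$. The complex $K(A)$ has length $n$ if $K(A)_n\ne 0$ and $K(A)_p=0$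 for all $p>n$. Let $n\ge 0$ be an integer. * $A$ is $n$-Kc-Calabi–Yau if $K(A)$ has length $n$ and $\mathrm{RHom}_{A^e}(K(A),A^e)\cong K(A)[-n]$ in the derived category of $A$-bimodules. * $A$ is $n$-Calabi–Yau (in Ginzburg's sense) if $A$ has a bounded resolution by finitely generated projective $A$-bimodules (homological smoothness) and $\mathrm{RHom}_{A^e}(A,A^e)\cong A[-n]$ in the derived category of $A$-bimodules. (In both cases $\mathrm{Hom}_{A^e}(-,A^e)$ is taken with respect to the outer bimodule structure of $A^e$, and the inner one provides the bimodule structure of the result.) **Proposition.** If $A$ is Koszul, then, for every integer $n\ge 0$, $A$ is $n$-Kc-Calabi–Yau if and only if $A$ is $n$-Calabi–Yau. In particular, the known $2$-Calabi–Yau property of preprojective algebras is recovered: let $\Delta$ be a non-empty finite connected graph, in which loops and multiple edges are allowed, that is not a Dynkin graph of type $A_m$ ($m\ge 1$), $D_m$ ($m\ge 4$), $E_6$, $E_7$ or $E_8$. Choose an orientation $\mathcal Q$ of $\Delta$, and let $\overline{\mathcal Q}$ be the quiver obtained from $\mathcal Q$ by adding an arrow $a^*\colon j\to i$ for each arrow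 $a\colon i\to j$. Then the preprojective algebra $A(\Delta)$, that is, the quotient of the path algebra of $\overline{\mathcal Q}$ over $F$ by the ideal generated by the elements $$\sigma_i=\sum_{a\in\mathcal Q_1,\ t(a)=i}aa^*-\sum_{a\in\mathcal Q_1,\ s(a)=i}a^*a\qquad(i\in\mathcal Q_0),$$ where $s(a)$ and $t(a)$ are the source and the target of $a$, is $2$-Calabi–Yau. -/

import Mathlib

universe u v w

noncomputable section

open CategoryTheory TensorProduct

namespace QuiverKoszul

/-! ### Path algebras -/

/-- All paths of the quiver `Q`: a source, a target, and a path between them. -/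
abbrev QPath (Q : Type v) [Quiver.{w} Q] : Type (max v w) :=
  Σ a b : Q, Quiver.Path a b

/-- The underlying vector space of the path algebra: the vector space with basis the paths. -/
def PathAlgebra (F : Type u) [Field F] (Q : Type v) [Quiver.{w} Q] : Type (max u v w) :=
  QPath Q →₀ F

namespace PathAlgebra

variable {F : Type u} [Field F] {Q : Type v} [Quiver.{w} Q]

instance : AddCommGroup (PathAlgebra F Q) := inferInstanceAs (AddCommGroup (QPath Q →₀ F))

instance : Module F (PathAlgebra F Q) := inferInstanceAs (Module F (QPath Q →₀ F))

variable (F) in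
/-- The basis element of a path. -/
def ofPath {a b : Q} (p : Quiver.Path a b) : PathAlgebra F Q :=
  Finsupp.single (⟨a, b, p⟩ : QPath Q) (1 : F)

variable (F) in
/-- The idempotent `e_i` of the vertex `i`. -/
def vertex (i : Q) : PathAlgebra F Q := ofPath F (Quiver.Path.nil : Quiver.Path i i)

variable (F) in
/-- An arrow, as an element of the path algebra. -/
def arrow {a b : Q} (α : a ⟶ b) : PathAlgebra F Q := ofPath F α.toPath

@[elab_as_elim]
theorem induction {C : PathAlgebra F Q → Prop} (x : PathAlgebra F Q) (zero : C 0)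
    (add : ∀ x y, C x → C y → C (x + y))
    (path : ∀ (c : F) (a b : Q) (p : Quiver.Path a b), C (c • ofPath F p)) : C x := by
  refine Finsupp.induction_linear x zero add ?_
  rintro ⟨a, b, p⟩ c
  have h := path c a b p
  have e : c • ofPath F p = (Finsupp.single (⟨a, b, p⟩ : QPath Q) c : QPath Q →₀ F) := by
    change c • (Finsupp.single (⟨a, b, p⟩ : QPath Q) (1 : F) : QPath Q →₀ F) = _
    simp
  rwa [e] at h

theorem linearMap_ext {M : Type*} [AddCommGroup M] [Module F M] {f g : PathAlgebra F Q →ₗ[F] M}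
    (h : ∀ (a b : Q) (p : Quiver.Path a b), f (ofPath F p) = g (ofPath F p)) : f = g := by
  ext x
  induction x using induction with
  | zero => simp
  | add x y hx hy => simp [hx, hy]
  | path c a b p => simp [h]

open scoped Classical in
variable (F) in
/-- The product of two paths. Paths are composed from right to left: `p * q` is `q` followed by
`p` when `q` ends where `p` starts, and it is zero otherwise. -/
def pathMul (p q : QPath Q) : PathAlgebra F Q :=
  if h : q.2.1 = p.1 then ofPath F (q.2.2.comp (p.2.2.cast h.symm rfl)) else 0

variable (F Q) in
/-- The bilinear extension of the product of paths. -/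
def mulHom : PathAlgebra F Q →ₗ[F] PathAlgebra F Q →ₗ[F] PathAlgebra F Q :=
  Finsupp.linearCombination F
    (fun p : QPath Q => (Finsupp.linearCombination F (pathMul F p) :
      PathAlgebra F Q →ₗ[F] PathAlgebra F Q))

instance : Mul (PathAlgebra F Q) := ⟨fun x y => mulHom F Q x y⟩

theorem mul_def' (x y : PathAlgebra F Q) : x * y = mulHom F Q x y := rfl

theorem ofPath_mul_ofPath_eq {a b c d : Q} (p : Quiver.Path c d) (q : Quiver.Path a b) :
    ofPath F p * ofPath F q = pathMul F ⟨c, d, p⟩ ⟨a, b, q⟩ := by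
  have h1 : mulHom F Q (ofPath F p) = (Finsupp.linearCombination F (pathMul F ⟨c, d, p⟩) :
      PathAlgebra F Q →ₗ[F] PathAlgebra F Q) :=
    (Finsupp.linearCombination_single F (1 : F) (⟨c, d, p⟩ : QPath Q)).trans (one_smul F _)
  rw [mul_def', h1]
  exact (Finsupp.linearCombination_single F (1 : F) (⟨a, b, q⟩ : QPath Q)).trans (one_smul F _)

theorem ofPath_mul_ofPath {a b c : Q} (p : Quiver.Path b c) (q : Quiver.Path a b) :
    ofPath F p * ofPath F q = ofPath F (q.comp p) := by
  simp [ofPath_mul_ofPath_eq, pathMul]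

theorem ofPath_mul_ofPath_of_ne {a b c d : Q} (p : Quiver.Path c d) (q : Quiver.Path a b)
    (h : b ≠ c) : ofPath F p * ofPath F q = 0 := by
  simp [ofPath_mul_ofPath_eq, pathMul, h]

protected theorem add_mul' (x y z : PathAlgebra F Q) : (x + y) * z = x * z + y * z := by
  simp [mul_def']

protected theorem mul_add' (x y z : PathAlgebra F Q) : x * (y + z) = x * y + x * z := by
  simp [mul_def']

protected theorem smul_mul' (c : F) (x y : PathAlgebra F Q) : (c • x) * y = c • (x * y) := by
  simp [mul_def']

protected theorem mul_smul' (c : F) (x y : PathAlgebra F Q) : x * (c • y) = c • (x * y) := by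
  simp [mul_def']

protected theorem zero_mul' (x : PathAlgebra F Q) : 0 * x = 0 := by
  simpa using PathAlgebra.smul_mul' (0 : F) 0 x

protected theorem mul_zero' (x : PathAlgebra F Q) : x * 0 = 0 := by
  simpa using PathAlgebra.mul_smul' (0 : F) x 0

protected theorem mul_assoc' (x y z : PathAlgebra F Q) : x * y * z = x * (y * z) := by
  induction x using induction with
  | zero => simp [PathAlgebra.zero_mul']
  | add x x' hx hx' => simp [PathAlgebra.add_mul', hx, hx']
  | path c a b p =>
  induction y using induction with
  | zero => simp [PathAlgebra.zero_mul', PathAlgebra.mul_zero']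
  | add x x' hx hx' => simp [PathAlgebra.add_mul', PathAlgebra.mul_add', hx, hx']
  | path d a' b' q =>
  induction z using induction with
  | zero => simp [PathAlgebra.mul_zero']
  | add x x' hx hx' => simp [PathAlgebra.mul_add', hx, hx']
  | path e a'' b'' r =>
  simp only [PathAlgebra.smul_mul', PathAlgebra.mul_smul']
  congr 3
  by_cases h : b' = a
  · subst h
    by_cases h' : b'' = a'
    · subst h'
      simp [ofPath_mul_ofPath, Quiver.Path.comp_assoc]
    · simp [ofPath_mul_ofPath, ofPath_mul_ofPath_of_ne _ _ h', PathAlgebra.mul_zero']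
  · by_cases h' : b'' = a'
    · subst h'
      simp [ofPath_mul_ofPath, ofPath_mul_ofPath_of_ne _ _ h, PathAlgebra.zero_mul']
    · simp [ofPath_mul_ofPath_of_ne _ _ h', ofPath_mul_ofPath_of_ne _ _ h,
        PathAlgebra.mul_zero', PathAlgebra.zero_mul']

open scoped Classical in
theorem vertex_mul_ofPath (i : Q) {a b : Q} (p : Quiver.Path a b) :
    vertex F i * ofPath F p = if i = b then ofPath F p else 0 := by
  split_ifs with h
  · subst h
    simp [vertex, ofPath_mul_ofPath]
  · simp [vertex, ofPath_mul_ofPath_of_ne _ _ (Ne.symm h)]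

open scoped Classical in
theorem ofPath_mul_vertex (i : Q) {a b : Q} (p : Quiver.Path a b) :
    ofPath F p * vertex F i = if i = a then ofPath F p else 0 := by
  split_ifs with h
  · subst h
    simp [vertex, ofPath_mul_ofPath]
  · simp [vertex, ofPath_mul_ofPath_of_ne _ _ h]

/-- The span of the paths of length `m`; for `m = 0` it is the ring `k` of the vertices, for
`m = 1` it is the arrow space `V`, and in general it is the `m`-th tensor power of `V` over `k`. -/
def degreePart (F : Type u) [Field F] (Q : Type v) [Quiver.{w} Q] (m : ℕ) :
    Submodule F (PathAlgebra F Q) :=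
  Submodule.span F {x | ∃ (a b : Q) (p : Quiver.Path a b), p.length = m ∧ x = ofPath F p}

theorem ofPath_mem {a b : Q} (p : Quiver.Path a b) {m : ℕ} (h : p.length = m) :
    ofPath F p ∈ degreePart F Q m :=
  Submodule.subset_span ⟨a, b, p, h, rfl⟩

/-! ### Removing the first or the last arrow of a path -/

theorem cons_injective {a b : Q} (α : a ⟶ b) : Function.Injective
    (fun q : Σ i : Q, Quiver.Path i a => (⟨q.1, b, q.2.cons α⟩ : QPath Q)) := by
  rintro ⟨i, q⟩ ⟨j, r⟩ h
  obtain ⟨rfl, h⟩ := Sigma.mk.inj_iff.1 h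
  have h := eq_of_heq h
  obtain ⟨-, h⟩ := Sigma.mk.inj_iff.1 h
  have h := eq_of_heq h
  obtain ⟨-, h, -⟩ := Quiver.Path.cons.inj h
  exact congrArg _ (eq_of_heq h)

theorem comp_injective {a b : Q} (α : a ⟶ b) : Function.Injective
    (fun q : Σ j : Q, Quiver.Path b j => (⟨a, q.1, α.toPath.comp q.2⟩ : QPath Q)) := by
  rintro ⟨i, q⟩ ⟨j, r⟩ h
  obtain ⟨-, h⟩ := Sigma.mk.inj_iff.1 h
  have h := eq_of_heq h
  obtain ⟨rfl, h⟩ := Sigma.mk.inj_iff.1 h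
  have h := eq_of_heq h
  exact congrArg _ (Quiver.Path.comp_injective_right _ h)

/-- The linear map that sends a path `α q` (first `q`, then `α`) to `q`, and every path that is
not of this form to zero. -/
def leftStrip {a b : Q} (α : a ⟶ b) : PathAlgebra F Q →ₗ[F] PathAlgebra F Q :=
  (Finsupp.lmapDomain F F (fun q : Σ i : Q, Quiver.Path i a => (⟨q.1, a, q.2⟩ : QPath Q))).comp
    (Finsupp.lcomapDomain (fun q : Σ i : Q, Quiver.Path i a => (⟨q.1, b, q.2.cons α⟩ : QPath Q))
      (cons_injective α))

/-- The linear map that sends a path `q α` (first `α`, then `q`) to `q`, and every path that is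
not of this form to zero. -/
def rightStrip {a b : Q} (α : a ⟶ b) : PathAlgebra F Q →ₗ[F] PathAlgebra F Q :=
  (Finsupp.lmapDomain F F (fun q : Σ j : Q, Quiver.Path b j => (⟨b, q.1, q.2⟩ : QPath Q))).comp
    (Finsupp.lcomapDomain
      (fun q : Σ j : Q, Quiver.Path b j => (⟨a, q.1, α.toPath.comp q.2⟩ : QPath Q))
      (comp_injective α))

theorem leftStrip_cons {i a b : Q} (α : a ⟶ b) (q : Quiver.Path i a) :
    leftStrip α (ofPath F (q.cons α)) = ofPath F q := by
  have h : Finsupp.comapDomain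
      (fun q : Σ i : Q, Quiver.Path i a => (⟨q.1, b, q.2.cons α⟩ : QPath Q))
      (Finsupp.single (⟨i, b, q.cons α⟩ : QPath Q) (1 : F)) (cons_injective α).injOn
      = Finsupp.single ⟨i, q⟩ 1 :=
    Finsupp.comapDomain_single (f := fun q : Σ i : Q, Quiver.Path i a =>
      (⟨q.1, b, q.2.cons α⟩ : QPath Q)) ⟨i, q⟩ (1 : F) (cons_injective α).injOn
  refine (congrArg (Finsupp.lmapDomain F F
    (fun q : Σ i : Q, Quiver.Path i a => (⟨q.1, a, q.2⟩ : QPath Q))) h).trans ?_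
  exact Finsupp.mapDomain_single

theorem leftStrip_eq_zero {i j a b : Q} (α : a ⟶ b) (p : Quiver.Path i j)
    (h : ∀ q : Σ i : Q, Quiver.Path i a, (⟨q.1, b, q.2.cons α⟩ : QPath Q) ≠ ⟨i, j, p⟩) :
    leftStrip α (ofPath F p) = 0 := by
  have h : Finsupp.comapDomain
      (fun q : Σ i : Q, Quiver.Path i a => (⟨q.1, b, q.2.cons α⟩ : QPath Q))
      (Finsupp.single (⟨i, j, p⟩ : QPath Q) (1 : F)) (cons_injective α).injOn = 0 := by
    ext q
    exact Finsupp.single_eq_of_ne (h q)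
  refine (congrArg (Finsupp.lmapDomain F F
    (fun q : Σ i : Q, Quiver.Path i a => (⟨q.1, a, q.2⟩ : QPath Q))) h).trans ?_
  exact map_zero _

theorem rightStrip_comp {a b j : Q} (α : a ⟶ b) (q : Quiver.Path b j) :
    rightStrip α (ofPath F (α.toPath.comp q)) = ofPath F q := by
  have h : Finsupp.comapDomain
      (fun q : Σ j : Q, Quiver.Path b j => (⟨a, q.1, α.toPath.comp q.2⟩ : QPath Q))
      (Finsupp.single (⟨a, j, α.toPath.comp q⟩ : QPath Q) (1 : F)) (comp_injective α).injOn
      = Finsupp.single ⟨j, q⟩ 1 :=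
    Finsupp.comapDomain_single (f := fun q : Σ j : Q, Quiver.Path b j =>
      (⟨a, q.1, α.toPath.comp q.2⟩ : QPath Q)) ⟨j, q⟩ (1 : F) (comp_injective α).injOn
  refine (congrArg (Finsupp.lmapDomain F F
    (fun q : Σ j : Q, Quiver.Path b j => (⟨b, q.1, q.2⟩ : QPath Q))) h).trans ?_
  exact Finsupp.mapDomain_single

theorem rightStrip_eq_zero {i j a b : Q} (α : a ⟶ b) (p : Quiver.Path i j)
    (h : ∀ q : Σ j : Q, Quiver.Path b j,
      (⟨a, q.1, α.toPath.comp q.2⟩ : QPath Q) ≠ ⟨i, j, p⟩) :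
    rightStrip α (ofPath F p) = 0 := by
  have h : Finsupp.comapDomain
      (fun q : Σ j : Q, Quiver.Path b j => (⟨a, q.1, α.toPath.comp q.2⟩ : QPath Q))
      (Finsupp.single (⟨i, j, p⟩ : QPath Q) (1 : F)) (comp_injective α).injOn = 0 := by
    ext q
    exact Finsupp.single_eq_of_ne (h q)
  refine (congrArg (Finsupp.lmapDomain F F
    (fun q : Σ j : Q, Quiver.Path b j => (⟨b, q.1, q.2⟩ : QPath Q))) h).trans ?_
  exact map_zero _

theorem leftStrip_nil {a b : Q} (α : a ⟶ b) (i : Q) :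
    leftStrip α (ofPath F (Quiver.Path.nil : Quiver.Path i i)) = 0 := by
  refine leftStrip_eq_zero α _ fun q h => ?_
  have := congrArg (fun p : QPath Q => p.2.2.length) h
  simp at this

theorem rightStrip_nil {a b : Q} (α : a ⟶ b) (i : Q) :
    rightStrip α (ofPath F (Quiver.Path.nil : Quiver.Path i i)) = 0 := by
  refine rightStrip_eq_zero α _ fun q h => ?_
  have := congrArg (fun p : QPath Q => p.2.2.length) h
  simp at this

theorem leftStrip_cons_of_ne {i a b c d : Q} (α : a ⟶ b) (β : c ⟶ d) (q : Quiver.Path i c)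
    (h : (⟨a, b, α⟩ : Σ a b : Q, a ⟶ b) ≠ ⟨c, d, β⟩) :
    leftStrip α (ofPath F (q.cons β)) = 0 := by
  refine leftStrip_eq_zero α _ fun ⟨i', r⟩ h' => h ?_
  obtain ⟨rfl, h'⟩ := Sigma.mk.inj_iff.1 h'
  obtain ⟨rfl, h'⟩ := Sigma.mk.inj_iff.1 (eq_of_heq h')
  obtain ⟨rfl, -, h'⟩ := Quiver.Path.cons.inj (eq_of_heq h')
  rw [eq_of_heq h']

theorem toPath_comp_inj {a b c j : Q} {α : a ⟶ b} {β : a ⟶ c} {q : Quiver.Path b j}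
    {r : Quiver.Path c j} (h : α.toPath.comp q = β.toPath.comp r) :
    (⟨b, α⟩ : Σ b : Q, a ⟶ b) = ⟨c, β⟩ := by
  induction q with
  | nil =>
    cases r with
    | nil => 
      obtain ⟨-, -, h⟩ := Quiver.Path.cons.inj h
      rw [eq_of_heq h]
    | cons r γ => 
      have := congrArg Quiver.Path.length h
      simp at this
  | cons q γ ih =>
    cases r with
    | nil =>
      have := congrArg Quiver.Path.length h
      simp at this
    | cons r δ =>
      obtain ⟨rfl, h, -⟩ := Quiver.Path.cons.inj h
      exact ih (eq_of_heq h)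

theorem rightStrip_comp_of_ne {a b c d j : Q} (α : a ⟶ b) (β : c ⟶ d) (q : Quiver.Path d j)
    (h : (⟨a, b, α⟩ : Σ a b : Q, a ⟶ b) ≠ ⟨c, d, β⟩) :
    rightStrip α (ofPath F (β.toPath.comp q)) = 0 := by
  refine rightStrip_eq_zero α _ fun ⟨j', r⟩ h' => h ?_
  obtain ⟨rfl, h'⟩ := Sigma.mk.inj_iff.1 h'
  obtain ⟨rfl, h'⟩ := Sigma.mk.inj_iff.1 (eq_of_heq h')
  rw [toPath_comp_inj (eq_of_heq h')]

/-- Every path of positive length is `q` followed by an arrow, and an arrow followed by `q'`. -/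
theorem exists_comp {i j : Q} (p : Quiver.Path i j) (h : p.length ≠ 0) :
    ∃ (c : Q) (β : i ⟶ c) (q : Quiver.Path c j), p = β.toPath.comp q := by
  obtain ⟨c, e, q, h, -⟩ := (Quiver.Path.length_ne_zero_iff_eq_comp p).1 h
  exact ⟨c, e, q, h⟩

theorem vertex_mem (i : Q) : vertex F i ∈ degreePart F Q 0 := ofPath_mem _ rfl

theorem leftStrip_mem {a b : Q} (α : a ⟶ b) (m : ℕ) {x : PathAlgebra F Q}
    (hx : x ∈ degreePart F Q (m + 1)) : leftStrip α x ∈ degreePart F Q m := by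
  induction hx using Submodule.span_induction with
  | zero => simp
  | add x y _ _ hx hy => rw [map_add]; exact add_mem hx hy
  | smul c x _ hx => rw [map_smul]; exact Submodule.smul_mem _ _ hx
  | mem x hx =>
    obtain ⟨i, j, p, hp, rfl⟩ := hx
    cases p with
    | nil => simp at hp
    | @cons c _ q β =>
      by_cases h : (⟨a, b, α⟩ : Σ a b : Q, a ⟶ b) = ⟨c, j, β⟩
      · cases h
        rw [leftStrip_cons]
        exact ofPath_mem _ (by simpa using hp)
      · rw [leftStrip_cons_of_ne α β q h]
        exact zero_mem _

theorem rightStrip_mem {a b : Q} (α : a ⟶ b) (m : ℕ) {x : PathAlgebra F Q}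
    (hx : x ∈ degreePart F Q (m + 1)) : rightStrip α x ∈ degreePart F Q m := by
  induction hx using Submodule.span_induction with
  | zero => simp
  | add x y _ _ hx hy => rw [map_add]; exact add_mem hx hy
  | smul c x _ hx => rw [map_smul]; exact Submodule.smul_mem _ _ hx
  | mem x hx =>
    obtain ⟨i, j, p, hp, rfl⟩ := hx
    obtain ⟨c, β, q, rfl⟩ := exists_comp p (by lia)
    by_cases h : (⟨a, b, α⟩ : Σ a b : Q, a ⟶ b) = ⟨i, c, β⟩
    · cases h
      rw [rightStrip_comp]
      exact ofPath_mem _ (by simp at hp; lia)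
    · rw [rightStrip_comp_of_ne α β q h]
      exact zero_mem _

theorem leftStrip_rightStrip {a b c d : Q} (α : a ⟶ b) (β : c ⟶ d) (x : PathAlgebra F Q) :
    leftStrip α (rightStrip β x) = rightStrip β (leftStrip α x) := by
  induction x using induction with
  | zero => simp
  | add x y hx hy => simp [hx, hy]
  | path e i j p =>
  simp only [map_smul]
  congr 1
  by_cases hp : p.length = 0
  · obtain rfl := Quiver.Path.eq_of_length_zero p hp
    obtain rfl := Quiver.Path.eq_nil_of_length_zero p hp
    simp [leftStrip_nil, rightStrip_nil]
  obtain ⟨c', β', q, rfl⟩ := exists_comp p hp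
  cases q with
  | nil =>
    have h1 : leftStrip α (ofPath F (β'.toPath.comp Quiver.Path.nil)) =
        leftStrip α (ofPath F (Quiver.Path.nil.cons β')) := rfl
    have h2 : rightStrip β (leftStrip α (ofPath F (β'.toPath.comp Quiver.Path.nil))) = 0 := by
      rw [h1]
      by_cases h : (⟨a, b, α⟩ : Σ a b : Q, a ⟶ b) = ⟨i, _, β'⟩
      · cases h
        rw [leftStrip_cons, rightStrip_nil]
      · rw [leftStrip_cons_of_ne α β' _ h, map_zero]
    rw [h2]
    by_cases h : (⟨c, d, β⟩ : Σ a b : Q, a ⟶ b) = ⟨i, _, β'⟩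
    · cases h
      rw [rightStrip_comp, leftStrip_nil]
    · rw [rightStrip_comp_of_ne β β' _ h, map_zero]
  | @cons b' _ q α' =>
    by_cases h : (⟨a, b, α⟩ : Σ a b : Q, a ⟶ b) = ⟨b', _, α'⟩
    · cases h
      by_cases h' : (⟨c, d, β⟩ : Σ a b : Q, a ⟶ b) = ⟨i, _, β'⟩
      · cases h'
        rw [rightStrip_comp, leftStrip_cons, Quiver.Path.comp_cons, leftStrip_cons,
          rightStrip_comp]
      · rw [rightStrip_comp_of_ne β β' _ h', map_zero, Quiver.Path.comp_cons, leftStrip_cons,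
          rightStrip_comp_of_ne β β' _ h']
    · rw [Quiver.Path.comp_cons, leftStrip_cons_of_ne α α' _ h, map_zero,
        ← Quiver.Path.comp_cons]
      by_cases h' : (⟨c, d, β⟩ : Σ a b : Q, a ⟶ b) = ⟨i, _, β'⟩
      · cases h'
        rw [rightStrip_comp, leftStrip_cons_of_ne α α' _ h]
      · rw [rightStrip_comp_of_ne β β' _ h', map_zero]

/-! ### The ring structure -/

variable [Fintype Q]

/-- The unit of the path algebra of a finite quiver is the sum of the vertices. -/
instance : One (PathAlgebra F Q) := ⟨∑ i : Q, vertex F i⟩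

theorem one_def' : (1 : PathAlgebra F Q) = ∑ i : Q, vertex F i := rfl

/-- Left multiplication as a linear map. -/
def mulL (x : PathAlgebra F Q) : PathAlgebra F Q →ₗ[F] PathAlgebra F Q where
  toFun y := x * y
  map_add' := PathAlgebra.mul_add' x
  map_smul' c := PathAlgebra.mul_smul' c x

/-- Right multiplication as a linear map. -/
def mulR (y : PathAlgebra F Q) : PathAlgebra F Q →ₗ[F] PathAlgebra F Q where
  toFun x := x * y
  map_add' a b := PathAlgebra.add_mul' a b y
  map_smul' c x := PathAlgebra.smul_mul' c x y

protected theorem one_mul' (x : PathAlgebra F Q) : 1 * x = x := by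
  classical
  induction x using induction with
  | zero => simp [PathAlgebra.mul_zero']
  | add x x' hx hx' => simp [PathAlgebra.mul_add', hx, hx']
  | path c a b p =>
  rw [PathAlgebra.mul_smul']
  congr 1
  change mulR (ofPath F p) (∑ i : Q, vertex F i) = _
  rw [map_sum]
  simp [mulR, vertex_mul_ofPath]

protected theorem mul_one' (x : PathAlgebra F Q) : x * 1 = x := by
  classical
  induction x using induction with
  | zero => simp [PathAlgebra.zero_mul']
  | add x x' hx hx' => simp [PathAlgebra.add_mul', hx, hx']
  | path c a b p =>
  rw [PathAlgebra.smul_mul']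
  congr 1
  change mulL (ofPath F p) (∑ i : Q, vertex F i) = _
  rw [map_sum]
  simp [mulL, ofPath_mul_vertex]

instance : Ring (PathAlgebra F Q) :=
  { (inferInstance : AddCommGroup (PathAlgebra F Q)) with
    left_distrib := PathAlgebra.mul_add'
    right_distrib := PathAlgebra.add_mul'
    zero_mul := PathAlgebra.zero_mul'
    mul_zero := PathAlgebra.mul_zero'
    mul_assoc := PathAlgebra.mul_assoc'
    one_mul := PathAlgebra.one_mul'
    mul_one := PathAlgebra.mul_one' }

instance : Algebra F (PathAlgebra F Q) :=
  Algebra.ofModule PathAlgebra.smul_mul' PathAlgebra.mul_smul'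

theorem degreePart_mul_le (m n : ℕ) :
    degreePart F Q m * degreePart F Q n ≤ degreePart F Q (m + n) := by
  rw [degreePart, degreePart, Submodule.span_mul_span, Submodule.span_le]
  rintro _ ⟨_, ⟨a, b, p, hp, rfl⟩, _, ⟨c, d, q, hq, rfl⟩, rfl⟩
  change ofPath F p * ofPath F q ∈ _
  by_cases h : d = a
  · subst h
    rw [ofPath_mul_ofPath]
    exact ofPath_mem _ (by simp [hp, hq, add_comm])
  · rw [ofPath_mul_ofPath_of_ne _ _ h]
    exact zero_mem _

theorem leftStrip_mul {a b : Q} (α : a ⟶ b) (m : ℕ) {x : PathAlgebra F Q}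
    (hx : x ∈ degreePart F Q (m + 1)) (y : PathAlgebra F Q) :
    leftStrip α (x * y) = leftStrip α x * y := by
  induction hx using Submodule.span_induction with
  | zero => simp
  | add x x' _ _ hx hx' => simp [add_mul, hx, hx']
  | smul c x _ hx => simp [hx]
  | mem x hx =>
  obtain ⟨i, j, p, hp, rfl⟩ := hx
  induction y using induction with
  | zero => simp
  | add x x' hx hx' => simp [mul_add, hx, hx']
  | path e i' j' r =>
  simp only [mul_smul_comm, map_smul]
  congr 1
  cases p with
  | nil => simp at hp
  | @cons c _ q β =>
    by_cases h' : j' = i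
    · subst h'
      rw [ofPath_mul_ofPath, Quiver.Path.comp_cons]
      by_cases h : (⟨a, b, α⟩ : Σ a b : Q, a ⟶ b) = ⟨c, j, β⟩
      · cases h
        rw [leftStrip_cons, leftStrip_cons, ofPath_mul_ofPath]
      · rw [leftStrip_cons_of_ne α β _ h, leftStrip_cons_of_ne α β _ h, zero_mul]
    · rw [ofPath_mul_ofPath_of_ne _ _ h']
      by_cases h : (⟨a, b, α⟩ : Σ a b : Q, a ⟶ b) = ⟨c, j, β⟩
      · cases h
        rw [leftStrip_cons, ofPath_mul_ofPath_of_ne _ _ h', map_zero]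
      · rw [leftStrip_cons_of_ne α β _ h, zero_mul, map_zero]

theorem rightStrip_mul {a b : Q} (α : a ⟶ b) (m : ℕ) (x : PathAlgebra F Q)
    {y : PathAlgebra F Q} (hy : y ∈ degreePart F Q (m + 1)) :
    rightStrip α (x * y) = x * rightStrip α y := by
  induction hy using Submodule.span_induction with
  | zero => simp
  | add x x' _ _ hx hx' => simp [mul_add, hx, hx']
  | smul c x _ hx => simp [hx]
  | mem y hy =>
  obtain ⟨i, j, p, hp, rfl⟩ := hy
  induction x using induction with
  | zero => simp
  | add x x' hx hx' => simp [add_mul, hx, hx']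
  | path e i' j' r =>
  simp only [smul_mul_assoc, map_smul]
  congr 1
  obtain ⟨c, β, q, rfl⟩ := exists_comp p (by lia)
  by_cases h' : j = i'
  · subst h'
    rw [ofPath_mul_ofPath, Quiver.Path.comp_assoc]
    by_cases h : (⟨a, b, α⟩ : Σ a b : Q, a ⟶ b) = ⟨i, c, β⟩
    · cases h
      rw [rightStrip_comp, rightStrip_comp, ofPath_mul_ofPath]
    · rw [rightStrip_comp_of_ne α β _ h, rightStrip_comp_of_ne α β _ h, mul_zero]
  · rw [ofPath_mul_ofPath_of_ne _ _ h']
    by_cases h : (⟨a, b, α⟩ : Σ a b : Q, a ⟶ b) = ⟨i, c, β⟩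
    · cases h
      rw [rightStrip_comp, ofPath_mul_ofPath_of_ne _ _ h', map_zero]
    · rw [rightStrip_comp_of_ne α β _ h, mul_zero, map_zero]

open scoped Classical in
theorem leftStrip_vertex_mul {a b : Q} (α : a ⟶ b) (i : Q) (x : PathAlgebra F Q) :
    leftStrip α (vertex F i * x) = if i = b then leftStrip α x else 0 := by
  induction x using induction with
  | zero => simp
  | add x y hx hy => rw [mul_add, map_add, hx, hy, map_add]; split_ifs <;> simp
  | path e c j p =>
    rw [mul_smul_comm, map_smul, map_smul, ← smul_ite_zero]
    congr 1
    rw [vertex_mul_ofPath]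
    cases p with
    | nil => split_ifs <;> simp [leftStrip_nil]
    | @cons d _ q β =>
      by_cases h : (⟨a, b, α⟩ : Σ a b : Q, a ⟶ b) = ⟨d, j, β⟩
      · cases h
        split_ifs <;> simp
      · rw [leftStrip_cons_of_ne α β _ h]
        split_ifs <;> simp [leftStrip_cons_of_ne α β _ h]

open scoped Classical in
theorem rightStrip_mul_vertex {a b : Q} (α : a ⟶ b) (i : Q) (x : PathAlgebra F Q) :
    rightStrip α (x * vertex F i) = if i = a then rightStrip α x else 0 := by
  induction x using induction with
  | zero => simp
  | add x y hx hy => rw [add_mul, map_add, hx, hy, map_add]; split_ifs <;> simp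
  | path e c j p =>
    rw [smul_mul_assoc, map_smul, map_smul, ← smul_ite_zero]
    congr 1
    rw [ofPath_mul_vertex]
    by_cases hp : p.length = 0
    · obtain rfl := Quiver.Path.eq_of_length_zero p hp
      obtain rfl := Quiver.Path.eq_nil_of_length_zero p hp
      split_ifs <;> simp [rightStrip_nil]
    · obtain ⟨d, β, q, rfl⟩ := exists_comp p hp
      by_cases h : (⟨a, b, α⟩ : Σ a b : Q, a ⟶ b) = ⟨c, d, β⟩
      · cases h
        split_ifs <;> simp
      · rw [rightStrip_comp_of_ne α β _ h]
        split_ifs <;> simp [rightStrip_comp_of_ne α β _ h]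

theorem leftStrip_mul_vertex {a b : Q} (α : a ⟶ b) (i : Q) (x : PathAlgebra F Q) :
    leftStrip α (x * vertex F i) = leftStrip α x * vertex F i := by
  classical
  induction x using induction with
  | zero => simp
  | add x y hx hy => simp [add_mul, hx, hy]
  | path e c j p =>
    by_cases hp : p.length = 0
    · obtain rfl := Quiver.Path.eq_of_length_zero p hp
      obtain rfl := Quiver.Path.eq_nil_of_length_zero p hp
      simp only [smul_mul_assoc, map_smul, leftStrip_nil, ofPath_mul_vertex]
      split_ifs <;> simp [leftStrip_nil]
    · obtain ⟨m, hm⟩ := Nat.exists_eq_succ_of_ne_zero hp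
      exact leftStrip_mul α m (Submodule.smul_mem _ _ (ofPath_mem p hm)) _

theorem rightStrip_vertex_mul {a b : Q} (α : a ⟶ b) (i : Q) (x : PathAlgebra F Q) :
    rightStrip α (vertex F i * x) = vertex F i * rightStrip α x := by
  classical
  induction x using induction with
  | zero => simp
  | add x y hx hy => simp [mul_add, hx, hy]
  | path e c j p =>
    by_cases hp : p.length = 0
    · obtain rfl := Quiver.Path.eq_of_length_zero p hp
      obtain rfl := Quiver.Path.eq_nil_of_length_zero p hp
      simp only [mul_smul_comm, map_smul, rightStrip_nil, vertex_mul_ofPath]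
      split_ifs <;> simp [rightStrip_nil]
    · obtain ⟨m, hm⟩ := Nat.exists_eq_succ_of_ne_zero hp
      exact rightStrip_mul α m _ (Submodule.smul_mem _ _ (ofPath_mem p hm))

end PathAlgebra

/-! ### Bimodules -/

/-- The enveloping algebra `A ⊗ Aᵒᵖ`. An `A`-bimodule (with the same action of `F` on both sides)
is a left module over it, by `(a ⊗ b) x = a x b`. -/
def Env (F : Type u) [Field F] (A : Type v) [Ring A] [Algebra F A] : Type v :=
  A ⊗[F] Aᵐᵒᵖ

namespace Env

variable {F : Type u} [Field F] {A : Type v} [Ring A] [Algebra F A]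

instance : Ring (Env F A) := inferInstanceAs (Ring (A ⊗[F] Aᵐᵒᵖ))

instance : Algebra F (Env F A) := inferInstanceAs (Algebra F (A ⊗[F] Aᵐᵒᵖ))

variable (F) in
/-- The element `a ⊗ b` of the enveloping algebra. -/
def of (a b : A) : Env F A := (a ⊗ₜ[F] MulOpposite.op b : A ⊗[F] Aᵐᵒᵖ)

theorem of_mul_of (a b c d : A) : of F a b * of F c d = of F (a * c) (d * b) :=
  Algebra.TensorProduct.tmul_mul_tmul (R := F) a c (MulOpposite.op b) (MulOpposite.op d)

variable (F A) in
/-- The map `a ↦ a ⊗ 1`. -/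
def left : A →ₗ[F] Env F A where
  toFun a := of F a 1
  map_add' a b := TensorProduct.add_tmul a b _
  map_smul' c a := (TensorProduct.smul_tmul' c a _).symm

variable (F A) in
/-- The map `a ↦ 1 ⊗ a`. -/
def right : A →ₗ[F] Env F A where
  toFun a := of F 1 a
  map_add' a b := TensorProduct.tmul_add (1 : A) (MulOpposite.op a) (MulOpposite.op b)
  map_smul' c a := TensorProduct.tmul_smul c (1 : A) (MulOpposite.op a)

theorem left_apply (a : A) : left F A a = of F a 1 := rfl

theorem right_apply (a : A) : right F A a = of F 1 a := rfl

/-- The ring homomorphism from the enveloping algebra to its opposite that maps `a ⊗ b` to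
`b ⊗ a`; through it, right modules over the enveloping algebra become left modules. -/
def swap (F : Type u) [Field F] (A : Type v) [Ring A] [Algebra F A] :
    Env F A →+* (Env F A)ᵐᵒᵖ :=
  (((Algebra.TensorProduct.comm F A Aᵐᵒᵖ).trans
    (Algebra.TensorProduct.congr AlgEquiv.refl (AlgEquiv.opOp F A))).trans
      (Algebra.TensorProduct.opAlgEquiv F F A Aᵐᵒᵖ)).toRingEquiv.toRingHom

theorem swap_of (a b : A) : swap F A (of F a b) = MulOpposite.op (of F b a) := rfl

variable (F A) in
/-- The bimodule `A`. -/
def regular : ModuleCat.{v} (Env F A) :=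
  letI : Module (Env F A) A := (TensorProduct.Algebra.module : Module (A ⊗[F] Aᵐᵒᵖ) A)
  ModuleCat.of (Env F A) A

/-- The space `Hom_{Aᵉ}(N, Aᵉ)` of homomorphisms of bimodules from `N` to `Aᵉ`, where `Aᵉ` has its
outer bimodule structure (left multiplication in `Aᵉ`). -/
def Dual (N : ModuleCat.{v} (Env F A)) : Type v := N →ₗ[Env F A] Env F A

instance (N : ModuleCat.{v} (Env F A)) : AddCommGroup (Dual N) :=
  inferInstanceAs (AddCommGroup (N →ₗ[Env F A] Env F A))

/-- The bimodule structure on `Hom_{Aᵉ}(N, Aᵉ)` given by the inner bimodule structure of `Aᵉ`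
(right multiplication in `Aᵉ`). -/
instance (N : ModuleCat.{v} (Env F A)) : Module (Env F A) (Dual N) :=
  letI : Module (Env F A)ᵐᵒᵖ (Dual N) :=
    inferInstanceAs (Module (Env F A)ᵐᵒᵖ (N →ₗ[Env F A] Env F A))
  Module.compHom (Dual N) (swap F A)

theorem dual_smul_apply (N : ModuleCat.{v} (Env F A)) (a b : A) (f : Dual N) (x : N) :
    (show N →ₗ[Env F A] Env F A from (of F a b • f : Dual N)) x =
      (show N →ₗ[Env F A] Env F A from f) x * of F b a := rfl

/-- Precomposition with a homomorphism of bimodules. -/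
def dualMap {M N : ModuleCat.{v} (Env F A)} (g : M ⟶ N) : Dual N →ₗ[Env F A] Dual M where
  toFun f := LinearMap.comp (f : N →ₗ[Env F A] Env F A) g.hom
  map_add' _ _ := rfl
  map_smul' _ _ := rfl

/-- The complex of bimodules `Hom_{Aᵉ}(P, Aᵉ)`, with `Hom_{Aᵉ}(P^{-p}, Aᵉ)` in degree `p`. -/
def dualComplex (P : CochainComplex (ModuleCat.{v} (Env F A)) ℤ) :
    CochainComplex (ModuleCat.{v} (Env F A)) ℤ where
  X p := ModuleCat.of (Env F A) (Dual (P.X (-p)))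
  d p q := ModuleCat.ofHom (dualMap (P.d (-q) (-p)))
  shape p q h := by
    have h0 : P.d (-q) (-p) = 0 := P.shape _ _ fun h' => h (by
      simp only [ComplexShape.up_Rel] at h' ⊢
      lia)
    rw [h0]
    ext f
    exact LinearMap.comp_zero _
  d_comp_d' p q r _ _ := by
    have key : ∀ g : P.X (-p) →ₗ[Env F A] Env F A,
        LinearMap.comp (LinearMap.comp g (P.d (-q) (-p)).hom) (P.d (-r) (-q)).hom = 0 := by
      intro g
      rw [LinearMap.comp_assoc, ← ModuleCat.hom_comp, P.d_comp_d]
      exact LinearMap.comp_zero _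
    ext f
    exact key f

/-- Two complexes of bimodules are isomorphic in the derived category of bimodules. -/
def DerivedIso (X Y : CochainComplex (ModuleCat.{v} (Env F A)) ℤ) : Prop :=
  letI := HasDerivedCategory.standard (ModuleCat.{v} (Env F A))
  Nonempty (DerivedCategory.Q.obj X ≅ DerivedCategory.Q.obj Y)

/-- `RHom_{Aᵉ}(X, Aᵉ) ≅ Y` in the derived category of bimodules, for a complex `X` that is bounded
above: `RHom_{Aᵉ}(X, Aᵉ)` is the complex `Hom_{Aᵉ}(P, Aᵉ)` for a projective resolution `P` of `X`,
that is, a bounded above complex of projective bimodules with a quasi-isomorphism to `X`. -/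
def RHomDualIso (X Y : CochainComplex (ModuleCat.{v} (Env F A)) ℤ) : Prop :=
  ∃ (P : CochainComplex (ModuleCat.{v} (Env F A)) ℤ) (f : P ⟶ X),
    QuasiIso f ∧ (∀ i, Projective (P.X i)) ∧ (∃ N : ℤ, P.IsStrictlyLE N) ∧
      DerivedIso (dualComplex P) Y

end Env

/-! ### Calabi–Yau algebras -/

/-- An algebra is homologically smooth if, as a bimodule, it has a bounded resolution by finitely
generated projective bimodules. -/
def IsHomologicallySmooth (F : Type u) [Field F] (A : Type v) [Ring A] [Algebra F A] : Prop :=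
  ∃ P : ProjectiveResolution (Env.regular F A),
    (∀ p, Module.Finite (Env F A) (P.complex.X p)) ∧
      ∃ N : ℕ, ∀ p, N < p → Limits.IsZero (P.complex.X p)

/-- Calabi–Yau algebras of dimension `n` in the sense of Ginzburg: `A` is homologically smooth and
`RHom_{Aᵉ}(A, Aᵉ) ≅ A[-n]` in the derived category of bimodules. -/
def IsCalabiYau (F : Type u) [Field F] (A : Type v) [Ring A] [Algebra F A] (n : ℕ) : Prop :=
  IsHomologicallySmooth F A ∧
    Env.RHomDualIso ((HomologicalComplex.single _ (ComplexShape.up ℤ) 0).obj (Env.regular F A))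
      (((HomologicalComplex.single _ (ComplexShape.up ℤ) 0).obj (Env.regular F A))⟦(-n : ℤ)⟧)

/-! ### Quadratic quiver algebras -/

/-- A space of quadratic relations: a `k`-sub-bimodule of the span of the paths of length two. -/
structure QuadraticRelations (F : Type u) [Field F] (Q : Type v) [Quiver.{w} Q] [Fintype Q] where
  carrier : Submodule F (PathAlgebra F Q)
  le_degree : carrier ≤ PathAlgebra.degreePart F Q 2
  left_mul_le : PathAlgebra.degreePart F Q 0 * carrier ≤ carrier
  right_mul_le : carrier * PathAlgebra.degreePart F Q 0 ≤ carrier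

/-- All arrows of the quiver `Q`. -/
abbrev Arr (Q : Type v) [Quiver.{w} Q] : Type (max v w) := Σ a b : Q, a ⟶ b

namespace QuadraticRelations

open PathAlgebra

variable {F : Type u} [Field F] {Q : Type v} [Quiver.{w} Q] [Fintype Q]

/-- The two-sided ideal of the path algebra generated by the relations. -/
def relIdeal (R : QuadraticRelations F Q) : Ideal (PathAlgebra F Q) :=
  (TwoSidedIdeal.span (R.carrier : Set (PathAlgebra F Q))).asIdeal

instance (R : QuadraticRelations F Q) : R.relIdeal.IsTwoSided :=
  inferInstanceAs (TwoSidedIdeal.asIdeal _).IsTwoSided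

/-- The quadratic algebra defined by the relations: the quotient of the path algebra by the
two-sided ideal that they generate. -/
def Alg (R : QuadraticRelations F Q) : Type (max u v w) := PathAlgebra F Q ⧸ R.relIdeal

instance (R : QuadraticRelations F Q) : Ring R.Alg :=
  inferInstanceAs (Ring (PathAlgebra F Q ⧸ R.relIdeal))

instance (R : QuadraticRelations F Q) : Algebra F R.Alg :=
  inferInstanceAs (Algebra F (PathAlgebra F Q ⧸ R.relIdeal))

/-- The projection from the path algebra. -/
def proj (R : QuadraticRelations F Q) : PathAlgebra F Q →ₐ[F] R.Alg :=
  Ideal.Quotient.mkₐ F R.relIdeal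

/-- The space `W_p`: the intersection of the `V^{⊗ i} ⊗ R ⊗ V^{⊗ j}` with `i + 2 + j = p`, inside
the `p`-th tensor power of `V`. For `p = 0` and `p = 1` there is no such `(i, j)`, and this is
`k`, respectively `V`. -/
def W (R : QuadraticRelations F Q) (p : ℕ) : Submodule F (PathAlgebra F Q) :=
  degreePart F Q p ⊓
    ⨅ (i : ℕ) (j : ℕ) (_ : i + 2 + j = p), degreePart F Q i * R.carrier * degreePart F Q j

theorem leftStrip_mem_W (R : QuadraticRelations F Q) (m : ℕ) {a b : Q} (α : a ⟶ b)
    {x : PathAlgebra F Q} (hx : x ∈ R.W (m + 1)) : leftStrip α x ∈ R.W m := by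
  simp only [W, Submodule.mem_inf, Submodule.mem_iInf] at hx ⊢
  refine ⟨leftStrip_mem α m hx.1, fun i j h => ?_⟩
  have hx' := hx.2 (i + 1) j (by lia)
  rw [mul_assoc] at hx' ⊢
  clear hx
  induction hx' using Submodule.mul_induction_on' with
  | mem_mul_mem y hy z hz =>
    rw [leftStrip_mul α i hy]
    exact Submodule.mul_mem_mul (leftStrip_mem α i hy) hz
  | add y _ z _ hy hz => rw [map_add]; exact add_mem hy hz

theorem rightStrip_mem_W (R : QuadraticRelations F Q) (m : ℕ) {a b : Q} (α : a ⟶ b)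
    {x : PathAlgebra F Q} (hx : x ∈ R.W (m + 1)) : rightStrip α x ∈ R.W m := by
  simp only [W, Submodule.mem_inf, Submodule.mem_iInf] at hx ⊢
  refine ⟨rightStrip_mem α m hx.1, fun i j h => ?_⟩
  have hx' := hx.2 i (j + 1) (by lia)
  clear hx
  induction hx' using Submodule.mul_induction_on' with
  | mem_mul_mem y hy z hz =>
    rw [rightStrip_mul α j y hz]
    exact Submodule.mul_mem_mul hy (rightStrip_mem α j hz)
  | add y _ z _ hy hz => rw [map_add]; exact add_mem hy hz

/-- `leftStrip`, from `W_{m + 1}` to `W_m`. -/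
def leftW (R : QuadraticRelations F Q) (m : ℕ) {a b : Q} (α : a ⟶ b) : R.W (m + 1) →ₗ[F] R.W m :=
  (leftStrip α).restrict fun _ hx => R.leftStrip_mem_W m α hx

/-- `rightStrip`, from `W_{m + 1}` to `W_m`. -/
def rightW (R : QuadraticRelations F Q) (m : ℕ) {a b : Q} (α : a ⟶ b) :
    R.W (m + 1) →ₗ[F] R.W m :=
  (rightStrip α).restrict fun _ hx => R.rightStrip_mem_W m α hx

/-- The element `a ⊗ 1` of the enveloping algebra, for the image `a` of `x` in `A`. -/
def inl (R : QuadraticRelations F Q) : PathAlgebra F Q →ₗ[F] Env F R.Alg :=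
  Env.left F R.Alg ∘ₗ R.proj.toLinearMap

/-- The element `1 ⊗ a` of the enveloping algebra, for the image `a` of `x` in `A`. -/
def inr (R : QuadraticRelations F Q) : PathAlgebra F Q →ₗ[F] Env F R.Alg :=
  Env.right F R.Alg ∘ₗ R.proj.toLinearMap

theorem inl_mul_inl (R : QuadraticRelations F Q) (x y : PathAlgebra F Q) :
    R.inl x * R.inl y = R.inl (x * y) := by
  simp [inl, Env.left_apply, Env.of_mul_of]

theorem inr_mul_inr (R : QuadraticRelations F Q) (x y : PathAlgebra F Q) :
    R.inr x * R.inr y = R.inr (y * x) := by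
  simp [inr, Env.right_apply, Env.of_mul_of]

theorem inl_mul_inr (R : QuadraticRelations F Q) (x y : PathAlgebra F Q) :
    R.inl x * R.inr y = R.inr y * R.inl x := by
  simp [inl, inr, Env.left_apply, Env.right_apply, Env.of_mul_of]

/-- The bimodule `A ⊗_F W_p ⊗_F A`, written as `(A ⊗ Aᵒᵖ) ⊗_F W_p`: the element `(a ⊗ b) ⊗ x`
stands for `a ⊗ x ⊗ b`. -/
abbrev Pre (R : QuadraticRelations F Q) (p : ℕ) : Type (max u v w) := Env F R.Alg ⊗[F] R.W p

/-- The sub-bimodule of `A ⊗_F W_p ⊗_F A` generated by the relations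
`e_i ⊗ x ⊗ 1 = 1 ⊗ e_i x ⊗ 1` and `1 ⊗ x ⊗ e_i = 1 ⊗ x e_i ⊗ 1`. -/
def balance (R : QuadraticRelations F Q) (p : ℕ) : Submodule (Env F R.Alg) (R.Pre p) :=
  Submodule.span _
    ({y | ∃ (i : Q) (x x' : R.W p), (x' : PathAlgebra F Q) = vertex F i * x ∧
        y = R.inl (vertex F i) ⊗ₜ[F] x - 1 ⊗ₜ[F] x'} ∪
      {y | ∃ (i : Q) (x x' : R.W p), (x' : PathAlgebra F Q) = x * vertex F i ∧
        y = R.inr (vertex F i) ⊗ₜ[F] x - 1 ⊗ₜ[F] x'})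

/-- The bimodule `A ⊗_k W_p ⊗_k A`. -/
abbrev KoszulModule (R : QuadraticRelations F Q) (p : ℕ) : Type (max u v w) :=
  R.Pre p ⧸ R.balance p

theorem pre_ext (R : QuadraticRelations F Q) (m : ℕ) {M : Type*} [AddCommGroup M]
    [Module (Env F R.Alg) M] {f g : R.Pre m →ₗ[Env F R.Alg] M}
    (h : ∀ x : R.W m, f (1 ⊗ₜ x) = g (1 ⊗ₜ x)) : f = g := by
  ext y
  induction y using TensorProduct.induction_on with
  | zero => simp
  | add y z hy hz => rw [map_add, map_add, hy, hz]
  | tmul u x =>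
    have e : (u ⊗ₜ[F] x : R.Pre m) = u • (1 ⊗ₜ[F] x : R.Pre m) := by
      rw [TensorProduct.smul_tmul', smul_eq_mul, mul_one]
    rw [e, map_smul, map_smul, h]

/-- The inclusion of `A ⊗_F W_p ⊗_F A` into the tensor product with the whole path algebra. -/
def incl (R : QuadraticRelations F Q) (m : ℕ) :
    R.Pre m →ₗ[F] Env F R.Alg ⊗[F] PathAlgebra F Q :=
  LinearMap.lTensor (Env F R.Alg) (R.W m).subtype

theorem incl_injective (R : QuadraticRelations F Q) (m : ℕ) : Function.Injective (R.incl m) :=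
  Module.Flat.lTensor_preserves_injective_linearMap _ (Submodule.injective_subtype _)

theorem incl_tmul (R : QuadraticRelations F Q) (m : ℕ) (u : Env F R.Alg) (x : R.W m) :
    R.incl m (u ⊗ₜ x) = u ⊗ₜ (x : PathAlgebra F Q) := rfl

theorem proj_eq_zero (R : QuadraticRelations F Q) {x : PathAlgebra F Q} (hx : x ∈ R.carrier) :
    R.proj x = 0 := by
  have h : x ∈ R.relIdeal := TwoSidedIdeal.mem_asIdeal.2 (TwoSidedIdeal.subset_span hx)
  exact Ideal.Quotient.eq_zero_iff_mem.2 h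

theorem inl_eq_zero (R : QuadraticRelations F Q) {x : PathAlgebra F Q} (hx : x ∈ R.carrier) :
    R.inl x = 0 := by
  rw [inl, LinearMap.comp_apply, AlgHom.toLinearMap_apply, R.proj_eq_zero hx, map_zero]

theorem inr_eq_zero (R : QuadraticRelations F Q) {x : PathAlgebra F Q} (hx : x ∈ R.carrier) :
    R.inr x = 0 := by
  rw [inr, LinearMap.comp_apply, AlgHom.toLinearMap_apply, R.proj_eq_zero hx, map_zero]

variable [∀ a b : Q, Fintype (a ⟶ b)]

/-- The map `a ⊗ x_1 ⋯ x_p ⊗ b ↦ a x_1 ⊗ x_2 ⋯ x_p ⊗ b`, for `p = m + 1`. -/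
def preLeft (R : QuadraticRelations F Q) (m : ℕ) : R.Pre (m + 1) →ₗ[Env F R.Alg] R.Pre m :=
  ∑ α : Arr Q, TensorProduct.AlgebraTensorModule.map
    (LinearMap.toSpanSingleton (Env F R.Alg) (Env F R.Alg) (R.inl (arrow F α.2.2))) (R.leftW m α.2.2)

/-- The map `a ⊗ x_1 ⋯ x_p ⊗ b ↦ a ⊗ x_1 ⋯ x_{p - 1} ⊗ x_p b`, for `p = m + 1`. -/
def preRight (R : QuadraticRelations F Q) (m : ℕ) : R.Pre (m + 1) →ₗ[Env F R.Alg] R.Pre m :=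
  ∑ α : Arr Q, TensorProduct.AlgebraTensorModule.map
    (LinearMap.toSpanSingleton (Env F R.Alg) (Env F R.Alg) (R.inr (arrow F α.2.2))) (R.rightW m α.2.2)

/-- The Koszul differential, before passing from `⊗_F` to `⊗_k`. -/
def preD (R : QuadraticRelations F Q) (m : ℕ) : R.Pre (m + 1) →ₗ[Env F R.Alg] R.Pre m :=
  R.preLeft m + (-1 : ℤ) ^ (m + 1) • R.preRight m

theorem preLeft_tmul (R : QuadraticRelations F Q) (m : ℕ) (u : Env F R.Alg) (x : R.W (m + 1)) :
    R.preLeft m (u ⊗ₜ x) =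
      ∑ α : Arr Q, (u * R.inl (arrow F α.2.2)) ⊗ₜ R.leftW m α.2.2 x := by
  simp [preLeft, LinearMap.sum_apply]

theorem preRight_tmul (R : QuadraticRelations F Q) (m : ℕ) (u : Env F R.Alg) (x : R.W (m + 1)) :
    R.preRight m (u ⊗ₜ x) =
      ∑ α : Arr Q, (u * R.inr (arrow F α.2.2)) ⊗ₜ R.rightW m α.2.2 x := by
  simp [preRight, LinearMap.sum_apply]

theorem preLeft_preRight (R : QuadraticRelations F Q) (m : ℕ) :
    R.preLeft m ∘ₗ R.preRight (m + 1) = R.preRight m ∘ₗ R.preLeft (m + 1) := by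
  refine R.pre_ext _ fun x => ?_
  rw [LinearMap.comp_apply, LinearMap.comp_apply, preLeft_tmul, preRight_tmul, map_sum, map_sum]
  have e1 : ∀ β : Arr Q, R.preLeft m ((1 * R.inr (arrow F β.2.2)) ⊗ₜ R.rightW (m + 1) β.2.2 x) =
      ∑ α : Arr Q, (R.inr (arrow F β.2.2) * R.inl (arrow F α.2.2)) ⊗ₜ
        R.leftW m α.2.2 (R.rightW (m + 1) β.2.2 x) := fun β => by rw [preLeft_tmul, one_mul]
  have e2 : ∀ α : Arr Q, R.preRight m ((1 * R.inl (arrow F α.2.2)) ⊗ₜ R.leftW (m + 1) α.2.2 x) =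
      ∑ β : Arr Q, (R.inl (arrow F α.2.2) * R.inr (arrow F β.2.2)) ⊗ₜ
        R.rightW m β.2.2 (R.leftW (m + 1) α.2.2 x) := fun β => by rw [preRight_tmul, one_mul]
  rw [Finset.sum_congr rfl fun β _ => e1 β, Finset.sum_congr rfl fun α _ => e2 α,
    Finset.sum_comm]
  refine Finset.sum_congr rfl fun α _ => Finset.sum_congr rfl fun β _ => ?_
  rw [inl_mul_inr]
  congr 1
  exact Subtype.ext (leftStrip_rightStrip α.2.2 β.2.2 (x : PathAlgebra F Q))

/-- Strip two arrows on the left, and put their product in front. -/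
def leftTwo (R : QuadraticRelations F Q) :
    PathAlgebra F Q →ₗ[F] Env F R.Alg ⊗[F] PathAlgebra F Q :=
  ∑ α : Arr Q, ∑ β : Arr Q,
    (TensorProduct.mk F (Env F R.Alg) (PathAlgebra F Q)
      (R.inl (arrow F α.2.2 * arrow F β.2.2))) ∘ₗ (leftStrip β.2.2 ∘ₗ leftStrip α.2.2)

/-- Strip two arrows on the right, and put their product behind. -/
def rightTwo (R : QuadraticRelations F Q) :
    PathAlgebra F Q →ₗ[F] Env F R.Alg ⊗[F] PathAlgebra F Q :=
  ∑ α : Arr Q, ∑ β : Arr Q,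
    (TensorProduct.mk F (Env F R.Alg) (PathAlgebra F Q)
      (R.inr (arrow F β.2.2 * arrow F α.2.2))) ∘ₗ (rightStrip β.2.2 ∘ₗ rightStrip α.2.2)

theorem leftTwo_apply (R : QuadraticRelations F Q) (x : PathAlgebra F Q) :
    R.leftTwo x = ∑ α : Arr Q, ∑ β : Arr Q, R.inl (arrow F α.2.2 * arrow F β.2.2) ⊗ₜ
      leftStrip β.2.2 (leftStrip α.2.2 x) := by
  simp [leftTwo, LinearMap.sum_apply]

theorem rightTwo_apply (R : QuadraticRelations F Q) (x : PathAlgebra F Q) :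
    R.rightTwo x = ∑ α : Arr Q, ∑ β : Arr Q, R.inr (arrow F β.2.2 * arrow F α.2.2) ⊗ₜ
      rightStrip β.2.2 (rightStrip α.2.2 x) := by
  simp [rightTwo, LinearMap.sum_apply]

theorem leftTwo_path (R : QuadraticRelations F Q) {i a b c : Q} (q : Quiver.Path i a) (β : a ⟶ b)
    (α : b ⟶ c) : R.leftTwo (ofPath F ((q.cons β).cons α)) =
      R.inl (arrow F α * arrow F β) ⊗ₜ ofPath F q := by
  rw [leftTwo_apply, Finset.sum_eq_single (⟨b, c, α⟩ : Arr Q),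
    Finset.sum_eq_single (⟨a, b, β⟩ : Arr Q), leftStrip_cons, leftStrip_cons]
  · intro β' _ h
    rw [leftStrip_cons, leftStrip_cons_of_ne β'.2.2 β _ h, tmul_zero]
  · simp
  · intro α' _ h
    refine Finset.sum_eq_zero fun β' _ => ?_
    rw [leftStrip_cons_of_ne α'.2.2 α _ h, map_zero, tmul_zero]
  · simp

theorem rightTwo_path (R : QuadraticRelations F Q) {j a b c : Q} (q : Quiver.Path c j)
    (β : b ⟶ c) (α : a ⟶ b) : R.rightTwo (ofPath F (α.toPath.comp (β.toPath.comp q))) =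
      R.inr (arrow F β * arrow F α) ⊗ₜ ofPath F q := by
  rw [rightTwo_apply, Finset.sum_eq_single (⟨a, b, α⟩ : Arr Q),
    Finset.sum_eq_single (⟨b, c, β⟩ : Arr Q), rightStrip_comp, rightStrip_comp]
  · intro β' _ h
    rw [rightStrip_comp, rightStrip_comp_of_ne β'.2.2 β _ h, tmul_zero]
  · simp
  · intro α' _ h
    refine Finset.sum_eq_zero fun β' _ => ?_
    rw [rightStrip_comp_of_ne α'.2.2 α _ h, map_zero, tmul_zero]
  · simp

theorem leftTwo_mul (R : QuadraticRelations F Q) {x : PathAlgebra F Q}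
    (hx : x ∈ degreePart F Q 2) (y : PathAlgebra F Q) :
    R.leftTwo (x * y) = ∑ i : Q, R.inl (x * vertex F i) ⊗ₜ (vertex F i * y) := by
  classical
  induction hx using Submodule.span_induction with
  | zero => simp
  | add x x' _ _ hx hx' =>
    simp only [add_mul, map_add, add_tmul, Finset.sum_add_distrib, hx, hx']
  | smul c x _ hx =>
    simp only [smul_mul_assoc, map_smul, ← smul_tmul', ← Finset.smul_sum, hx]
  | mem x hx =>
  obtain ⟨i, j, p, hp, rfl⟩ := hx
  induction y using induction with
  | zero => simp
  | add x x' hx hx' => simp only [mul_add, map_add, tmul_add, Finset.sum_add_distrib, hx, hx']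
  | path e i' j' r =>
  simp only [mul_smul_comm, map_smul, tmul_smul, ← Finset.smul_sum]
  congr 1
  simp only [ofPath_mul_vertex, vertex_mul_ofPath]
  rw [Finset.sum_eq_single i (fun k _ hk => by rw [if_neg hk, map_zero, zero_tmul])
    (fun h => absurd (Finset.mem_univ _) h), if_pos rfl]
  obtain ⟨k, p, α, rfl⟩ := (Quiver.Path.length_ne_zero_iff_eq_cons p).1 (by lia)
  obtain ⟨l, p, β, rfl⟩ := (Quiver.Path.length_ne_zero_iff_eq_cons p).1 (by simp at hp; lia)
  have hp : p.length = 0 := by simpa using hp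
  obtain rfl := Quiver.Path.eq_of_length_zero p hp
  obtain rfl := Quiver.Path.eq_nil_of_length_zero p hp
  by_cases h : j' = i
  · subst h
    rw [if_pos rfl, ofPath_mul_ofPath]
    refine (R.leftTwo_path r β α).trans ?_
    rw [arrow, arrow, ofPath_mul_ofPath]
    rfl
  · rw [ofPath_mul_ofPath_of_ne _ _ h, if_neg (Ne.symm h), map_zero, tmul_zero]

theorem rightTwo_mul (R : QuadraticRelations F Q) (x : PathAlgebra F Q) {y : PathAlgebra F Q}
    (hy : y ∈ degreePart F Q 2) :
    R.rightTwo (x * y) = ∑ i : Q, R.inr (vertex F i * y) ⊗ₜ (x * vertex F i) := by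
  classical
  induction hy using Submodule.span_induction with
  | zero => simp
  | add x x' _ _ hx hx' =>
    simp only [mul_add, map_add, add_tmul, Finset.sum_add_distrib, hx, hx']
  | smul c x _ hx =>
    simp only [mul_smul_comm, map_smul, ← smul_tmul', ← Finset.smul_sum, hx]
  | mem y hy =>
  obtain ⟨i, j, p, hp, rfl⟩ := hy
  induction x using induction with
  | zero => simp
  | add x x' hx hx' => simp only [add_mul, map_add, tmul_add, Finset.sum_add_distrib, hx, hx']
  | path e i' j' r =>
  simp only [smul_mul_assoc, map_smul, tmul_smul, ← Finset.smul_sum]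
  congr 1
  simp only [ofPath_mul_vertex, vertex_mul_ofPath]
  rw [Finset.sum_eq_single j (fun k _ hk => by rw [if_neg hk, map_zero, zero_tmul])
    (fun h => absurd (Finset.mem_univ _) h), if_pos rfl]
  obtain ⟨k, p, β, rfl⟩ := (Quiver.Path.length_ne_zero_iff_eq_cons p).1 (by lia)
  obtain ⟨l, p, α, rfl⟩ := (Quiver.Path.length_ne_zero_iff_eq_cons p).1 (by simp at hp; lia)
  have hp : p.length = 0 := by simpa using hp
  obtain rfl := Quiver.Path.eq_of_length_zero p hp
  obtain rfl := Quiver.Path.eq_nil_of_length_zero p hp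
  by_cases h : j = i'
  · subst h
    rw [if_pos rfl, ofPath_mul_ofPath]
    have e : ((Quiver.Path.nil.cons α).cons β).comp r = α.toPath.comp (β.toPath.comp r) := by
      rw [← Quiver.Path.comp_assoc]
      rfl
    rw [e, R.rightTwo_path r β α, arrow, arrow, ofPath_mul_ofPath]
    rfl
  · rw [ofPath_mul_ofPath_of_ne _ _ h, if_neg h, map_zero, tmul_zero]

theorem leftTwo_eq_zero (R : QuadraticRelations F Q) (m : ℕ) {x : PathAlgebra F Q}
    (hx : x ∈ R.W (m + 2)) : R.leftTwo x = 0 := by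
  simp only [W, Submodule.mem_inf, Submodule.mem_iInf] at hx
  have hx' := hx.2 0 m (by lia)
  clear hx
  induction hx' using Submodule.mul_induction_on' with
  | mem_mul_mem y hy z hz =>
    have hy := R.left_mul_le hy
    rw [leftTwo_mul R (R.le_degree hy)]
    refine Finset.sum_eq_zero fun i _ => ?_
    rw [R.inl_eq_zero (R.right_mul_le (Submodule.mul_mem_mul hy (vertex_mem i))), zero_tmul]
  | add y _ z _ hy hz => rw [map_add, hy, hz, add_zero]

theorem rightTwo_eq_zero (R : QuadraticRelations F Q) (m : ℕ) {x : PathAlgebra F Q}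
    (hx : x ∈ R.W (m + 2)) : R.rightTwo x = 0 := by
  simp only [W, Submodule.mem_inf, Submodule.mem_iInf] at hx
  have hx' := hx.2 m 0 (by lia)
  rw [mul_assoc] at hx'
  clear hx
  induction hx' using Submodule.mul_induction_on' with
  | mem_mul_mem y hy z hz =>
    have hz := R.right_mul_le hz
    rw [rightTwo_mul R _ (R.le_degree hz)]
    refine Finset.sum_eq_zero fun i _ => ?_
    rw [R.inr_eq_zero (R.left_mul_le (Submodule.mul_mem_mul (vertex_mem i) hz)), zero_tmul]
  | add y _ z _ hy hz => rw [map_add, hy, hz, add_zero]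

theorem preLeft_preLeft (R : QuadraticRelations F Q) (m : ℕ) :
    R.preLeft m ∘ₗ R.preLeft (m + 1) = 0 := by
  refine R.pre_ext _ fun x => R.incl_injective m ?_
  rw [LinearMap.comp_apply, preLeft_tmul, map_sum, LinearMap.zero_apply, map_zero,
    ← R.leftTwo_eq_zero m x.2, leftTwo_apply, map_sum]
  refine Finset.sum_congr rfl fun α _ => ?_
  rw [preLeft_tmul, map_sum]
  refine Finset.sum_congr rfl fun β _ => ?_
  rw [one_mul, inl_mul_inl, incl_tmul]
  rfl

theorem preRight_preRight (R : QuadraticRelations F Q) (m : ℕ) :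
    R.preRight m ∘ₗ R.preRight (m + 1) = 0 := by
  refine R.pre_ext _ fun x => R.incl_injective m ?_
  rw [LinearMap.comp_apply, preRight_tmul, map_sum, LinearMap.zero_apply, map_zero,
    ← R.rightTwo_eq_zero m x.2, rightTwo_apply, map_sum]
  refine Finset.sum_congr rfl fun α _ => ?_
  rw [preRight_tmul, map_sum]
  refine Finset.sum_congr rfl fun β _ => ?_
  rw [one_mul, inr_mul_inr, incl_tmul]
  rfl

theorem preD_preD (R : QuadraticRelations F Q) (m : ℕ) (y : R.Pre (m + 1 + 1)) :
    R.preD m (R.preD (m + 1) y) = 0 := by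
  have h1 : R.preLeft m (R.preLeft (m + 1) y) = 0 := LinearMap.congr_fun (R.preLeft_preLeft m) y
  have h2 : R.preRight m (R.preRight (m + 1) y) = 0 :=
    LinearMap.congr_fun (R.preRight_preRight m) y
  have h3 : R.preLeft m (R.preRight (m + 1) y) = R.preRight m (R.preLeft (m + 1) y) :=
    LinearMap.congr_fun (R.preLeft_preRight m) y
  simp only [preD, LinearMap.add_apply, LinearMap.smul_apply, map_add, map_zsmul, h1, h2, h3]
  simp [pow_succ]

theorem preLeft_balance_le (R : QuadraticRelations F Q) (m : ℕ) :
    R.balance (m + 1) ≤ (R.balance m).comap (R.preLeft m) := by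
  classical
  refine Submodule.span_le.2 ?_
  rintro _ (⟨i, x, x', hx, rfl⟩ | ⟨i, x, x', hx, rfl⟩)
  · refine SetLike.mem_coe.2 (Submodule.mem_comap.2 ?_)
    rw [map_sub, preLeft_tmul, preLeft_tmul, ← Finset.sum_sub_distrib]
    refine sum_mem fun α _ => ?_
    have h : R.leftW m α.2.2 x' = if i = α.2.1 then R.leftW m α.2.2 x else 0 := by
      apply Subtype.ext
      change leftStrip α.2.2 (x' : PathAlgebra F Q) = _
      rw [hx, leftStrip_vertex_mul]
      split_ifs <;> rfl
    rw [h, inl_mul_inl, one_mul, arrow, vertex_mul_ofPath]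
    split_ifs
    · rw [sub_self]; exact zero_mem _
    · rw [map_zero, zero_tmul, tmul_zero, sub_self]; exact zero_mem _
  · refine SetLike.mem_coe.2 (Submodule.mem_comap.2 ?_)
    rw [map_sub, preLeft_tmul, preLeft_tmul, ← Finset.sum_sub_distrib]
    refine sum_mem fun α _ => ?_
    have h : R.inr (vertex F i) ⊗ₜ[F] R.leftW m α.2.2 x - 1 ⊗ₜ[F] R.leftW m α.2.2 x' ∈
        R.balance m := by
      refine Submodule.subset_span (Or.inr ⟨i, _, _, ?_, rfl⟩)
      change leftStrip α.2.2 (x' : PathAlgebra F Q) = leftStrip α.2.2 (x : PathAlgebra F Q) * _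
      rw [hx, leftStrip_mul_vertex]
    have h' := Submodule.smul_mem _ (R.inl (arrow F α.2.2)) h
    rwa [smul_sub, TensorProduct.smul_tmul', TensorProduct.smul_tmul', smul_eq_mul, smul_eq_mul,
      mul_one, inl_mul_inr, ← one_mul (R.inl (arrow F α.2.2)), ← mul_assoc, mul_one] at h'

theorem preRight_balance_le (R : QuadraticRelations F Q) (m : ℕ) :
    R.balance (m + 1) ≤ (R.balance m).comap (R.preRight m) := by
  classical
  refine Submodule.span_le.2 ?_
  rintro _ (⟨i, x, x', hx, rfl⟩ | ⟨i, x, x', hx, rfl⟩)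
  · refine SetLike.mem_coe.2 (Submodule.mem_comap.2 ?_)
    rw [map_sub, preRight_tmul, preRight_tmul, ← Finset.sum_sub_distrib]
    refine sum_mem fun α _ => ?_
    have h : R.inl (vertex F i) ⊗ₜ[F] R.rightW m α.2.2 x - 1 ⊗ₜ[F] R.rightW m α.2.2 x' ∈
        R.balance m := by
      refine Submodule.subset_span (Or.inl ⟨i, _, _, ?_, rfl⟩)
      change rightStrip α.2.2 (x' : PathAlgebra F Q) = _ * rightStrip α.2.2 (x : PathAlgebra F Q)
      rw [hx, rightStrip_vertex_mul]
    have h' := Submodule.smul_mem _ (R.inr (arrow F α.2.2)) h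
    rwa [smul_sub, TensorProduct.smul_tmul', TensorProduct.smul_tmul', smul_eq_mul, smul_eq_mul,
      mul_one, ← inl_mul_inr, ← one_mul (R.inr (arrow F α.2.2)), ← mul_assoc, mul_one] at h'
  · refine SetLike.mem_coe.2 (Submodule.mem_comap.2 ?_)
    rw [map_sub, preRight_tmul, preRight_tmul, ← Finset.sum_sub_distrib]
    refine sum_mem fun α _ => ?_
    have h : R.rightW m α.2.2 x' = if i = α.1 then R.rightW m α.2.2 x else 0 := by
      apply Subtype.ext
      change rightStrip α.2.2 (x' : PathAlgebra F Q) = _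
      rw [hx, rightStrip_mul_vertex]
      split_ifs <;> rfl
    rw [h, inr_mul_inr, one_mul, arrow, ofPath_mul_vertex]
    split_ifs
    · rw [sub_self]; exact zero_mem _
    · rw [map_zero, zero_tmul, tmul_zero, sub_self]; exact zero_mem _

theorem balance_le (R : QuadraticRelations F Q) (m : ℕ) :
    R.balance (m + 1) ≤ (R.balance m).comap (R.preD m) := by
  intro y hy
  have h1 : R.preLeft m y ∈ R.balance m := R.preLeft_balance_le m hy
  have h2 : R.preRight m y ∈ R.balance m := R.preRight_balance_le m hy
  exact add_mem h1 (zsmul_mem h2 _)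

/-- The differential `A ⊗_k W_{m + 1} ⊗_k A → A ⊗_k W_m ⊗_k A` of the Koszul complex: with
`p = m + 1`, it maps `a ⊗ x_1 ⋯ x_p ⊗ b` to
`a x_1 ⊗ x_2 ⋯ x_p ⊗ b + (-1) ^ p a ⊗ x_1 ⋯ x_{p - 1} ⊗ x_p b`. -/
def koszulD (R : QuadraticRelations F Q) (m : ℕ) :
    R.KoszulModule (m + 1) →ₗ[Env F R.Alg] R.KoszulModule m :=
  Submodule.mapQ _ _ (R.preD m) (R.balance_le m)

theorem koszulD_mk (R : QuadraticRelations F Q) (m : ℕ) (y : R.Pre (m + 1)) :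
    R.koszulD m (Submodule.Quotient.mk y) = Submodule.Quotient.mk (R.preD m y) := rfl

theorem koszulD_koszulD (R : QuadraticRelations F Q) (m : ℕ) :
    R.koszulD m ∘ₗ R.koszulD (m + 1) = 0 := by
  refine LinearMap.ext fun z => ?_
  obtain ⟨y, rfl⟩ := Submodule.Quotient.mk_surjective _ z
  rw [LinearMap.comp_apply, koszulD_mk, koszulD_mk, preD_preD, Submodule.Quotient.mk_zero,
    LinearMap.zero_apply]

/-- The Koszul bimodule complex `K(A)`. -/
def koszulComplex (R : QuadraticRelations F Q) :
    ChainComplex (ModuleCat.{max u v w} (Env F R.Alg)) ℕ :=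
  ChainComplex.of (fun m => ModuleCat.of (Env F R.Alg) (R.KoszulModule m))
    (fun m => ModuleCat.ofHom (R.koszulD m))
    (fun m => by rw [← ModuleCat.ofHom_comp, koszulD_koszulD]; rfl)

/-- The Koszul complex as a cochain complex, with `K(A)_p` in degree `-p`. -/
def koszulCochain (R : QuadraticRelations F Q) :
    CochainComplex (ModuleCat.{max u v w} (Env F R.Alg)) ℤ :=
  R.koszulComplex.extend ComplexShape.embeddingDownNat

/-- The algebra is Koszul: the homology of `K(A)` is zero in all degrees greater than one. -/
def IsKoszul (R : QuadraticRelations F Q) : Prop :=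
  ∀ p : ℕ, 1 < p → R.koszulComplex.ExactAt p

/-- The Koszul complex has length `n`. -/
def HasLength (R : QuadraticRelations F Q) (n : ℕ) : Prop :=
  ¬ Limits.IsZero (R.koszulComplex.X n) ∧ ∀ p : ℕ, n < p → Limits.IsZero (R.koszulComplex.X p)

/-- Koszul complex Calabi–Yau algebras of dimension `n`: the complex `K(A)` has length `n`, and
`RHom_{Aᵉ}(K(A), Aᵉ) ≅ K(A)[-n]` in the derived category of bimodules. -/
def IsKcCalabiYau (R : QuadraticRelations F Q) (n : ℕ) : Prop :=
  R.HasLength n ∧ Env.RHomDualIso R.koszulCochain (R.koszulCochain⟦(-n : ℤ)⟧)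

end QuadraticRelations

/-! ### Preprojective algebras -/

section Preprojective

open PathAlgebra

instance (Q : Type v) [Fintype Q] : Fintype (Quiver.Symmetrify Q) := inferInstanceAs (Fintype Q)

instance (Q : Type v) [Quiver.{w} Q] [∀ a b : Q, Fintype (a ⟶ b)] (a b : Quiver.Symmetrify Q) :
    Fintype (a ⟶ b) :=
  inferInstanceAs (Fintype (((show Q from a) ⟶ (show Q from b)) ⊕
    ((show Q from b) ⟶ (show Q from a))))

variable (F : Type u) [Field F] (Q : Type v) [Quiver.{w} Q] [Fintype Q]
  [∀ a b : Q, Fintype (a ⟶ b)]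

/-- The preprojective relation at the vertex `i`, in the path algebra of the double quiver: the sum
of the `a a*` over the arrows `a` of `Q` with target `i`, minus the sum of the `a* a` over the
arrows `a` of `Q` with source `i`. -/
def preprojectiveRelation (i : Q) : PathAlgebra F (Quiver.Symmetrify Q) :=
  ∑ j : Q, ∑ a : j ⟶ i, arrow F a.toPos * arrow F a.toNeg -
    ∑ j : Q, ∑ a : i ⟶ j, arrow F a.toNeg * arrow F a.toPos

/-- The relations of the preprojective algebra: the `k`-bimodule generated by the preprojective
relations of all the vertices. The algebra `(preprojective F Q).Alg` is the preprojective algebra of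
the underlying graph of `Q`. -/
def preprojective : QuadraticRelations F (Quiver.Symmetrify Q) where
  carrier := degreePart F (Quiver.Symmetrify Q) 0 *
    Submodule.span F (Set.range (preprojectiveRelation F Q)) *
      degreePart F (Quiver.Symmetrify Q) 0
  le_degree := by
    have h : Submodule.span F (Set.range (preprojectiveRelation F Q)) ≤
        degreePart F (Quiver.Symmetrify Q) 2 := by
      rw [Submodule.span_le]
      rintro _ ⟨i, rfl⟩
      have e : ∀ {a b c d : Quiver.Symmetrify Q} (α : a ⟶ b) (β : c ⟶ d),
          arrow F α * arrow F β ∈ degreePart F (Quiver.Symmetrify Q) 2 := fun α β =>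
        degreePart_mul_le 1 1 (Submodule.mul_mem_mul (ofPath_mem _ rfl) (ofPath_mem _ rfl))
      exact sub_mem (sum_mem fun j _ => sum_mem fun a _ => e _ _)
        (sum_mem fun j _ => sum_mem fun a _ => e _ _)
    exact (mul_le_mul' ((mul_le_mul' le_rfl h).trans (degreePart_mul_le 0 2)) le_rfl).trans
      (degreePart_mul_le 2 0)
  left_mul_le := by
    rw [← mul_assoc, ← mul_assoc]
    exact mul_le_mul' (mul_le_mul' (degreePart_mul_le 0 0) le_rfl) le_rfl
  right_mul_le := by
    rw [mul_assoc]
    exact mul_le_mul' le_rfl (degreePart_mul_le 0 0)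

end Preprojective

section Graph

variable (Q : Type v) [Quiver.{w} Q]

/-- The underlying graph of the quiver is connected. -/
def IsConnectedQuiver : Prop :=
  Nonempty Q ∧ ∀ i j : Quiver.Symmetrify Q, Nonempty (Quiver.Path i j)

variable [∀ a b : Q, Fintype (a ⟶ b)]

open scoped Classical in
/-- The Cartan matrix of the underlying graph: `2` times the identity matrix minus the adjacency
matrix, where edges are counted with multiplicity and loops twice. It determines the graph. -/
def graphCartan : Matrix Q Q ℤ :=
  Matrix.of fun i j =>
    (if i = j then 2 else 0) - (Fintype.card (i ⟶ j) + Fintype.card (j ⟶ i) : ℤ)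

/-- The underlying graph is the Dynkin graph whose Cartan matrix is `C`. -/
def HasGraph {n : ℕ} (C : Matrix (Fin n) (Fin n) ℤ) : Prop :=
  ∃ e : Q ≃ Fin n, ∀ i j : Q, graphCartan Q i j = C (e i) (e j)

/-- The underlying graph is a Dynkin graph of type `A_n` (`n ≥ 1`), `D_n` (`n ≥ 4`), `E_6`, `E_7` or
`E_8`. -/
def IsDynkinADE : Prop :=
  (∃ n : ℕ, 1 ≤ n ∧ HasGraph Q (CartanMatrix.A n)) ∨
    (∃ n : ℕ, 4 ≤ n ∧ HasGraph Q (CartanMatrix.D n)) ∨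
      HasGraph Q CartanMatrix.E₆ ∨ HasGraph Q CartanMatrix.E₇ ∨ HasGraph Q CartanMatrix.E₈

end Graph

end QuiverKoszul

end

/-!
The first assertion compares two derived duals. For every quadratic quiver algebra `A`, the Koszul
complex augments to `A` and is exact in degrees zero and one
(`QuadraticRelations.mem_range_koszulD_zero`, `QuadraticRelations.mem_range_koszulD_one`): in
degree one, a derivation of `A` with values in the cokernel of `K₂ → K₁` provides a left inverse
of the map from this cokernel to `K₀`. Its terms are finitely generated projective bimodules.
Hence for a Koszul algebra the Koszul complex is a projective resolution of `A`, so that `RHom`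
out of it is `RHom` out of `A`, and the two conditions on derived duals are equivalent. It remains
to see that a Calabi–Yau algebra of dimension `n` has a Koszul complex of length `n`. The Koszul
complex is minimal: the bimodule maps to the base field given by a linear form on `W_p` and two
vertices kill the boundaries (`QuadraticRelations.map_koszulD_eq_zero`). As `A` is homologically
smooth, some homotopy contracts the identity of the Koszul complex in high degrees, and minimality
makes these terms vanish. Minimality also prevents the dual of the last differential from being
onto, so the last nonzero degree is one where the dual complex has cohomology, which is `n`
(`QuadraticRelations.hasLength_of_isCalabiYau`).

For a preprojective algebra `Π`, everything rests on the vanishing of the right socle: an element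
annihilated by right multiplication by all the arrows is zero
(`Preproj.eq_zero_of_mul_ar_eq_zero`). The defining relations imply that a family `(y_α)` with `∑
ε_α y_α α* = 0` has the form `(x α)` (`Preproj.exists_mul_ar_eq`). Using this to solve equations
degree by degree, a nonzero homogeneous socle element in `e_j Π e_i` is extended to an injective
homomorphism from the graded dual of `Π e_i` to `e_j Π` (`Preproj.exists_layer`). A nonzero
multiple of `e_j` is among its values, and these are annihilated by long paths, so that `e_j Π` is
finite-dimensional. This property passes to the neighbours of `j`, hence to all the vertices, and
then counting dimensions in `Π e_i → ⨁ Π e_{s(α)} → Π e_i → F → 0` gives positive integers `x` for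
which `2 x_i - ∑ x_{s(α)} ≥ 1` at every vertex. Pairing `x` with a nonzero weight `δ ≥ 0` such
that `2 δ_i ≤ ∑ δ_{s(α)}` is a contradiction. Once the socle vanishes, the map `K₂ → K₁` is
injective and `W₃ = 0`, so `Π` is Koszul with a Koszul complex of length two; sending an arrow `α`
to `± α*` identifies this complex with its dual, up to a shift by two, and the dual is therefore a
resolution of `Π`.

The weight `δ` exists because a connected graph that is not a Dynkin graph contains an extended
Dynkin graph, whose minimal imaginary root can be taken for `δ` (`exists_weight`). Conversely
phrased: in a graph without such a weight there are no loops, multiple edges or cycles, a branch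
vertex is unique and of valency three, and the arms at this vertex are short
(`Multigraph.HasNoWeight`), so that a longest path together with what is attached to it exhausts
the graph and displays it as of type `A`, `D` or `E`.
-/

noncomputable section

set_option linter.unusedSectionVars false

open CategoryTheory TensorProduct

namespace QuiverKoszul

/-! ### Homomorphisms out of path algebras and quadratic algebras -/

namespace PathAlgebra

variable {F : Type u} [Field F] {Q : Type v} [Quiver.{w} Q] [Fintype Q]

/-- The algebra homomorphism out of the path algebra given by a multiplicative family of elements,
one for each path. -/
def liftHom {B : Type*} [Ring B] [Algebra F B] (φ : ∀ {a b : Q}, Quiver.Path a b → B)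
    (h1 : ∑ i : Q, φ (Quiver.Path.nil : Quiver.Path i i) = 1)
    (hmul : ∀ (a b c : Q) (p : Quiver.Path b c) (q : Quiver.Path a b), φ p * φ q = φ (q.comp p))
    (hzero : ∀ (a b c d : Q) (p : Quiver.Path c d) (q : Quiver.Path a b), b ≠ c →
      φ p * φ q = 0) : PathAlgebra F Q →ₐ[F] B :=
  let g : PathAlgebra F Q →ₗ[F] B :=
    Finsupp.linearCombination F (fun p : QPath Q => φ p.2.2)
  have hl : ∀ {a b : Q} (p : Quiver.Path a b), g (ofPath F p) = φ p := fun {a b} p =>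
    (Finsupp.linearCombination_single F (1 : F) (⟨a, b, p⟩ : QPath Q)).trans (one_smul F _)
  AlgHom.ofLinearMap g
    (by rw [one_def', map_sum, ← h1]; exact Finset.sum_congr rfl fun i _ => hl _)
    (by
      intro x y
      induction x using induction with
      | zero => simp
      | add x x' hx hx' => rw [add_mul, map_add, map_add, hx, hx', add_mul]
      | path c a b p =>
      induction y using induction with
      | zero => simp
      | add x x' hx hx' => rw [mul_add, map_add, map_add, hx, hx', mul_add]
      | path d a' b' q =>
      simp only [smul_mul_assoc, mul_smul_comm, map_smul, hl]
      by_cases h : b' = a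
      · subst h
        rw [hmul _ _ _, ofPath_mul_ofPath, hl]
      · rw [hzero _ _ _ _ _ _ h, ofPath_mul_ofPath_of_ne _ _ h, map_zero])

theorem liftHom_ofPath {B : Type*} [Ring B] [Algebra F B] (φ : ∀ {a b : Q}, Quiver.Path a b → B)
    (h1 : ∑ i : Q, φ (Quiver.Path.nil : Quiver.Path i i) = 1)
    (hmul : ∀ (a b c : Q) (p : Quiver.Path b c) (q : Quiver.Path a b), φ p * φ q = φ (q.comp p))
    (hzero : ∀ (a b c d : Q) (p : Quiver.Path c d) (q : Quiver.Path a b), b ≠ c →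
      φ p * φ q = 0) {a b : Q} (p : Quiver.Path a b) :
    liftHom (F := F) φ h1 hmul hzero (ofPath F p) = φ p :=
  (Finsupp.linearCombination_single F (1 : F) (⟨a, b, p⟩ : QPath Q)).trans (one_smul F _)

theorem ofPath_cons {a b c : Q} (p : Quiver.Path a b) (α : b ⟶ c) :
    ofPath F (p.cons α) = arrow F α * ofPath F p := by
  rw [arrow, ofPath_mul_ofPath]; rfl

open scoped Classical in
theorem vertex_mul_vertex (i j : Q) :
    vertex F i * vertex F j = if i = j then vertex F i else 0 := by
  rw [vertex, vertex, ← vertex, vertex_mul_ofPath]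
  split_ifs with h
  · subst h; rfl
  · rfl

theorem vertex_mul_self (i : Q) : vertex F i * vertex F i = vertex F i := by
  classical rw [vertex_mul_vertex, if_pos rfl]

theorem vertex_mul_vertex_of_ne {i j : Q} (h : i ≠ j) : vertex F i * vertex F j = 0 := by
  classical rw [vertex_mul_vertex, if_neg h]

theorem vertex_mul_arrow {a b : Q} (α : a ⟶ b) : vertex F b * arrow F α = arrow F α := by
  classical rw [arrow, vertex_mul_ofPath, if_pos rfl]

theorem arrow_mul_vertex {a b : Q} (α : a ⟶ b) : arrow F α * vertex F a = arrow F α := by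
  classical rw [arrow, ofPath_mul_vertex, if_pos rfl]

theorem span_vertex :
    Submodule.span F (Set.range (vertex F : Q → PathAlgebra F Q)) = degreePart F Q 0 := by
  refine le_antisymm (Submodule.span_le.2 ?_) (Submodule.span_le.2 ?_)
  · rintro _ ⟨i, rfl⟩
    exact vertex_mem i
  · rintro _ ⟨a, b, p, hp, rfl⟩
    obtain rfl := Quiver.Path.eq_of_length_zero p hp
    obtain rfl := Quiver.Path.eq_nil_of_length_zero p hp
    exact Submodule.subset_span ⟨a, rfl⟩

theorem span_arrow :
    Submodule.span F (Set.range fun α : Arr Q => arrow F α.2.2) = degreePart F Q 1 := by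
  refine le_antisymm (Submodule.span_le.2 ?_) (Submodule.span_le.2 ?_)
  · rintro _ ⟨α, rfl⟩
    exact ofPath_mem _ rfl
  · rintro _ ⟨a, b, p, hp, rfl⟩
    obtain ⟨k, p, α, rfl⟩ := (Quiver.Path.length_ne_zero_iff_eq_cons p).1 (by lia)
    have hp : p.length = 0 := by simpa using hp
    obtain rfl := Quiver.Path.eq_of_length_zero p hp
    obtain rfl := Quiver.Path.eq_nil_of_length_zero p hp
    exact Submodule.subset_span ⟨⟨a, b, α⟩, rfl⟩

/-- Induction on the elements of degree zero, which are the combinations of the vertices. -/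
theorem degreePart_zero_induction {C : PathAlgebra F Q → Prop}
    {x : PathAlgebra F Q} (hx : x ∈ degreePart F Q 0) (zero : C 0)
    (add : ∀ x y, C x → C y → C (x + y)) (smul : ∀ (c : F) x, C x → C (c • x))
    (vertex : ∀ i, C (vertex F i)) : C x := by
  induction hx using Submodule.span_induction with
  | zero => exact zero
  | add x y _ _ hx hy => exact add _ _ hx hy
  | smul c x _ hx => exact smul _ _ hx
  | mem x hx =>
    obtain ⟨a, b, p, hp, rfl⟩ := hx
    obtain rfl := Quiver.Path.eq_of_length_zero p hp
    obtain rfl := Quiver.Path.eq_nil_of_length_zero p hp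
    exact vertex a

open scoped Classical in
theorem rightStrip_arrow (β γ : Arr Q) :
    rightStrip β.2.2 (arrow F γ.2.2) = if β = γ then vertex F γ.2.1 else 0 := by
  change rightStrip β.2.2 (ofPath F (γ.2.2.toPath.comp Quiver.Path.nil)) = _
  split_ifs with h
  · subst h
    rw [rightStrip_comp]; rfl
  · rw [rightStrip_comp_of_ne _ _ _ h]

open scoped Classical in
theorem leftStrip_arrow (β γ : Arr Q) :
    leftStrip β.2.2 (arrow F γ.2.2) = if β = γ then vertex F γ.1 else 0 := by
  change leftStrip β.2.2 (ofPath F (Quiver.Path.nil.cons γ.2.2)) = _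
  split_ifs with h
  · subst h
    rw [leftStrip_cons]; rfl
  · rw [leftStrip_cons_of_ne _ _ _ h]

/-- The augmentation at the vertex `i`: it maps `e_i` to `1` and all other paths to `0`. -/
def augVertex (F : Type u) [Field F] {Q : Type v} [Quiver.{w} Q] [Fintype Q] (i : Q) :
    PathAlgebra F Q →ₐ[F] F :=
  open scoped Classical in
  liftHom (fun {a _} p => if p.length = 0 ∧ a = i then 1 else 0)
    (by rw [Finset.sum_eq_single i] <;> simp +contextual) (by
      intro a b c p q
      by_cases hq : q.length = 0
      · obtain rfl := Quiver.Path.eq_of_length_zero q hq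
        by_cases hp : p.length = 0 <;> by_cases h : a = i <;> simp [hp, hq, h]
      · simp [hq]) (by
      intro a b c d p q h
      by_cases hq : q.length = 0
      · obtain rfl := Quiver.Path.eq_of_length_zero q hq
        by_cases hi : a = i
        · subst hi
          simp [Ne.symm h]
        · simp [hi]
      · simp [hq])

open scoped Classical in
theorem augVertex_ofPath (i : Q) {a b : Q} (p : Quiver.Path a b) :
    augVertex F i (ofPath F p) = if p.length = 0 ∧ a = i then 1 else 0 := by
  unfold augVertex
  rw [liftHom_ofPath]

open scoped Classical in
theorem augVertex_vertex (i j : Q) : augVertex F i (vertex F j) = if j = i then 1 else 0 := by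
  rw [vertex, augVertex_ofPath]; simp

theorem augVertex_of_mem (i : Q) (m : ℕ) {x : PathAlgebra F Q}
    (hx : x ∈ degreePart F Q (m + 1)) : augVertex F i x = 0 := by
  classical
  induction hx using Submodule.span_induction with
  | zero => simp
  | add x y _ _ hx hy => rw [map_add, hx, hy, add_zero]
  | smul c x _ hx => rw [map_smul, hx, smul_zero]
  | mem x hx =>
    obtain ⟨a, b, p, hp, rfl⟩ := hx
    rw [augVertex_ofPath, if_neg (by simp [hp])]

theorem arrow_mem {a b : Q} (α : a ⟶ b) : arrow F α ∈ degreePart F Q 1 := ofPath_mem _ rfl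

theorem augVertex_arrow (i : Q) {a b : Q} (α : a ⟶ b) : augVertex F i (arrow F α) = 0 :=
  augVertex_of_mem i 0 (arrow_mem α)

/-- The algebra homomorphism that records the length of paths, as the exponent of a variable. -/
def lengthHom (F : Type u) [Field F] (Q : Type v) [Quiver.{w} Q] [Fintype Q] :
    PathAlgebra F Q →ₐ[F] Polynomial (PathAlgebra F Q) :=
  liftHom (fun p => Polynomial.monomial p.length (ofPath F p))
    (by
      simp only [Quiver.Path.length_nil, Polynomial.monomial_zero_left]
      rw [← map_sum]
      exact map_one _)
    (by
      intro a b c p q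
      rw [Polynomial.monomial_mul_monomial, ofPath_mul_ofPath, Quiver.Path.length_comp, add_comm])
    (by
      intro a b c d p q h
      rw [Polynomial.monomial_mul_monomial, ofPath_mul_ofPath_of_ne _ _ h, map_zero])

theorem lengthHom_ofPath {a b : Q} (p : Quiver.Path a b) :
    lengthHom F Q (ofPath F p) = Polynomial.monomial p.length (ofPath F p) := by
  unfold lengthHom
  rw [liftHom_ofPath]

theorem lengthHom_of_mem (m : ℕ) {x : PathAlgebra F Q} (hx : x ∈ degreePart F Q m) :
    lengthHom F Q x = Polynomial.monomial m x := by
  induction hx using Submodule.span_induction with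
  | zero => simp
  | add x y _ _ hx hy => rw [map_add, hx, hy, map_add]
  | smul c x _ hx => rw [map_smul, hx, Polynomial.smul_monomial]
  | mem x hx =>
    obtain ⟨a, b, p, hp, rfl⟩ := hx
    subst hp
    exact lengthHom_ofPath p

end PathAlgebra

namespace QuadraticRelations

open PathAlgebra

variable {F : Type u} [Field F] {Q : Type v} [Quiver.{w} Q] [Fintype Q]

theorem proj_surjective (R : QuadraticRelations F Q) : Function.Surjective R.proj :=
  Ideal.Quotient.mkₐ_surjective F R.relIdeal

theorem proj_eq_zero_iff (R : QuadraticRelations F Q) {x : PathAlgebra F Q} :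
    R.proj x = 0 ↔ x ∈ R.relIdeal := Ideal.Quotient.eq_zero_iff_mem

/-- Induction on membership in the ideal of relations: it is spanned by the products `u r v` with
`r` a relation. -/
theorem relIdeal_induction (R : QuadraticRelations F Q) {C : PathAlgebra F Q → Prop}
    (zero : C 0) (add : ∀ x y, C x → C y → C (x + y))
    (mul : ∀ u, ∀ r ∈ R.carrier, ∀ v, C (u * r * v)) {x : PathAlgebra F Q}
    (hx : x ∈ R.relIdeal) : C x := by
  have hx' : x ∈ TwoSidedIdeal.span (R.carrier : Set (PathAlgebra F Q)) :=
    TwoSidedIdeal.mem_asIdeal.1 hx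
  rw [TwoSidedIdeal.mem_span_iff_mem_addSubgroup_closure] at hx'
  clear hx
  induction hx' using AddSubgroup.closure_induction'' with
  | zero => exact zero
  | add x y _ _ hx hy => exact add x y hx hy
  | mem x hx =>
    obtain ⟨_, ⟨u, -, r, hr, rfl⟩, v, -, rfl⟩ := hx
    exact mul u r hr v
  | neg_mem x hx =>
    obtain ⟨_, ⟨u, -, r, hr, rfl⟩, v, -, rfl⟩ := hx
    have := mul (-u) r hr v
    simpa using this

/-- The homomorphism on the quadratic algebra induced by one on the path algebra. -/
def lift (R : QuadraticRelations F Q) {B : Type*} [Ring B] [Algebra F B]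
    (f : PathAlgebra F Q →ₐ[F] B) (h : ∀ r ∈ R.carrier, f r = 0) : R.Alg →ₐ[F] B :=
  Ideal.Quotient.liftₐ R.relIdeal f fun x hx => by
    refine R.relIdeal_induction (C := fun x => f x = 0) (map_zero f) ?_ ?_ hx
    · intro x y hx hy; rw [map_add, hx, hy, add_zero]
    · intro u r hr v; rw [map_mul, map_mul, h r hr, mul_zero, zero_mul]

/-- The augmentation of the quadratic algebra at the vertex `i`. -/
def aug (R : QuadraticRelations F Q) (i : Q) : R.Alg →ₐ[F] F :=
  R.lift (augVertex F i) fun _ hr => augVertex_of_mem i 1 (R.le_degree hr)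

theorem aug_proj (R : QuadraticRelations F Q) (i : Q) (x : PathAlgebra F Q) :
    R.aug i (R.proj x) = augVertex F i x := rfl

/-- The algebra homomorphism that records the degree of the elements of the quadratic algebra, as
the exponent of a variable. -/
def gradeHom (R : QuadraticRelations F Q) : R.Alg →ₐ[F] Polynomial R.Alg :=
  R.lift ((Polynomial.mapAlgHom R.proj).comp (lengthHom F Q)) fun r hr => by
    change Polynomial.map R.proj.toRingHom (lengthHom F Q r) = 0
    rw [lengthHom_of_mem 2 (R.le_degree hr), Polynomial.map_monomial]
    change Polynomial.monomial 2 (R.proj r) = 0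
    rw [R.proj_eq_zero hr, map_zero]

/-- The homogeneous component of degree `m`. -/
def comp (R : QuadraticRelations F Q) (m : ℕ) : R.Alg →ₗ[F] R.Alg where
  toFun x := (R.gradeHom x).coeff m
  map_add' x y := by simp
  map_smul' c x := by simp

theorem gradeHom_proj_of_mem (R : QuadraticRelations F Q) (m : ℕ) {x : PathAlgebra F Q}
    (hx : x ∈ degreePart F Q m) : R.gradeHom (R.proj x) = Polynomial.monomial m (R.proj x) := by
  change Polynomial.map R.proj.toRingHom (lengthHom F Q x) = _
  rw [lengthHom_of_mem m hx, Polynomial.map_monomial]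
  rfl

/-- The homogeneous elements of degree `m`. -/
def deg (R : QuadraticRelations F Q) (m : ℕ) : Submodule F R.Alg :=
  (degreePart F Q m).map R.proj.toLinearMap

theorem proj_mem_deg (R : QuadraticRelations F Q) (m : ℕ) {x : PathAlgebra F Q}
    (hx : x ∈ degreePart F Q m) : R.proj x ∈ R.deg m := ⟨x, hx, rfl⟩

theorem gradeHom_of_mem (R : QuadraticRelations F Q) {m : ℕ} {x : R.Alg} (hx : x ∈ R.deg m) :
    R.gradeHom x = Polynomial.monomial m x := by
  obtain ⟨x, hx, rfl⟩ := hx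
  exact R.gradeHom_proj_of_mem m hx

theorem comp_of_mem (R : QuadraticRelations F Q) {m : ℕ} {x : R.Alg} (hx : x ∈ R.deg m) :
    R.comp m x = x := by
  change (R.gradeHom x).coeff m = x
  rw [R.gradeHom_of_mem hx, Polynomial.coeff_monomial, if_pos rfl]

theorem comp_of_mem_ne (R : QuadraticRelations F Q) {m n : ℕ} (h : m ≠ n) {x : R.Alg}
    (hx : x ∈ R.deg m) : R.comp n x = 0 := by
  change (R.gradeHom x).coeff n = 0
  rw [R.gradeHom_of_mem hx, Polynomial.coeff_monomial, if_neg h]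

theorem deg_mul_mem (R : QuadraticRelations F Q) {m n : ℕ} {x y : R.Alg} (hx : x ∈ R.deg m)
    (hy : y ∈ R.deg n) : x * y ∈ R.deg (m + n) := by
  obtain ⟨x, hx, rfl⟩ := hx
  obtain ⟨y, hy, rfl⟩ := hy
  exact ⟨x * y, degreePart_mul_le m n (Submodule.mul_mem_mul hx hy), map_mul R.proj x y⟩

/-- Elements of the quadratic algebra are combinations of images of paths. -/
theorem alg_induction (R : QuadraticRelations F Q) {C : R.Alg → Prop} (x : R.Alg) (zero : C 0)
    (add : ∀ x y, C x → C y → C (x + y))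
    (path : ∀ (c : F) (a b : Q) (p : Quiver.Path a b), C (c • R.proj (ofPath F p))) : C x := by
  obtain ⟨x, rfl⟩ := R.proj_surjective x
  induction x using PathAlgebra.induction with
  | zero => rwa [map_zero]
  | add x y hx hy => rw [map_add]; exact add _ _ hx hy
  | path c a b p => rw [map_smul]; exact path c a b p

theorem comp_mem (R : QuadraticRelations F Q) (m : ℕ) (x : R.Alg) : R.comp m x ∈ R.deg m := by
  induction x using R.alg_induction with
  | zero => rw [map_zero]; exact zero_mem _
  | add x y hx hy => rw [map_add]; exact add_mem hx hy
  | path c a b p =>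
    rw [map_smul]
    refine Submodule.smul_mem _ _ ?_
    by_cases h : p.length = m
    · subst h
      have := R.proj_mem_deg _ (ofPath_mem (F := F) p rfl)
      rwa [R.comp_of_mem this]
    · rw [R.comp_of_mem_ne h (R.proj_mem_deg _ (ofPath_mem (F := F) p rfl))]
      exact zero_mem _

/-- Every element is the sum of its components; they vanish in large degrees. -/
theorem exists_eq_sum_comp (R : QuadraticRelations F Q) (x : R.Alg) :
    ∃ N : ℕ, (∀ m, N ≤ m → R.comp m x = 0) ∧ x = ∑ m ∈ Finset.range N, R.comp m x := by
  refine ⟨(R.gradeHom x).natDegree + 1, fun m hm =>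
    Polynomial.coeff_eq_zero_of_natDegree_lt (Nat.lt_of_succ_le hm), ?_⟩
  have h : (R.gradeHom x).eval 1 = x := by
    induction x using R.alg_induction with
    | zero => simp
    | add x y hx hy => rw [map_add, Polynomial.eval_add, hx, hy]
    | path c a b p =>
      rw [map_smul, Polynomial.eval_smul, R.gradeHom_proj_of_mem _ (ofPath_mem p rfl)]
      simp
  conv_lhs => rw [← h, Polynomial.eval_eq_sum_range]
  simp [comp]

theorem comp_mul_of_mem (R : QuadraticRelations F Q) {n : ℕ} (m : ℕ) (x : R.Alg) {y : R.Alg}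
    (hy : y ∈ R.deg n) : R.comp (m + n) (x * y) = R.comp m x * y := by
  change (R.gradeHom (x * y)).coeff (m + n) = _
  rw [map_mul, R.gradeHom_of_mem hy, Polynomial.coeff_mul_monomial]
  rfl

theorem mul_comp_of_mem (R : QuadraticRelations F Q) {n : ℕ} (m : ℕ) {x : R.Alg} (y : R.Alg)
    (hx : x ∈ R.deg n) : R.comp (m + n) (x * y) = x * R.comp m y := by
  change (R.gradeHom (x * y)).coeff (m + n) = _
  rw [map_mul, R.gradeHom_of_mem hx, Polynomial.coeff_monomial_mul]
  rfl

/-- The idempotent of the vertex `i` in the quadratic algebra. -/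
def e (R : QuadraticRelations F Q) (i : Q) : R.Alg := R.proj (vertex F i)

/-- The image of an arrow in the quadratic algebra. -/
def ar (R : QuadraticRelations F Q) {a b : Q} (α : a ⟶ b) : R.Alg := R.proj (arrow F α)

theorem sum_e (R : QuadraticRelations F Q) : ∑ i : Q, R.e i = 1 := by
  simp only [e]
  rw [← map_sum, ← one_def', map_one]

theorem e_mul_self (R : QuadraticRelations F Q) (i : Q) : R.e i * R.e i = R.e i := by
  rw [e, ← map_mul, vertex_mul_self]

theorem e_mul_of_ne (R : QuadraticRelations F Q) {i j : Q} (h : i ≠ j) : R.e i * R.e j = 0 := by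
  rw [e, e, ← map_mul, vertex_mul_vertex_of_ne h, map_zero]

theorem e_mul_ar (R : QuadraticRelations F Q) {a b : Q} (α : a ⟶ b) :
    R.e b * R.ar α = R.ar α := by
  rw [e, ar, ← map_mul, vertex_mul_arrow]

theorem ar_mul_e (R : QuadraticRelations F Q) {a b : Q} (α : a ⟶ b) :
    R.ar α * R.e a = R.ar α := by
  rw [e, ar, ← map_mul, arrow_mul_vertex]

theorem e_mem_deg (R : QuadraticRelations F Q) (i : Q) : R.e i ∈ R.deg 0 :=
  R.proj_mem_deg 0 (vertex_mem i)

theorem ar_mem_deg (R : QuadraticRelations F Q) {a b : Q} (α : a ⟶ b) : R.ar α ∈ R.deg 1 :=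
  R.proj_mem_deg 1 (arrow_mem α)

theorem aug_e_self (R : QuadraticRelations F Q) (i : Q) : R.aug i (R.e i) = 1 := by
  classical rw [e, aug_proj, augVertex_vertex, if_pos rfl]

theorem aug_ar (R : QuadraticRelations F Q) (i : Q) {a b : Q} (α : a ⟶ b) :
    R.aug i (R.ar α) = 0 := by
  rw [ar, aug_proj, augVertex_arrow]

theorem exists_smul_e_of_mem_deg_zero (R : QuadraticRelations F Q) (j : Q) {x : R.Alg}
    (hx : x ∈ R.deg 0) (hj : R.e j * x = x) : ∃ c : F, x = c • R.e j := by
  classical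
  obtain ⟨x, hx, rfl⟩ := hx
  rw [← hj]
  refine degreePart_zero_induction (C := fun x => ∃ c : F, R.e j * R.proj x = c • R.e j) hx
    ⟨0, by simp⟩ ?_ ?_ ?_
  · rintro x y ⟨c, hx⟩ ⟨d, hy⟩
    exact ⟨c + d, by rw [map_add, mul_add, hx, hy, add_smul]⟩
  · rintro c x ⟨d, hx⟩
    exact ⟨c * d, by rw [map_smul, mul_smul_comm, hx, smul_smul]⟩
  · intro i
    by_cases h : j = i
    · subst h
      exact ⟨1, by rw [one_smul]; exact R.e_mul_self j⟩
    · exact ⟨0, by rw [zero_smul]; exact R.e_mul_of_ne h⟩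

theorem proj_ofPath_cons (R : QuadraticRelations F Q) {a b c : Q} (p : Quiver.Path a b)
    (α : b ⟶ c) :
    R.proj (ofPath F (p.cons α)) = R.ar α * R.proj (ofPath F p) := by
  rw [ofPath_cons, map_mul]; rfl

theorem e_mul_proj_ofPath (R : QuadraticRelations F Q) {a b : Q} (p : Quiver.Path a b) :
    R.e b * R.proj (ofPath F p) = R.proj (ofPath F p) := by
  classical
  rw [e, ← map_mul, vertex_mul_ofPath, if_pos rfl]

end QuadraticRelations

/-! ### Right multiplication by the arrows in a preprojective algebra -/

namespace Preproj

open PathAlgebra QuadraticRelations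

section

variable {Q : Type v} [Quiver.{w} Q]

/-- The reverse of an arrow of the double quiver. -/
def rev (α : Arr (Quiver.Symmetrify Q)) : Arr (Quiver.Symmetrify Q) :=
  ⟨α.2.1, α.1, Quiver.reverse α.2.2⟩

theorem rev_rev (α : Arr (Quiver.Symmetrify Q)) : rev (rev α) = α := by
  obtain ⟨a, b, α⟩ := α
  simp [rev]

/-- The sign of an arrow of the double quiver: `1` for the arrows of `Q`, and `-1` for their
reverses. -/
def sgn (F : Type u) [Field F] (α : Arr (Quiver.Symmetrify Q)) : F :=
  Sum.elim (fun _ => 1) (fun _ => -1)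
    (show (@Quiver.Hom Q _ α.1 α.2.1) ⊕ (@Quiver.Hom Q _ α.2.1 α.1) from α.2.2)

theorem sgn_rev (F : Type u) [Field F] (α : Arr (Quiver.Symmetrify Q)) :
    sgn F (rev α) = -sgn F α := by
  obtain ⟨a, b, α | α⟩ := α
  · rfl
  · exact (neg_neg (1 : F)).symm

theorem sgn_mul_self (F : Type u) [Field F] (α : Arr (Quiver.Symmetrify Q)) :
    sgn F α * sgn F α = 1 := by
  obtain ⟨a, b, α | α⟩ := α
  · exact one_mul (1 : F)
  · exact (neg_mul_neg (1 : F) 1).trans (one_mul 1)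

theorem sum_arr [Fintype Q] [∀ a b : Q, Fintype (a ⟶ b)] {M : Type*} [AddCommMonoid M]
    (g : Arr (Quiver.Symmetrify Q) → M) :
    ∑ α, g α = ∑ a : Q, ∑ b : Q, (∑ f : a ⟶ b, g ⟨a, b, f.toPos⟩ +
      ∑ f : b ⟶ a, g ⟨a, b, f.toNeg⟩) := by
  have key : ∀ a b : Q,
      ∑ f : (@Quiver.Hom Q _ a b) ⊕ (@Quiver.Hom Q _ b a), g ⟨a, b, f⟩ =
        ∑ f : a ⟶ b, g ⟨a, b, f.toPos⟩ + ∑ f : b ⟶ a, g ⟨a, b, f.toNeg⟩ := fun a b =>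
    Fintype.sum_sum_type _
  rw [Fintype.sum_sigma]
  refine Finset.sum_congr rfl fun a _ => ?_
  rw [Fintype.sum_sigma]
  exact Finset.sum_congr rfl fun b _ => key a b

end

variable (F : Type u) [Field F] (Q : Type v) [Quiver.{w} Q] [Fintype Q]
  [∀ a b : Q, Fintype (a ⟶ b)]

/-- The sum of the preprojective relations of all the vertices. -/
def sigma : PathAlgebra F (Quiver.Symmetrify Q) :=
  ∑ α : Arr (Quiver.Symmetrify Q), sgn F α • (arrow F α.2.2 * arrow F (rev α).2.2)

variable {F Q}

theorem vertex_mul_sigma (k : Quiver.Symmetrify Q) :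
    vertex F k * sigma F Q = preprojectiveRelation F Q k := by
  classical
  have h : ∀ α : Arr (Quiver.Symmetrify Q),
      vertex F k * (sgn F α • (arrow F α.2.2 * arrow F (rev α).2.2)) =
        if k = α.2.1 then sgn F α • (arrow F α.2.2 * arrow F (rev α).2.2) else 0 := by
    intro α
    rw [mul_smul_comm, ← mul_assoc]
    split_ifs with h
    · subst h
      rw [vertex_mul_arrow]
    · rw [arrow, vertex_mul_ofPath, if_neg h, zero_mul, smul_zero]
  rw [sigma, Finset.mul_sum, Finset.sum_congr rfl fun α _ => h α, sum_arr]
  unfold preprojectiveRelation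
  rw [← Finset.sum_sub_distrib]
  refine Finset.sum_congr rfl fun a _ => ?_
  refine Eq.trans (Finset.sum_eq_single (M := PathAlgebra F (Quiver.Symmetrify Q))
    (show Q from k) ?_ ?_) ?_
  · intro b _ hb
    have hb' : ∀ (β : Arr (Quiver.Symmetrify Q)), β.2.1 = b → k ≠ β.2.1 := fun β h h' =>
      hb (h'.trans h).symm
    exact (congrArg₂ (· + ·) (Finset.sum_eq_zero fun f _ => if_neg (hb' _ rfl))
      (Finset.sum_eq_zero fun f _ => if_neg (hb' _ rfl))).trans (add_zero 0)
  · exact fun h => absurd (Finset.mem_univ _) h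
  · rw [sub_eq_add_neg, ← Finset.sum_neg_distrib]
    refine congrArg₂ (· + ·) (Finset.sum_congr rfl fun f _ => ?_)
      (Finset.sum_congr rfl fun f _ => ?_)
    · exact (if_pos rfl).trans (one_smul F _)
    · exact (if_pos rfl).trans (neg_one_smul F _)

theorem sigma_mul_vertex (k : Quiver.Symmetrify Q) :
    sigma F Q * vertex F k = vertex F k * sigma F Q := by
  classical
  rw [sigma, Finset.mul_sum, Finset.sum_mul]
  refine Finset.sum_congr rfl fun α _ => ?_
  rw [mul_smul_comm, smul_mul_assoc, ← mul_assoc, mul_assoc (arrow F α.2.2)]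
  congr 1
  by_cases h : k = α.2.1
  · subst h
    rw [vertex_mul_arrow]
    congr 1
    exact arrow_mul_vertex (rev α).2.2
  · have h' : k ≠ (rev α).1 := h
    rw [arrow, vertex_mul_ofPath, if_neg h, zero_mul, arrow, ofPath_mul_vertex, if_neg h',
      mul_zero]

theorem sigma_mem : sigma F Q ∈ degreePart F (Quiver.Symmetrify Q) 2 :=
  sum_mem fun _ _ => Submodule.smul_mem _ _
    (degreePart_mul_le 1 1 (Submodule.mul_mem_mul (arrow_mem _) (arrow_mem _)))

theorem preprojective_carrier :
    (preprojective F Q).carrier = Submodule.span F (Set.range (preprojectiveRelation F Q)) := by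
  classical
  change degreePart F (Quiver.Symmetrify Q) 0 * _ * degreePart F (Quiver.Symmetrify Q) 0 = _
  set S := Submodule.span F (Set.range (preprojectiveRelation F Q)) with hS
  have key : ∀ i j : Quiver.Symmetrify Q, vertex F i * preprojectiveRelation F Q j ∈ S := by
    intro i j
    rw [← vertex_mul_sigma, ← mul_assoc, vertex_mul_vertex]
    split_ifs with h
    · rw [vertex_mul_sigma]; exact Submodule.subset_span ⟨_, rfl⟩
    · rw [zero_mul]; exact zero_mem _
  have key' : ∀ i j : Quiver.Symmetrify Q, preprojectiveRelation F Q j * vertex F i ∈ S := by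
    intro i j
    rw [← vertex_mul_sigma, mul_assoc, sigma_mul_vertex, ← mul_assoc, vertex_mul_vertex]
    split_ifs with h
    · rw [vertex_mul_sigma]; exact Submodule.subset_span ⟨_, rfl⟩
    · rw [zero_mul]; exact zero_mem _
  have h1 : degreePart F (Quiver.Symmetrify Q) 0 * S ≤ S := by
    refine Submodule.mul_le.2 fun x hx y hy => ?_
    induction hy using Submodule.span_induction with
    | zero => rw [mul_zero]; exact zero_mem _
    | add y y' _ _ hy hy' => rw [mul_add]; exact add_mem hy hy'
    | smul c y _ hy => rw [mul_smul_comm]; exact Submodule.smul_mem _ _ hy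
    | mem y hy =>
      obtain ⟨j, rfl⟩ := hy
      refine degreePart_zero_induction (C := fun x => x * _ ∈ S) hx (by simp) ?_ ?_ (key · j)
      · intro x y hx hy; rw [add_mul]; exact add_mem hx hy
      · intro c x hx; rw [smul_mul_assoc]; exact Submodule.smul_mem _ _ hx
  have h2 : S * degreePart F (Quiver.Symmetrify Q) 0 ≤ S := by
    refine Submodule.mul_le.2 fun y hy x hx => ?_
    induction hy using Submodule.span_induction with
    | zero => rw [zero_mul]; exact zero_mem _
    | add y y' _ _ hy hy' => rw [add_mul]; exact add_mem hy hy'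
    | smul c y _ hy => rw [smul_mul_assoc]; exact Submodule.smul_mem _ _ hy
    | mem y hy =>
      obtain ⟨j, rfl⟩ := hy
      refine degreePart_zero_induction (C := fun x => _ * x ∈ S) hx (by simp) ?_ ?_ (key' · j)
      · intro x y hx hy; rw [mul_add]; exact add_mem hx hy
      · intro c x hx; rw [mul_smul_comm]; exact Submodule.smul_mem _ _ hx
  refine le_antisymm ((mul_le_mul' h1 le_rfl).trans h2) fun x hx => ?_
  have one_mem : (1 : PathAlgebra F (Quiver.Symmetrify Q)) ∈
      degreePart F (Quiver.Symmetrify Q) 0 := by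
    rw [one_def']
    exact sum_mem fun i _ => vertex_mem i
  simpa using Submodule.mul_mem_mul (Submodule.mul_mem_mul one_mem hx) one_mem

theorem exists_eq_mul_sigma {r : PathAlgebra F (Quiver.Symmetrify Q)}
    (hr : r ∈ (preprojective F Q).carrier) : ∃ s, r = s * sigma F Q := by
  rw [preprojective_carrier] at hr
  induction hr using Submodule.span_induction with
  | zero => exact ⟨0, (zero_mul _).symm⟩
  | add x y _ _ hx hy =>
    obtain ⟨s, rfl⟩ := hx
    obtain ⟨t, rfl⟩ := hy
    exact ⟨s + t, (add_mul _ _ _).symm⟩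
  | smul c x _ hx =>
    obtain ⟨s, rfl⟩ := hx
    exact ⟨c • s, (smul_mul_assoc _ _ _).symm⟩
  | mem x hx =>
    obtain ⟨k, rfl⟩ := hx
    exact ⟨_, (vertex_mul_sigma k).symm⟩

theorem preprojectiveRelation_mem (k : Quiver.Symmetrify Q) :
    preprojectiveRelation F Q k ∈ (preprojective F Q).carrier := by
  rw [preprojective_carrier]
  exact Submodule.subset_span ⟨k, rfl⟩

theorem sigma_mem_carrier : sigma F Q ∈ (preprojective F Q).carrier := by
  have h : sigma F Q = ∑ k : Quiver.Symmetrify Q, preprojectiveRelation F Q k := by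
    simp only [← vertex_mul_sigma]
    rw [← Finset.sum_mul, ← one_def', one_mul]
  rw [h]
  exact sum_mem fun k _ => preprojectiveRelation_mem k

theorem rightStrip_rev_sum (y : Arr (Quiver.Symmetrify Q) → PathAlgebra F (Quiver.Symmetrify Q))
    (β : Arr (Quiver.Symmetrify Q)) :
    rightStrip (rev β).2.2 (∑ α, sgn F α • (y α * arrow F (rev α).2.2)) =
      sgn F β • (y β * vertex F β.1) := by
  classical
  rw [map_sum, Finset.sum_eq_single β]
  · rw [map_smul, rightStrip_mul _ 0 _ (arrow_mem _), rightStrip_arrow, if_pos rfl]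
    rfl
  · intro α _ h
    rw [map_smul, rightStrip_mul _ 0 _ (arrow_mem _), rightStrip_arrow, if_neg, mul_zero,
      smul_zero]
    intro h'
    exact h (by rw [← rev_rev α, ← h', rev_rev])
  · simp

theorem rightStrip_sigma (β : Arr (Quiver.Symmetrify Q)) :
    rightStrip (rev β).2.2 (sigma F Q) = sgn F β • arrow F β.2.2 := by
  rw [sigma, rightStrip_rev_sum, arrow_mul_vertex]

/-- Stripping the first arrow of an element of the ideal of relations gives, in the preprojective
algebra, what stripping it from a multiple of the relations gives. -/
theorem exists_proj_rightStrip {x : PathAlgebra F (Quiver.Symmetrify Q)}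
    (hx : x ∈ (preprojective F Q).relIdeal) :
    ∃ t : (preprojective F Q).Alg, ∀ β : Arr (Quiver.Symmetrify Q),
      (preprojective F Q).proj (rightStrip β.2.2 x) =
        t * (preprojective F Q).proj (rightStrip β.2.2 (sigma F Q)) := by
  refine (preprojective F Q).relIdeal_induction (C := fun x => ∃ t : (preprojective F Q).Alg,
    ∀ β : Arr (Quiver.Symmetrify Q), (preprojective F Q).proj (rightStrip β.2.2 x) =
      t * (preprojective F Q).proj (rightStrip β.2.2 (sigma F Q))) ?_ ?_ ?_ hx
  · exact ⟨0, by simp⟩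
  · rintro x y ⟨t, ht⟩ ⟨t', ht'⟩
    exact ⟨t + t', fun β => by rw [map_add, map_add, ht, ht', add_mul]⟩
  · intro u r hr v
    induction v using PathAlgebra.induction with
    | zero => exact ⟨0, by simp⟩
    | add x y hx hy =>
      obtain ⟨t, ht⟩ := hx
      obtain ⟨t', ht'⟩ := hy
      exact ⟨t + t', fun β => by rw [mul_add, map_add, map_add, ht, ht', add_mul]⟩
    | path c a b p =>
      by_cases hp : p.length = 0
      · have hr' : r * (c • ofPath F p) ∈ (preprojective F Q).carrier :=
          (preprojective F Q).right_mul_le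
            (Submodule.mul_mem_mul hr (Submodule.smul_mem _ _ (ofPath_mem p hp)))
        obtain ⟨s, hs⟩ := exists_eq_mul_sigma hr'
        refine ⟨(preprojective F Q).proj (u * s), fun β => ?_⟩
        rw [mul_assoc, hs, ← mul_assoc, rightStrip_mul _ 1 _ sigma_mem, map_mul]
      · obtain ⟨m, hm⟩ := Nat.exists_eq_succ_of_ne_zero hp
        refine ⟨0, fun β => ?_⟩
        rw [zero_mul, rightStrip_mul _ m _ (Submodule.smul_mem _ _ (ofPath_mem p hm)), map_mul,
          map_mul, (preprojective F Q).proj_eq_zero hr, mul_zero, zero_mul]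

/-- Right multiplication by the arrows is exact in the middle: a family `(y_α)` with
`∑ ± y_α α* = 0` is of the form `(x α)`. -/
theorem exists_mul_ar_eq (y : Arr (Quiver.Symmetrify Q) → (preprojective F Q).Alg)
    (hy : ∀ α, y α * (preprojective F Q).e α.1 = y α)
    (hs : ∑ α, sgn F α • (y α * (preprojective F Q).ar (rev α).2.2) = 0) :
    ∃ x, ∀ α, x * (preprojective F Q).ar α.2.2 = y α := by
  choose Y hY using fun α => (preprojective F Q).proj_surjective (y α)
  have hX : ∑ α, sgn F α • (Y α * arrow F (rev α).2.2) ∈ (preprojective F Q).relIdeal := by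
    rw [← proj_eq_zero_iff, map_sum, ← hs]
    refine Finset.sum_congr rfl fun α _ => ?_
    rw [map_smul, map_mul, hY]
    rfl
  obtain ⟨t, ht⟩ := exists_proj_rightStrip hX
  refine ⟨t, fun β => ?_⟩
  have h := ht (rev β)
  rw [rightStrip_rev_sum, rightStrip_sigma, map_smul, map_smul, mul_smul_comm, map_mul, hY] at h
  have h := congrArg (sgn F β • ·) h
  simp only [smul_smul, sgn_mul_self, one_smul] at h
  rw [ar, ← h]
  exact hy β

theorem sum_ar_mul_ar_rev :
    ∑ α : Arr (Quiver.Symmetrify Q), sgn F α • ((preprojective F Q).ar α.2.2 *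
      (preprojective F Q).ar (rev α).2.2) = 0 := by
  rw [← (preprojective F Q).proj_eq_zero sigma_mem_carrier, sigma, map_sum]
  refine Finset.sum_congr rfl fun α _ => ?_
  rw [map_smul, map_mul]
  rfl

end Preproj

/-! ### The graded dual of a left module and the right socle -/

namespace Preproj

open PathAlgebra QuadraticRelations

variable {F : Type u} [Field F] {Q : Type v} [Quiver.{w} Q] [Fintype Q]
  [∀ a b : Q, Fintype (a ⟶ b)]

/-- The right action of an algebra on its linear dual: `(f a)(y) = f (a y)`. -/
def dualAct {A : Type*} [Ring A] [Algebra F A] (a : A) : Module.Dual F A →ₗ[F] Module.Dual F A :=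
  (LinearMap.mulLeft F a).dualMap

theorem dualAct_apply {A : Type*} [Ring A] [Algebra F A] (a : A) (f : Module.Dual F A) (y : A) :
    dualAct a f y = f (a * y) := rfl

theorem dualAct_dualAct {A : Type*} [Ring A] [Algebra F A] (a b : A) (f : Module.Dual F A) :
    dualAct b (dualAct a f) = dualAct (a * b) f := by
  ext y
  simp [dualAct_apply, mul_assoc]

theorem dualAct_zero {A : Type*} [Ring A] [Algebra F A] (f : Module.Dual F A) :
    dualAct 0 f = 0 := by
  ext y
  simp [dualAct_apply]

/-- The relations of the preprojective algebra. -/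
local notation "𝐏" => preprojective F Q

/-- If `z` in `e_j A_n e_i` is annihilated by all arrows on the right, then the map from the
dual of `A_0 e_i` to `A` with value `z` extends, degree by degree, to a homomorphism of right modules
from the graded dual of `A e_i` to `e_j A`: the obstruction to extending it to the next degree
vanishes by `exists_mul_ar_eq`. The extension is injective. -/
theorem exists_layer (i j : Quiver.Symmetrify Q) (n : ℕ) (z : 𝐏.Alg)
    (hz : z ∈ 𝐏.deg n) (hzi : z * 𝐏.e i = z)
    (hjz : 𝐏.e j * z = z) (hz0 : z ≠ 0)
    (h0 : ∀ α : Arr (Quiver.Symmetrify Q), z * 𝐏.ar α.2.2 = 0) (l : ℕ)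
    (hl : l ≤ n) :
    ∃ φ : Module.Dual F 𝐏.Alg →ₗ[F] 𝐏.Alg,
      (∀ f k, φ f * 𝐏.e k = φ (dualAct (𝐏.e k) f)) ∧
      (∀ f, ∑ α : Arr (Quiver.Symmetrify Q), sgn F α •
        (φ (dualAct (𝐏.ar α.2.2) f) * 𝐏.ar (rev α).2.2) = 0) ∧
      (∀ f, φ f ∈ 𝐏.deg (n - l)) ∧
      (∀ f, 𝐏.e j * φ f = φ f) ∧
      (∀ f, φ f = 0 → ∀ (k : Quiver.Symmetrify Q) (p : Quiver.Path i k), p.length = l →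
        f (𝐏.proj (ofPath F p)) = 0) ∧
      (∀ f (a b : Quiver.Symmetrify Q) (p : Quiver.Path a b), l < p.length →
        φ f * 𝐏.proj (ofPath F p) = 0) := by
  classical
  induction l with
  | zero =>
    refine ⟨(LinearMap.applyₗ (𝐏.e i)).smulRight z, ?_, ?_, ?_, ?_, ?_, ?_⟩
    · intro f k
      simp only [LinearMap.smulRight_apply, LinearMap.applyₗ_apply_apply, dualAct_apply,
        smul_mul_assoc]
      by_cases h : i = k
      · subst h
        rw [hzi, 𝐏.e_mul_self]
      · rw [← hzi, mul_assoc, 𝐏.e_mul_of_ne h, 𝐏.e_mul_of_ne (Ne.symm h)]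
        simp
    · intro f
      refine Finset.sum_eq_zero fun α _ => ?_
      simp only [LinearMap.smulRight_apply, smul_mul_assoc, h0 (rev α), smul_zero]
    · intro f
      exact Submodule.smul_mem _ _ hz
    · intro f
      simp only [LinearMap.smulRight_apply, mul_smul_comm, hjz]
    · intro f hf k p hp
      obtain rfl := Quiver.Path.eq_of_length_zero p hp
      obtain rfl := Quiver.Path.eq_nil_of_length_zero p hp
      exact (smul_eq_zero.1 hf).resolve_right hz0
    · intro f a b p hp
      cases p with
      | nil => simp at hp
      | @cons c _ q α =>
        rw [proj_ofPath_cons, LinearMap.smulRight_apply, smul_mul_assoc, ← mul_assoc,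
          h0 ⟨c, b, α⟩, zero_mul, smul_zero]
  | succ l ih =>
    obtain ⟨ψ, hψe, hψs, hψd, hψj, hψp, hψq⟩ := ih (by lia)
    obtain ⟨m, hm⟩ : ∃ m, n - l = m + 1 := ⟨n - l - 1, by lia⟩
    have hm' : n - (l + 1) = m := by lia
    let E : 𝐏.Alg →ₗ[F] (Arr (Quiver.Symmetrify Q) → 𝐏.Alg) :=
      LinearMap.pi fun α => LinearMap.mulRight F (𝐏.ar α.2.2)
    let G : Module.Dual F 𝐏.Alg →ₗ[F] (Arr (Quiver.Symmetrify Q) → 𝐏.Alg) :=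
      LinearMap.pi fun α => ψ ∘ₗ dualAct (𝐏.ar α.2.2)
    have hG : ∀ f, G f ∈ LinearMap.range E := by
      intro f
      obtain ⟨x, hx⟩ := exists_mul_ar_eq (G f) (fun α => by
        change ψ _ * 𝐏.e α.1 = ψ _
        rw [hψe, dualAct_dualAct, 𝐏.ar_mul_e]) (hψs f)
      exact ⟨x, funext hx⟩
    obtain ⟨s, hs⟩ := E.rangeRestrict.exists_rightInverse_of_surjective E.range_rangeRestrict
    let H : Module.Dual F 𝐏.Alg →ₗ[F] 𝐏.Alg := s ∘ₗ G.codRestrict _ hG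
    have hH : ∀ f (α : Arr (Quiver.Symmetrify Q)),
        H f * 𝐏.ar α.2.2 = ψ (dualAct (𝐏.ar α.2.2) f) := by
      intro f α
      have h1 : E (H f) = G f :=
        congrArg Subtype.val (LinearMap.congr_fun hs (⟨G f, hG f⟩ : LinearMap.range E))
      exact congrFun h1 α
    let φ : Module.Dual F 𝐏.Alg →ₗ[F] 𝐏.Alg := ∑ k : Quiver.Symmetrify Q,
      LinearMap.mulRight F (𝐏.e k) ∘ₗ LinearMap.mulLeft F (𝐏.e j) ∘ₗ 𝐏.comp m ∘ₗ H ∘ₗ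
        dualAct (𝐏.e k)
    have hφ : ∀ f, φ f = ∑ k : Quiver.Symmetrify Q,
        𝐏.e j * 𝐏.comp m (H (dualAct (𝐏.e k) f)) * 𝐏.e k := fun f => by
      simp [φ, LinearMap.sum_apply]
    have hφα : ∀ f (α : Arr (Quiver.Symmetrify Q)),
        φ f * 𝐏.ar α.2.2 = ψ (dualAct (𝐏.ar α.2.2) f) := by
      intro f α
      rw [hφ, Finset.sum_mul, Finset.sum_eq_single α.2.1]
      · rw [mul_assoc, 𝐏.e_mul_ar, mul_assoc, ← 𝐏.comp_mul_of_mem m _ (𝐏.ar_mem_deg α.2.2), hH,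
          dualAct_dualAct, 𝐏.e_mul_ar, 𝐏.comp_of_mem (hm ▸ hψd _), hψj]
      · intro k _ hk
        rw [mul_assoc, ← 𝐏.e_mul_ar α.2.2, ← mul_assoc (𝐏.e k), 𝐏.e_mul_of_ne hk, zero_mul,
          mul_zero]
      · simp
    refine ⟨φ, ?_, ?_, ?_, ?_, ?_, ?_⟩
    · intro f k
      rw [hφ, hφ, Finset.sum_mul]
      refine Finset.sum_congr rfl fun k' _ => ?_
      rw [dualAct_dualAct]
      by_cases h : k' = k
      · subst h
        rw [mul_assoc, 𝐏.e_mul_self]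
      · rw [mul_assoc, 𝐏.e_mul_of_ne h, 𝐏.e_mul_of_ne (Ne.symm h), dualAct_zero]
        simp
    · intro f
      have h1 : ∑ α : Arr (Quiver.Symmetrify Q), sgn F α •
          dualAct (𝐏.ar (rev α).2.2) (dualAct (𝐏.ar α.2.2) f) = 0 := by
        ext y
        rw [LinearMap.sum_apply, LinearMap.zero_apply, ← map_zero f, ← zero_mul y,
          ← sum_ar_mul_ar_rev (F := F) (Q := Q), Finset.sum_mul, map_sum]
        refine Finset.sum_congr rfl fun α _ => ?_
        rw [LinearMap.smul_apply, dualAct_apply, dualAct_apply, smul_mul_assoc, map_smul,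
          mul_assoc]
      rw [← map_zero ψ, ← h1, map_sum]
      refine Finset.sum_congr rfl fun α _ => ?_
      rw [hφα, map_smul]
    · intro f
      rw [hφ, hm']
      refine sum_mem fun k _ => ?_
      have h1 := 𝐏.deg_mul_mem (𝐏.deg_mul_mem (𝐏.e_mem_deg j)
        (𝐏.comp_mem m (H (dualAct (𝐏.e k) f)))) (𝐏.e_mem_deg k)
      rwa [zero_add, add_zero] at h1
    · intro f
      rw [hφ, Finset.mul_sum]
      refine Finset.sum_congr rfl fun k _ => ?_
      rw [← mul_assoc, ← mul_assoc, 𝐏.e_mul_self]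
    · intro f hf k p hp
      cases p with
      | nil => simp at hp
      | @cons c _ q α =>
        rw [proj_ofPath_cons, ← dualAct_apply]
        refine hψp _ ?_ c q (by simpa using hp)
        rw [← hφα f ⟨c, k, α⟩, hf, zero_mul]
    · intro f a b p hp
      cases p with
      | nil => simp at hp
      | @cons c _ q α =>
        rw [proj_ofPath_cons, ← mul_assoc, hφα f ⟨c, b, α⟩]
        exact hψq _ _ _ _ (by simp at hp; lia)

/-- If `e_j A` has a nonzero homogeneous element of degree `n` that is annihilated by all arrows,
then it is zero in degrees larger than `n`. -/
theorem proj_ofPath_eq_zero_of_socle (i j : Quiver.Symmetrify Q) (n : ℕ)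
    (z : 𝐏.Alg)
    (hz : z ∈ 𝐏.deg n) (hzi : z * 𝐏.e i = z)
    (hjz : 𝐏.e j * z = z) (hz0 : z ≠ 0)
    (h0 : ∀ α : Arr (Quiver.Symmetrify Q), z * 𝐏.ar α.2.2 = 0)
    {a : Quiver.Symmetrify Q} (p : Quiver.Path a j) (hp : n < p.length) :
    𝐏.proj (ofPath F p) = 0 := by
  classical
  obtain ⟨φ, -, -, hφd, hφj, hφp, hφq⟩ := exists_layer i j n z hz hzi hjz hz0 h0 n le_rfl
  obtain ⟨f, hf⟩ : ∃ f : Module.Dual F 𝐏.Alg, f z ≠ 0 := by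
    by_contra! h
    exact hz0 ((Module.forall_dual_apply_eq_zero_iff F z).1 h)
  have hφf : φ f ≠ 0 := by
    intro hφf
    refine hf ?_
    obtain ⟨x, hx, rfl⟩ := hz
    rw [← hzi]
    change f (𝐏.proj x * 𝐏.proj (vertex F i)) = 0
    rw [← map_mul]
    clear hzi hjz hz0 h0 hf
    induction hx using Submodule.span_induction with
    | zero => simp
    | add x y _ _ hx hy => rw [add_mul, map_add, map_add, hx, hy, add_zero]
    | smul c x _ hx => rw [smul_mul_assoc, map_smul, map_smul, hx, smul_zero]
    | mem x hx =>
      obtain ⟨a, b, p, hp, rfl⟩ := hx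
      rw [ofPath_mul_vertex]
      split_ifs with h
      · subst h
        exact hφp f hφf b p hp
      · simp
  obtain ⟨c, hc⟩ := exists_smul_e_of_mem_deg_zero 𝐏 j (by simpa using hφd f) (hφj f)
  have hc0 : c ≠ 0 := by
    rintro rfl
    exact hφf (by rw [hc, zero_smul])
  have h := hφq f a j p hp
  rw [hc, smul_mul_assoc, e_mul_proj_ofPath] at h
  exact (smul_eq_zero.1 h).resolve_left hc0

end Preproj

/-! ### Finite-dimensional right ideals of a preprojective algebra -/

namespace PathAlgebra

variable {F : Type u} [Field F] {Q : Type v} [Quiver.{w} Q] [Fintype Q]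

theorem degreePart_succ (m : ℕ) :
    degreePart F Q (m + 1) = degreePart F Q 1 * degreePart F Q m := by
  refine le_antisymm (Submodule.span_le.2 ?_) ((degreePart_mul_le 1 m).trans_eq (by rw [add_comm]))
  rintro _ ⟨a, b, p, hp, rfl⟩
  cases p with
  | nil => simp at hp
  | @cons c _ q α =>
    rw [ofPath_cons]
    exact Submodule.mul_mem_mul (arrow_mem α) (ofPath_mem q (by simpa using hp))

theorem degreePart_fg [∀ a b : Q, Fintype (a ⟶ b)] (m : ℕ) : (degreePart F Q m).FG := by
  induction m with
  | zero =>
    rw [← span_vertex]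
    exact Submodule.fg_span (Set.finite_range _)
  | succ m ih =>
    rw [degreePart_succ]
    refine Submodule.FG.mul ?_ ih
    rw [← span_arrow]
    exact Submodule.fg_span (Set.finite_range _)

theorem ofPath_ne_zero {a b : Q} (p : Quiver.Path a b) : ofPath F p ≠ 0 := by
  intro h
  have : (Finsupp.single (⟨a, b, p⟩ : QPath Q) (1 : F)) = 0 := h
  simp at this

end PathAlgebra

namespace QuadraticRelations

open PathAlgebra

variable {F : Type u} [Field F] {Q : Type v} [Quiver.{w} Q] [Fintype Q]

theorem coeff_lengthHom_of_mem_relIdeal (R : QuadraticRelations F Q) {x : PathAlgebra F Q}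
    (hx : x ∈ R.relIdeal) {m : ℕ} (hm : m < 2) : (lengthHom F Q x).coeff m = 0 := by
  refine R.relIdeal_induction (C := fun x => (lengthHom F Q x).coeff m = 0) (by simp) ?_ ?_ hx
  · intro x y hx hy; rw [map_add, Polynomial.coeff_add, hx, hy, add_zero]
  · intro u r hr v
    rw [map_mul, map_mul, lengthHom_of_mem 2 (R.le_degree hr), ← Polynomial.C_mul_X_pow_eq_monomial,
      ← mul_assoc, mul_assoc, (Polynomial.commute_X_pow _ 2).eq, ← mul_assoc,
      Polynomial.coeff_mul_X_pow', if_neg (by lia)]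

/-- The ideal of relations has no elements of degree less than two. -/
theorem eq_zero_of_proj_eq_zero (R : QuadraticRelations F Q) {m : ℕ} (hm : m < 2)
    {x : PathAlgebra F Q} (hx : x ∈ degreePart F Q m) (h : R.proj x = 0) : x = 0 := by
  have := coeff_lengthHom_of_mem_relIdeal R (R.proj_eq_zero_iff.1 h) hm
  rwa [lengthHom_of_mem m hx, Polynomial.coeff_monomial, if_pos rfl] at this

theorem ar_ne_zero (R : QuadraticRelations F Q) {a b : Q} (α : a ⟶ b) : R.ar α ≠ 0 := fun h =>
  ofPath_ne_zero α.toPath (eq_zero_of_proj_eq_zero R (by lia) (arrow_mem α) h)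

end QuadraticRelations

namespace Preproj

open PathAlgebra QuadraticRelations

variable {F : Type u} [Field F] {Q : Type v} [Quiver.{w} Q] [Fintype Q]
  [∀ a b : Q, Fintype (a ⟶ b)]

/-- The relations of the preprojective algebra. -/
local notation "𝐏" => preprojective F Q

variable (F) in
/-- The right ideal `e_j A` of the preprojective algebra is zero in large degrees. -/
def IsBounded (j : Quiver.Symmetrify Q) : Prop :=
  ∃ N : ℕ, ∀ (a : Quiver.Symmetrify Q) (p : Quiver.Path a j), N ≤ p.length →
    (preprojective F Q).proj (ofPath F p) = 0

theorem isBounded_of_mul_ar_eq_zero {z : (𝐏).Alg} (hz : z ≠ 0)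
    (h0 : ∀ α : Arr (Quiver.Symmetrify Q), z * (𝐏).ar α.2.2 = 0) : ∃ j, IsBounded F (Q := Q) j := by
  obtain ⟨j, hj⟩ : ∃ j, (𝐏).e j * z ≠ 0 := by
    by_contra! h
    refine hz ?_
    rw [← one_mul z, ← sum_e, Finset.sum_mul]
    exact Finset.sum_eq_zero fun j _ => h j
  obtain ⟨i, hi⟩ : ∃ i, (𝐏).e j * z * (𝐏).e i ≠ 0 := by
    by_contra! h
    refine hj ?_
    rw [← mul_one (_ * z), ← sum_e, Finset.mul_sum]
    exact Finset.sum_eq_zero fun j _ => h j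
  obtain ⟨m, hm⟩ : ∃ m, (𝐏).comp m ((𝐏).e j * z * (𝐏).e i) ≠ 0 := by
    by_contra! h
    obtain ⟨N, -, hN⟩ := (𝐏).exists_eq_sum_comp ((𝐏).e j * z * (𝐏).e i)
    exact hi (hN.trans (Finset.sum_eq_zero fun m _ => h m))
  refine ⟨j, m + 1, fun a p hp =>
    proj_ofPath_eq_zero_of_socle i j m _ ((𝐏).comp_mem _ _) ?_ ?_ hm ?_ p hp⟩
  · have h := (𝐏).comp_mul_of_mem m ((𝐏).e j * z * (𝐏).e i) ((𝐏).e_mem_deg i)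
    rw [add_zero] at h
    rw [← h, mul_assoc _ _ ((𝐏).e i), (𝐏).e_mul_self]
  · have h := (𝐏).mul_comp_of_mem m ((𝐏).e j * z * (𝐏).e i) ((𝐏).e_mem_deg j)
    rw [add_zero] at h
    rw [← h, ← mul_assoc, ← mul_assoc, (𝐏).e_mul_self]
  · intro α
    rw [← (𝐏).comp_mul_of_mem m _ ((𝐏).ar_mem_deg α.2.2), mul_assoc, mul_assoc]
    by_cases h : i = α.2.1
    · subst h
      rw [(𝐏).e_mul_ar, h0, mul_zero, map_zero]
    · rw [← (𝐏).e_mul_ar α.2.2, ← mul_assoc ((𝐏).e i), (𝐏).e_mul_of_ne h, zero_mul, mul_zero,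
        mul_zero, map_zero]

/-- If `e_i A` is finite-dimensional and `α` is an arrow from `i` to `j`, then `α A` is
finite-dimensional, so that its part of top degree is annihilated by the arrows. -/
theorem IsBounded.of_arrow {i j : Quiver.Symmetrify Q} (α : i ⟶ j)
    (hi : IsBounded F (Q := Q) i) : IsBounded F (Q := Q) j := by
  classical
  obtain ⟨N, hN⟩ := hi
  have hex : ∃ m, m ≤ N ∧ ∃ (a : Quiver.Symmetrify Q) (q : Quiver.Path a i), q.length = N - m ∧
      (𝐏).ar α * (𝐏).proj (ofPath F q) ≠ 0 :=
    ⟨N, le_rfl, i, Quiver.Path.nil, by simp, by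
      change (𝐏).ar α * (𝐏).e i ≠ 0
      rw [ar_mul_e]
      exact ar_ne_zero _ α⟩
  obtain ⟨hmN, a, q, hq, hne⟩ := Nat.find_spec hex
  set m := Nat.find hex with hm
  have hmax : ∀ (b : Quiver.Symmetrify Q) (r : Quiver.Path b i), N - m < r.length →
      (𝐏).ar α * (𝐏).proj (ofPath F r) = 0 := by
    intro b r hr
    by_contra h
    by_cases hrN : N ≤ r.length
    · exact h (by rw [hN b r hrN, mul_zero])
    · exact Nat.find_min hex (m := N - r.length) (by lia) ⟨by lia, b, r, by lia, h⟩
  have hz : (𝐏).ar α * (𝐏).proj (ofPath F q) = (𝐏).proj (ofPath F (q.cons α)) :=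
    (proj_ofPath_cons _ q α).symm
  refine ⟨N - m + 2, fun b p hp => proj_ofPath_eq_zero_of_socle a j (N - m + 1)
    ((𝐏).ar α * (𝐏).proj (ofPath F q)) ?_ ?_ ?_ hne ?_ p (by lia)⟩
  · rw [hz]
    exact proj_mem_deg _ _ (ofPath_mem _ (by simp [hq]))
  · rw [hz, e, ← map_mul, ofPath_mul_vertex, if_pos rfl]
  · rw [← mul_assoc, e_mul_ar]
  · intro β
    rw [mul_assoc]
    unfold ar
    rw [← map_mul, show arrow F β.2.2 = ofPath F β.2.2.toPath from rfl]
    by_cases h : β.2.1 = a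
    · obtain ⟨c, d, β⟩ := β
      subst h
      rw [ofPath_mul_ofPath]
      exact hmax _ _ (by simp [hq])
    · rw [ofPath_mul_ofPath_of_ne _ _ h, map_zero, mul_zero]

theorem module_finite_of_isBounded (h : ∀ j, IsBounded F (Q := Q) j) :
    Module.Finite F (𝐏).Alg := by
  choose N hN using h
  have hfg : (⨆ m ∈ Finset.range (∑ j, N j), (𝐏).deg m).FG :=
    Submodule.fg_biSup _ _ fun m _ => (degreePart_fg m).map _
  refine ⟨?_⟩
  convert hfg
  refine (eq_top_iff.2 fun x _ => ?_).symm
  induction x using (𝐏).alg_induction with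
  | zero => exact zero_mem _
  | add x y hx hy => exact add_mem (hx trivial) (hy trivial)
  | path c a b p =>
    refine Submodule.smul_mem _ _ ?_
    by_cases hp : p.length < ∑ j, N j
    · exact Submodule.mem_iSup_of_mem p.length (Submodule.mem_iSup_of_mem
        (Finset.mem_range.2 hp) (proj_mem_deg _ _ (ofPath_mem p rfl)))
    · rw [hN b a p ((Finset.single_le_sum (fun _ _ => Nat.zero_le _)
        (Finset.mem_univ b)).trans (not_lt.1 hp))]
      exact zero_mem _

variable (F) in
/-- The left ideal `A e_i`. -/
def leftIdeal (i : Quiver.Symmetrify Q) : Submodule F (𝐏).Alg :=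
  LinearMap.range (LinearMap.mulRight F ((𝐏).e i))

theorem mem_leftIdeal {i : Quiver.Symmetrify Q} {x : (𝐏).Alg} :
    x ∈ leftIdeal F i ↔ x * (𝐏).e i = x := by
  constructor
  · rintro ⟨y, rfl⟩
    rw [LinearMap.mulRight_apply, mul_assoc, e_mul_self]
  · exact fun h => ⟨x, h⟩

open scoped Classical in
/-- The sequence `A e_i → ⨁ A e_{s(α)} → A e_i`, where `α` runs through the arrows with target `i`,
is exact in the middle, and the second map is not surjective. -/
theorem sum_finrank_lt [Module.Finite F (𝐏).Alg] (i : Quiver.Symmetrify Q) :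
    ∑ α : {α : Arr (Quiver.Symmetrify Q) // α.2.1 = i}, Module.finrank F (leftIdeal F α.1.1) <
      2 * Module.finrank F (leftIdeal F (Q := Q) i) := by
  classical
  let f : leftIdeal F (Q := Q) i →ₗ[F]
      (∀ α : {α : Arr (Quiver.Symmetrify Q) // α.2.1 = i}, leftIdeal F α.1.1) :=
    LinearMap.pi fun α => (LinearMap.mulRight F ((𝐏).ar α.1.2.2)).restrict fun x hx => by
      rw [mem_leftIdeal, LinearMap.mulRight_apply, mul_assoc, ar_mul_e]
  let g : (∀ α : {α : Arr (Quiver.Symmetrify Q) // α.2.1 = i}, leftIdeal F α.1.1) →ₗ[F]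
      leftIdeal F (Q := Q) i :=
    ∑ α : {α : Arr (Quiver.Symmetrify Q) // α.2.1 = i}, sgn F α.1 •
      ((LinearMap.mulRight F ((𝐏).ar (rev α.1).2.2)).restrict fun x hx => by
        obtain ⟨α, rfl⟩ := α
        rw [mem_leftIdeal, LinearMap.mulRight_apply, mul_assoc]
        congr 1
        exact ar_mul_e _ _) ∘ₗ LinearMap.proj α
  have hg : ∀ y, (g y : (𝐏).Alg) = ∑ α : {α : Arr (Quiver.Symmetrify Q) // α.2.1 = i},
      sgn F α.1 • ((y α : (𝐏).Alg) * (𝐏).ar (rev α.1).2.2) := fun y => by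
    simp [g, LinearMap.sum_apply]
  have hker : LinearMap.ker g ≤ LinearMap.range f := by
    intro y hy
    have hy' := congrArg Subtype.val (LinearMap.mem_ker.1 hy)
    rw [hg] at hy'
    let y' : Arr (Quiver.Symmetrify Q) → (𝐏).Alg := fun α =>
      if h : α.2.1 = i then (y ⟨α, h⟩ : (𝐏).Alg) else 0
    obtain ⟨x, hx⟩ := exists_mul_ar_eq y' (fun α => by
        by_cases h : α.2.1 = i
        · simp only [y', h, dite_true]
          exact mem_leftIdeal.1 (y ⟨α, h⟩).2
        · simp [y', h]) (by
      rw [← Finset.sum_subset (Finset.subset_univ (Finset.univ.filter fun α => α.2.1 = i)),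
        ← Finset.sum_subtype_eq_sum_filter]
      · refine Eq.trans ?_ hy'
        rw [Finset.subtype_univ]
        refine Finset.sum_congr rfl fun α _ => ?_
        simp only [y', α.2, dite_true]
      · intro α _ hα
        have h : ¬ α.2.1 = i := by simpa using hα
        simp [y', h])
    refine ⟨⟨x * (𝐏).e i, mem_leftIdeal.2 (by rw [mul_assoc, e_mul_self])⟩, ?_⟩
    funext ⟨α, hα⟩
    subst hα
    refine Subtype.ext ?_
    change x * (𝐏).e α.2.1 * (𝐏).ar α.2.2 = _
    rw [mul_assoc, e_mul_ar, hx]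
    simp [y']
  have hrange : Module.finrank F (LinearMap.range g) < Module.finrank F (leftIdeal F (Q := Q) i) := by
    refine Submodule.finrank_lt fun h => ?_
    have he : (⟨(𝐏).e i, mem_leftIdeal.2 (e_mul_self _ i)⟩ : leftIdeal F (Q := Q) i) ∈
        LinearMap.range g := h ▸ Submodule.mem_top
    obtain ⟨y, hy⟩ := he
    have h1 := congrArg (fun x => (𝐏).aug i (Subtype.val x)) hy
    simp only [hg, map_sum, map_smul, map_mul, aug_ar, mul_zero, smul_zero,
      Finset.sum_const_zero, aug_e_self] at h1
    exact zero_ne_one h1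
  have h1 := LinearMap.finrank_range_add_finrank_ker g
  have h2 := Submodule.finrank_mono hker
  have h3 := LinearMap.finrank_range_le f
  rw [Module.finrank_pi_fintype] at h1
  lia

/-- Sum the inequalities of `sum_finrank_lt`, weighted by `δ`: the dimensions `x i` of the `A e_i`
satisfy `∑ δ i * ∑ x (s α) < ∑ δ i * (2 * x i)`, while the assumption on `δ` gives the opposite
inequality. -/
theorem not_module_finite (δ : Q → ℕ) (hδ0 : ∃ a, δ a ≠ 0)
    (hδ : ∀ a, 2 * δ a ≤ ∑ b, (Fintype.card (a ⟶ b) + Fintype.card (b ⟶ a)) * δ b) :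
    ¬ Module.Finite F (𝐏).Alg := by
  classical
  intro hfin
  let x : Quiver.Symmetrify Q → ℕ := fun i => Module.finrank F (leftIdeal F (Q := Q) i)
  have h1 : ∑ i : Q, δ i * ∑ α : {α : Arr (Quiver.Symmetrify Q) // α.2.1 = i}, x α.1.1 <
      ∑ i : Q, δ i * (2 * x i) := by
    obtain ⟨a, ha⟩ := hδ0
    refine Finset.sum_lt_sum (fun i _ => Nat.mul_le_mul_left _ (sum_finrank_lt (F := F) i).le)
      ⟨a, Finset.mem_univ _, Nat.mul_lt_mul_of_pos_left (sum_finrank_lt (F := F) a) (Nat.pos_of_ne_zero ha)⟩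
  have h2 : ∑ i : Q, δ i * ∑ α : {α : Arr (Quiver.Symmetrify Q) // α.2.1 = i}, x α.1.1 =
      ∑ α : Arr (Quiver.Symmetrify Q), δ α.2.1 * x α.1 := by
    rw [← Fintype.sum_fiberwise (fun α : Arr (Quiver.Symmetrify Q) => (show Q from α.2.1))]
    refine Finset.sum_congr rfl fun i _ => ?_
    rw [Finset.mul_sum]
    refine Finset.sum_congr rfl fun α _ => ?_
    rw [show δ i = δ α.1.2.1 from congrArg δ α.2.symm]
  have h3 : ∑ α : Arr (Quiver.Symmetrify Q), δ α.2.1 * x α.1 =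
      ∑ a : Q, x a * ∑ b, (Fintype.card (a ⟶ b) + Fintype.card (b ⟶ a)) * δ b := by
    rw [sum_arr]
    refine Finset.sum_congr rfl fun a _ => ?_
    rw [Finset.mul_sum]
    refine Finset.sum_congr rfl fun b _ => ?_
    refine (congrArg₂ (· + ·) (Finset.sum_const (δ b * x a)) (Finset.sum_const (δ b * x a))).trans ?_
    rw [Finset.card_univ, Finset.card_univ, smul_eq_mul, smul_eq_mul]
    ring
  rw [h2, h3] at h1
  refine absurd h1 (not_lt.2 (Finset.sum_le_sum fun a _ => ?_))
  calc δ a * (2 * x a) = x a * (2 * δ a) := by ring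
    _ ≤ _ := Nat.mul_le_mul_left _ (hδ a)

/-- In the preprojective algebra of a connected graph with a subadditive function, no nonzero element
is annihilated by all arrows on the right. Otherwise one of the right ideals `e_j A` is
finite-dimensional, hence all of them are, which the subadditive function excludes. -/
theorem eq_zero_of_mul_ar_eq_zero (hQ : IsConnectedQuiver Q) (δ : Q → ℕ) (hδ0 : ∃ a, δ a ≠ 0)
    (hδ : ∀ a, 2 * δ a ≤ ∑ b, (Fintype.card (a ⟶ b) + Fintype.card (b ⟶ a)) * δ b)
    (z : (𝐏).Alg) (h0 : ∀ α : Arr (Quiver.Symmetrify Q), z * (𝐏).ar α.2.2 = 0) : z = 0 := by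
  by_contra hz
  obtain ⟨j, hj⟩ := isBounded_of_mul_ar_eq_zero hz h0
  refine not_module_finite (F := F) δ hδ0 hδ (module_finite_of_isBounded fun i => ?_)
  obtain ⟨p⟩ := hQ.2 j i
  induction p with
  | nil => exact hj
  | cons p α ih => exact ih.of_arrow α

end Preproj

/-! ### The terms of the Koszul complex -/

namespace Env

variable {F : Type u} [Field F] {A : Type v} [Ring A] [Algebra F A]

theorem induction {C : Env F A → Prop} (x : Env F A) (zero : C 0)
    (add : ∀ x y, C x → C y → C (x + y)) (of : ∀ a b : A, C (of F a b)) : C x :=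
  TensorProduct.induction_on (motive := C) x zero (fun a b => of a b.unop) add

theorem right_mul (a b : A) : right F A (a * b) = right F A b * right F A a := by
  rw [right_apply, right_apply, right_apply, of_mul_of, mul_one]

theorem left_one : left F A 1 = 1 := rfl

theorem of_eq (a b : A) : of F a b = left F A a * right F A b := by
  rw [left_apply, right_apply, of_mul_of, mul_one, mul_one]

theorem of_eq' (a b : A) : of F a b = right F A b * left F A a := by
  rw [left_apply, right_apply, of_mul_of, one_mul, one_mul]

/-- The augmentation `A ⊗ Aᵒᵖ → F` given by two characters of `A`. -/
def char (f g : A →ₐ[F] F) : Env F A →ₐ[F] F :=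
  Algebra.TensorProduct.lift f (AlgHom.fromOpposite g fun _ _ => mul_comm _ _)
    fun _ _ => mul_comm _ _

theorem char_of (f g : A →ₐ[F] F) (a b : A) : char f g (of F a b) = f a * g b := rfl

end Env

namespace QuadraticRelations

open PathAlgebra

variable {F : Type u} [Field F] {Q : Type v} [Quiver.{w} Q] [Fintype Q]

theorem inl_eq (R : QuadraticRelations F Q) (x : PathAlgebra F Q) :
    R.inl x = Env.left F R.Alg (R.proj x) := rfl

theorem inr_eq (R : QuadraticRelations F Q) (x : PathAlgebra F Q) :
    R.inr x = Env.right F R.Alg (R.proj x) := rfl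

theorem inl_one (R : QuadraticRelations F Q) : R.inl 1 = 1 := by
  rw [inl_eq, map_one, Env.left_one]

theorem mem_W_of_lt (R : QuadraticRelations F Q) {m : ℕ} (hm : m < 2) {x : PathAlgebra F Q}
    (hx : x ∈ degreePart F Q m) : x ∈ R.W m := by
  simp only [W, Submodule.mem_inf, Submodule.mem_iInf]
  exact ⟨hx, fun i j h => absurd h (by lia)⟩

theorem vertex_mul_mem_degreePart (i : Q) {m : ℕ} {x : PathAlgebra F Q}
    (hx : x ∈ degreePart F Q m) : vertex F i * x ∈ degreePart F Q m := by
  simpa using degreePart_mul_le 0 m (Submodule.mul_mem_mul (vertex_mem i) hx)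

theorem mul_vertex_mem_degreePart (i : Q) {m : ℕ} {x : PathAlgebra F Q}
    (hx : x ∈ degreePart F Q m) : x * vertex F i ∈ degreePart F Q m := by
  simpa using degreePart_mul_le m 0 (Submodule.mul_mem_mul hx (vertex_mem i))

theorem vertex_mul_mem_W (R : QuadraticRelations F Q) (i : Q) {m : ℕ} {x : PathAlgebra F Q}
    (hx : x ∈ R.W m) : vertex F i * x ∈ R.W m := by
  simp only [W, Submodule.mem_inf, Submodule.mem_iInf] at hx ⊢
  refine ⟨vertex_mul_mem_degreePart i hx.1, fun k l h => ?_⟩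
  have hx' := Submodule.mul_mem_mul (vertex_mem (F := F) i) (hx.2 k l h)
  rw [← mul_assoc, ← mul_assoc] at hx'
  exact mul_le_mul' (mul_le_mul' ((degreePart_mul_le 0 k).trans_eq (by rw [zero_add])) le_rfl)
    le_rfl hx'

theorem mul_vertex_mem_W (R : QuadraticRelations F Q) (i : Q) {m : ℕ} {x : PathAlgebra F Q}
    (hx : x ∈ R.W m) : x * vertex F i ∈ R.W m := by
  simp only [W, Submodule.mem_inf, Submodule.mem_iInf] at hx ⊢
  refine ⟨mul_vertex_mem_degreePart i hx.1, fun k l h => ?_⟩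
  have hx' := Submodule.mul_mem_mul (hx.2 k l h) (vertex_mem (F := F) i)
  rw [mul_assoc] at hx'
  exact mul_le_mul' le_rfl (degreePart_mul_le l 0) hx'

/-- The map `x ↦ e_i x e_j` on `W_m`. -/
def cut (R : QuadraticRelations F Q) (m : ℕ) (i j : Q) : R.W m →ₗ[F] R.W m where
  toFun x := ⟨vertex F i * x * vertex F j, R.mul_vertex_mem_W j (R.vertex_mul_mem_W i x.2)⟩
  map_add' x y := Subtype.ext (by
    change _ * ((x : PathAlgebra F Q) + y) * _ = _ * (x : PathAlgebra F Q) * _ + _ * y * _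
    rw [mul_add, add_mul])
  map_smul' c x := Subtype.ext (by
    change _ * (c • (x : PathAlgebra F Q)) * _ = c • (_ * (x : PathAlgebra F Q) * _)
    rw [mul_smul_comm, smul_mul_assoc])

theorem cut_coe (R : QuadraticRelations F Q) (m : ℕ) (i j : Q) (x : R.W m) :
    (R.cut m i j x : PathAlgebra F Q) = vertex F i * x * vertex F j := rfl

theorem sum_cut (R : QuadraticRelations F Q) (m : ℕ) (x : R.W m) :
    ∑ i, ∑ j, R.cut m i j x = x := by
  refine Subtype.ext ?_
  simp only [AddSubmonoidClass.coe_finsetSum, cut_coe]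
  simp only [← Finset.mul_sum, ← Finset.sum_mul]
  rw [← one_def', one_mul, mul_one]

/-- The element `1 ⊗ x ⊗ 1` of the term `A ⊗_k W_m ⊗_k A` of the Koszul complex. -/
def kmk (R : QuadraticRelations F Q) (m : ℕ) (x : R.W m) : R.KoszulModule m :=
  Submodule.Quotient.mk (1 ⊗ₜ x)

theorem mk_tmul (R : QuadraticRelations F Q) (m : ℕ) (u : Env F R.Alg) (x : R.W m) :
    (Submodule.Quotient.mk (u ⊗ₜ x) : R.KoszulModule m) = u • R.kmk m x := by
  rw [kmk, ← Submodule.Quotient.mk_smul, TensorProduct.smul_tmul', smul_eq_mul, mul_one]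

theorem kmk_add (R : QuadraticRelations F Q) (m : ℕ) (x y : R.W m) :
    R.kmk m (x + y) = R.kmk m x + R.kmk m y := by
  rw [kmk, TensorProduct.tmul_add]; rfl

theorem kmk_zero (R : QuadraticRelations F Q) (m : ℕ) : R.kmk m 0 = 0 := by
  rw [kmk, TensorProduct.tmul_zero]; rfl

theorem kmk_smul (R : QuadraticRelations F Q) (m : ℕ) (c : F) (x : R.W m) :
    R.kmk m (c • x) = c • R.kmk m x := by
  rw [kmk, TensorProduct.tmul_smul]; rfl

theorem kmk_sum (R : QuadraticRelations F Q) (m : ℕ) {ι : Type*} (s : Finset ι) (x : ι → R.W m) :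
    R.kmk m (∑ i ∈ s, x i) = ∑ i ∈ s, R.kmk m (x i) :=
  map_sum (⟨⟨R.kmk m, R.kmk_zero m⟩, R.kmk_add m⟩ : R.W m →+ R.KoszulModule m) x s

/-- The terms of the Koszul complex are spanned by the elements `(a ⊗ b) x`. -/
theorem koszulModule_induction (R : QuadraticRelations F Q) (m : ℕ)
    {C : R.KoszulModule m → Prop} (z : R.KoszulModule m)
    (zero : C 0) (add : ∀ x y, C x → C y → C (x + y))
    (smul : ∀ (u : Env F R.Alg) (x : R.W m), C (u • R.kmk m x)) : C z := by
  obtain ⟨y, rfl⟩ := Submodule.Quotient.mk_surjective _ z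
  induction y using TensorProduct.induction_on with
  | zero => exact zero
  | add x y hx hy => exact add _ _ hx hy
  | tmul u x => rw [mk_tmul]; exact smul u x

theorem koszulModule_hom_ext (R : QuadraticRelations F Q) (m : ℕ) {M : Type*} [AddCommGroup M]
    [Module (Env F R.Alg) M] {f g : R.KoszulModule m →ₗ[Env F R.Alg] M}
    (h : ∀ x, f (R.kmk m x) = g (R.kmk m x)) : f = g := by
  refine LinearMap.ext fun z => ?_
  induction z using R.koszulModule_induction m with
  | zero => simp
  | add x y hx hy => rw [map_add, map_add, hx, hy]
  | smul u x => rw [map_smul, map_smul, h]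

theorem inl_smul_kmk (R : QuadraticRelations F Q) (m : ℕ) (i : Q) (x x' : R.W m)
    (h : (x' : PathAlgebra F Q) = vertex F i * x) :
    R.inl (vertex F i) • R.kmk m x = R.kmk m x' := by
  rw [← mk_tmul, kmk, ← sub_eq_zero, ← Submodule.Quotient.mk_sub, Submodule.Quotient.mk_eq_zero]
  exact Submodule.subset_span (Or.inl ⟨i, x, x', h, rfl⟩)

theorem inr_smul_kmk (R : QuadraticRelations F Q) (m : ℕ) (i : Q) (x x' : R.W m)
    (h : (x' : PathAlgebra F Q) = x * vertex F i) :
    R.inr (vertex F i) • R.kmk m x = R.kmk m x' := by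
  rw [← mk_tmul, kmk, ← sub_eq_zero, ← Submodule.Quotient.mk_sub, Submodule.Quotient.mk_eq_zero]
  exact Submodule.subset_span (Or.inr ⟨i, x, x', h, rfl⟩)

/-- The idempotent `e_i ⊗ e_j` of the enveloping algebra. -/
def ee (R : QuadraticRelations F Q) (i j : Q) : Env F R.Alg := Env.of F (R.e i) (R.e j)

theorem ee_eq (R : QuadraticRelations F Q) (i j : Q) :
    R.ee i j = R.inl (vertex F i) * R.inr (vertex F j) := Env.of_eq _ _

theorem ee_smul_kmk (R : QuadraticRelations F Q) (m : ℕ) (i j : Q) (x : R.W m) :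
    R.ee i j • R.kmk m x = R.kmk m (R.cut m i j x) := by
  rw [ee_eq, mul_smul, R.inr_smul_kmk m j x ⟨_, R.mul_vertex_mem_W j x.2⟩ rfl,
    R.inl_smul_kmk m i _ (R.cut m i j x) (by rw [cut_coe, mul_assoc])]

/-- The section `(a ⊗ b) x ↦ ∑ (a e_i ⊗ e_j b) ⊗ e_i x e_j` of the projection from
`A ⊗_F W_m ⊗_F A` to `A ⊗_k W_m ⊗_k A`, before passing to the quotient. -/
def preSection (R : QuadraticRelations F Q) (m : ℕ) : R.Pre m →ₗ[Env F R.Alg] R.Pre m :=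
  ∑ i : Q, ∑ j : Q, TensorProduct.AlgebraTensorModule.map
    (LinearMap.toSpanSingleton (Env F R.Alg) (Env F R.Alg) (R.ee i j)) (R.cut m i j)

theorem preSection_tmul (R : QuadraticRelations F Q) (m : ℕ) (u : Env F R.Alg) (x : R.W m) :
    R.preSection m (u ⊗ₜ x) = ∑ i : Q, ∑ j : Q, (u * R.ee i j) ⊗ₜ R.cut m i j x := by
  simp [preSection, LinearMap.sum_apply]

theorem balance_le_ker_preSection (R : QuadraticRelations F Q) (m : ℕ) :
    R.balance m ≤ LinearMap.ker (R.preSection m) := by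
  classical
  refine Submodule.span_le.2 ?_
  rintro _ (⟨k, x, x', hx, rfl⟩ | ⟨k, x, x', hx, rfl⟩)
  · rw [SetLike.mem_coe, LinearMap.mem_ker, map_sub, sub_eq_zero, preSection_tmul,
      preSection_tmul]
    refine Finset.sum_congr rfl fun i _ => Finset.sum_congr rfl fun j _ => ?_
    rw [ee_eq, ← mul_assoc, inl_mul_inl, one_mul]
    by_cases h : k = i
    · subst h
      rw [vertex_mul_self]
      congr 1
      refine Subtype.ext ?_
      rw [cut_coe, cut_coe, hx, ← mul_assoc (vertex F k), vertex_mul_self]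
    · have h0 : R.cut m i j x' = 0 := by
        refine Subtype.ext ?_
        rw [cut_coe, hx, ← mul_assoc (vertex F i), vertex_mul_vertex_of_ne (Ne.symm h), zero_mul,
          zero_mul]
        rfl
      rw [vertex_mul_vertex_of_ne h, map_zero, zero_mul, zero_tmul, h0, tmul_zero]
  · rw [SetLike.mem_coe, LinearMap.mem_ker, map_sub, sub_eq_zero, preSection_tmul,
      preSection_tmul]
    refine Finset.sum_congr rfl fun i _ => Finset.sum_congr rfl fun j _ => ?_
    rw [ee_eq, inl_mul_inr, ← mul_assoc, inr_mul_inr, one_mul]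
    by_cases h : k = j
    · subst h
      rw [vertex_mul_self]
      congr 1
      refine Subtype.ext ?_
      rw [cut_coe, cut_coe, hx, mul_assoc, mul_assoc, mul_assoc, vertex_mul_self]
    · have h0 : R.cut m i j x' = 0 := by
        refine Subtype.ext ?_
        rw [cut_coe, hx, mul_assoc, mul_assoc, vertex_mul_vertex_of_ne h, mul_zero, mul_zero]
        rfl
      rw [vertex_mul_vertex_of_ne (Ne.symm h), map_zero, zero_mul, zero_tmul, h0, tmul_zero]

/-- The section `(a ⊗ b) x ↦ ∑ (a e_i ⊗ e_j b) ⊗ e_i x e_j` of the projection from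
`A ⊗_F W_m ⊗_F A` to `A ⊗_k W_m ⊗_k A`. -/
def ksec (R : QuadraticRelations F Q) (m : ℕ) :
    R.KoszulModule m →ₗ[Env F R.Alg] R.Pre m :=
  (R.balance m).liftQ (R.preSection m) (R.balance_le_ker_preSection m)

theorem ksec_kmk (R : QuadraticRelations F Q) (m : ℕ) (x : R.W m) :
    R.ksec m (R.kmk m x) = ∑ i : Q, ∑ j : Q, R.ee i j ⊗ₜ R.cut m i j x := by
  refine (R.preSection_tmul m 1 x).trans ?_
  simp only [one_mul]

theorem mkQ_comp_ksec (R : QuadraticRelations F Q) (m : ℕ) :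
    (R.balance m).mkQ ∘ₗ R.ksec m = LinearMap.id := by
  refine R.koszulModule_hom_ext m fun x => ?_
  rw [LinearMap.comp_apply, ksec_kmk, map_sum, LinearMap.id_apply]
  conv_rhs => rw [← R.sum_cut m x, kmk_sum]
  refine Finset.sum_congr rfl fun i _ => ?_
  rw [map_sum, kmk_sum]
  refine Finset.sum_congr rfl fun j _ => ?_
  change (Submodule.Quotient.mk _ : R.KoszulModule m) = _
  rw [mk_tmul, ee_smul_kmk]
  congr 1
  refine Subtype.ext ?_
  rw [cut_coe, cut_coe]
  simp only [mul_assoc, vertex_mul_self]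
  simp only [← mul_assoc, vertex_mul_self]

instance (R : QuadraticRelations F Q) (m : ℕ) :
    Module.Projective (Env F R.Alg) (R.KoszulModule m) :=
  Module.Projective.of_split (R.ksec m) (R.balance m).mkQ (R.mkQ_comp_ksec m)

variable [∀ a b : Q, Fintype (a ⟶ b)]

instance (R : QuadraticRelations F Q) (m : ℕ) : Module.Finite F (R.W m) :=
  Module.Finite.iff_fg.2 ((degreePart_fg m).of_le inf_le_left)

instance (R : QuadraticRelations F Q) (m : ℕ) :
    Module.Finite (Env F R.Alg) (R.KoszulModule m) :=
  Module.Finite.of_surjective (R.balance m).mkQ (Submodule.mkQ_surjective _)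

theorem koszulD_kmk (R : QuadraticRelations F Q) (m : ℕ) (x : R.W (m + 1)) :
    R.koszulD m (R.kmk (m + 1) x) =
      ∑ α : Arr Q, R.inl (arrow F α.2.2) • R.kmk m (R.leftW m α.2.2 x) + (-1 : ℤ) ^ (m + 1) •
        ∑ α : Arr Q, R.inr (arrow F α.2.2) • R.kmk m (R.rightW m α.2.2 x) := by
  rw [kmk, koszulD_mk, preD, LinearMap.add_apply, LinearMap.smul_apply, preLeft_tmul,
    preRight_tmul]
  simp only [← mk_tmul, one_mul]
  rw [Submodule.Quotient.mk_add, Submodule.Quotient.mk_smul]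
  congr 1
  · exact map_sum (R.balance m).mkQ _ _
  · congr 1
    exact map_sum (R.balance m).mkQ _ _

end QuadraticRelations

namespace Env

variable (F : Type u) [Field F] {A : Type v} [Ring A] [Algebra F A]

/-- The elements of `A`, as elements of the bimodule `A`. -/
def reg : A ≃+ regular F A := AddEquiv.refl A

theorem of_smul_reg (a b x : A) : of F a b • reg F x = reg F (a * x * b) :=
  congrArg (reg F) (mul_assoc a x b).symm

end Env

namespace QuadraticRelations

open PathAlgebra

variable {F : Type u} [Field F] {Q : Type v} [Quiver.{w} Q] [Fintype Q]

/-- The idempotent `e_i`, as an element of `W_0 = k`. -/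
def vertW (R : QuadraticRelations F Q) (i : Q) : R.W 0 :=
  ⟨vertex F i, R.mem_W_of_lt (by lia) (vertex_mem i)⟩

/-- An arrow, as an element of `W_1 = V`. -/
def arrW (R : QuadraticRelations F Q) {a b : Q} (α : a ⟶ b) : R.W 1 :=
  ⟨arrow F α, R.mem_W_of_lt (by lia) (ofPath_mem _ rfl)⟩

theorem span_vertW (R : QuadraticRelations F Q) :
    Submodule.span F (Set.range R.vertW) = ⊤ := by
  apply Submodule.map_injective_of_injective (R.W 0).injective_subtype
  rw [Submodule.map_span, ← Set.range_comp, Submodule.map_top, Submodule.range_subtype]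
  have : (⇑(R.W 0).subtype ∘ R.vertW) = vertex F := rfl
  rw [this, span_vertex]
  exact le_antisymm (fun x hx => R.mem_W_of_lt (by lia) hx) inf_le_left

theorem span_arrW (R : QuadraticRelations F Q) :
    Submodule.span F (Set.range fun α : Arr Q => R.arrW α.2.2) = ⊤ := by
  apply Submodule.map_injective_of_injective (R.W 1).injective_subtype
  rw [Submodule.map_span, ← Set.range_comp, Submodule.map_top, Submodule.range_subtype]
  have : (⇑(R.W 1).subtype ∘ fun α : Arr Q => R.arrW α.2.2) = fun α => arrow F α.2.2 := rfl
  rw [this, span_arrow]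
  exact le_antisymm (fun x hx => R.mem_W_of_lt (by lia) hx) inf_le_left

theorem mem_W_two (R : QuadraticRelations F Q) {r : PathAlgebra F Q} (hr : r ∈ R.carrier) :
    r ∈ R.W 2 := by
  simp only [W, Submodule.mem_inf, Submodule.mem_iInf]
  refine ⟨R.le_degree hr, fun i j h => ?_⟩
  obtain ⟨rfl, rfl⟩ : i = 0 ∧ j = 0 := by lia
  have h1 : (1 : PathAlgebra F Q) ∈ degreePart F Q 0 := sum_mem fun i _ => vertex_mem i
  simpa using Submodule.mul_mem_mul (Submodule.mul_mem_mul h1 hr) h1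

/-! ### The augmentation of the Koszul complex -/

/-- The generator `1 ⊗ 1` of `A ⊗_k A`. -/
def kgen (R : QuadraticRelations F Q) : R.KoszulModule 0 :=
  R.kmk 0 ⟨1, R.mem_W_of_lt (by lia) (sum_mem fun i _ => vertex_mem i)⟩

theorem inl_vertex_smul_kgen (R : QuadraticRelations F Q) (i : Q) :
    R.inl (vertex F i) • R.kgen = R.kmk 0 (R.vertW i) :=
  R.inl_smul_kmk 0 i _ _ (mul_one _).symm

theorem inr_vertex_smul_kgen (R : QuadraticRelations F Q) (i : Q) :
    R.inr (vertex F i) • R.kgen = R.kmk 0 (R.vertW i) :=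
  R.inr_smul_kmk 0 i _ _ (one_mul _).symm

theorem kmk_zero_eq (R : QuadraticRelations F Q) (x : R.W 0) :
    R.kmk 0 x = R.inl x • R.kgen := by
  have hx : x ∈ Submodule.span F (Set.range R.vertW) := R.span_vertW ▸ Submodule.mem_top
  induction hx using Submodule.span_induction with
  | mem x hx => obtain ⟨i, rfl⟩ := hx; exact (R.inl_vertex_smul_kgen i).symm
  | zero => rw [kmk_zero, Submodule.coe_zero, map_zero, zero_smul]
  | add x y _ _ hx hy => rw [kmk_add, hx, hy, Submodule.coe_add, map_add, add_smul]
  | smul c x _ hx => rw [kmk_smul, hx, Submodule.coe_smul, map_smul, smul_assoc]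

theorem exists_smul_kgen (R : QuadraticRelations F Q) (z : R.KoszulModule 0) :
    ∃ u : Env F R.Alg, z = u • R.kgen := by
  induction z using R.koszulModule_induction 0 with
  | zero => exact ⟨0, (zero_smul _ _).symm⟩
  | add x y hx hy =>
    obtain ⟨u, rfl⟩ := hx
    obtain ⟨u', rfl⟩ := hy
    exact ⟨u + u', (add_smul _ _ _).symm⟩
  | smul u x => exact ⟨u * R.inl x, by rw [kmk_zero_eq, smul_smul]⟩

/-- The map `(a ⊗ b) ⊗ x ↦ a x ⊗ b`. -/
def preMul (R : QuadraticRelations F Q) (m : ℕ) : R.Pre m →ₗ[Env F R.Alg] Env F R.Alg :=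
  TensorProduct.AlgebraTensorModule.lift
    { toFun := fun u => (LinearMap.mulLeft F u) ∘ₗ R.inl ∘ₗ (R.W m).subtype
      map_add' := fun u u' => by ext; simp [add_mul]
      map_smul' := fun u u' => by ext; simp }

theorem preMul_tmul (R : QuadraticRelations F Q) (m : ℕ) (u : Env F R.Alg) (x : R.W m) :
    R.preMul m (u ⊗ₜ x) = u * R.inl x := rfl

theorem preMul_ksec_kgen (R : QuadraticRelations F Q) :
    R.preMul 0 (R.ksec 0 R.kgen) = ∑ i : Q, R.ee i i := by
  rw [kgen, ksec_kmk, map_sum]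
  refine Finset.sum_congr rfl fun i _ => ?_
  rw [map_sum, Finset.sum_eq_single i]
  · rw [preMul_tmul, cut_coe, mul_one, vertex_mul_self, ee_eq, inl_mul_inr, mul_assoc,
      inl_mul_inl, vertex_mul_self]
  · intro j _ hj
    rw [preMul_tmul, cut_coe, mul_one, vertex_mul_vertex_of_ne (Ne.symm hj), map_zero, mul_zero]
  · exact fun h => absurd (Finset.mem_univ _) h

/-- The augmentation `A ⊗_k A → A`, that is, the multiplication of `A`. -/
def koszulAug (R : QuadraticRelations F Q) :
    R.KoszulModule 0 →ₗ[Env F R.Alg] Env.regular F R.Alg :=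
  (LinearMap.toSpanSingleton (Env F R.Alg) (Env.regular F R.Alg) (Env.reg F 1)) ∘ₗ
    R.preMul 0 ∘ₗ R.ksec 0

theorem koszulAug_kgen (R : QuadraticRelations F Q) :
    R.koszulAug R.kgen = Env.reg F 1 := by
  rw [koszulAug, LinearMap.comp_apply, LinearMap.comp_apply, preMul_ksec_kgen,
    LinearMap.toSpanSingleton_apply, Finset.sum_smul]
  refine (Finset.sum_congr rfl fun i _ => ?_).trans ((map_sum (Env.reg F) R.e _).symm.trans
    (congrArg _ R.sum_e))
  rw [ee, Env.of_smul_reg, mul_one, e_mul_self]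

theorem koszulAug_smul_kgen (R : QuadraticRelations F Q) (u : Env F R.Alg) :
    R.koszulAug (u • R.kgen) = u • Env.reg F (1 : R.Alg) := by
  rw [map_smul, koszulAug_kgen]

theorem koszulAug_surjective (R : QuadraticRelations F Q) :
    Function.Surjective R.koszulAug := fun a => by
  obtain ⟨a, rfl⟩ := (Env.reg F).surjective a
  exact ⟨Env.of F a 1 • R.kgen, by
    rw [koszulAug_smul_kgen, Env.of_smul_reg, mul_one, mul_one]⟩

variable [∀ a b : Q, Fintype (a ⟶ b)]

theorem leftW_arrW (R : QuadraticRelations F Q) {a b : Q} (α : a ⟶ b) :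
    R.leftW 0 α (R.arrW α) = R.vertW a := Subtype.ext (leftStrip_cons α _)

theorem rightW_arrW (R : QuadraticRelations F Q) {a b : Q} (α : a ⟶ b) :
    R.rightW 0 α (R.arrW α) = R.vertW b := Subtype.ext (rightStrip_comp α .nil)

theorem leftW_arrW_of_ne (R : QuadraticRelations F Q) {α β : Arr Q} (h : α ≠ β) :
    R.leftW 0 α.2.2 (R.arrW β.2.2) = 0 := Subtype.ext (leftStrip_cons_of_ne α.2.2 β.2.2 _ h)

theorem rightW_arrW_of_ne (R : QuadraticRelations F Q) {α β : Arr Q} (h : α ≠ β) :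
    R.rightW 0 α.2.2 (R.arrW β.2.2) = 0 :=
  Subtype.ext (rightStrip_comp_of_ne α.2.2 β.2.2 .nil h)

theorem koszulD_kmk_arrW (R : QuadraticRelations F Q) {a b : Q} (α : a ⟶ b) :
    R.koszulD 0 (R.kmk 1 (R.arrW α)) = (R.inl (arrow F α) - R.inr (arrow F α)) • R.kgen := by
  rw [koszulD_kmk, Finset.sum_eq_single (⟨a, b, α⟩ : Arr Q), Finset.sum_eq_single
    (⟨a, b, α⟩ : Arr Q), leftW_arrW, rightW_arrW, ← inl_vertex_smul_kgen,
    ← inr_vertex_smul_kgen, smul_smul, smul_smul, inl_mul_inl, inr_mul_inr, arrow_mul_vertex,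
    vertex_mul_arrow, sub_smul, zero_add, pow_one, neg_smul, one_smul, sub_eq_add_neg]
  · intro β _ h
    rw [R.rightW_arrW_of_ne (β := ⟨a, b, α⟩) h, kmk_zero, smul_zero]
  · exact fun h => absurd (Finset.mem_univ _) h
  · intro β _ h
    rw [R.leftW_arrW_of_ne (β := ⟨a, b, α⟩) h, kmk_zero, smul_zero]
  · exact fun h => absurd (Finset.mem_univ _) h

theorem koszulAug_koszulD (R : QuadraticRelations F Q) :
    R.koszulAug ∘ₗ R.koszulD 0 = 0 := by
  refine R.koszulModule_hom_ext 1 fun x => ?_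
  have hx : x ∈ Submodule.span F (Set.range fun α : Arr Q => R.arrW α.2.2) :=
    R.span_arrW ▸ Submodule.mem_top
  rw [LinearMap.zero_apply]
  induction hx using Submodule.span_induction with
  | mem x hx =>
    obtain ⟨α, rfl⟩ := hx
    rw [LinearMap.comp_apply, koszulD_kmk_arrW, koszulAug_smul_kgen, sub_smul, inl_eq, inr_eq,
      Env.left_apply, Env.right_apply, Env.of_smul_reg, Env.of_smul_reg, one_mul, one_mul,
      mul_one, mul_one, sub_self]
  | zero => rw [kmk_zero, map_zero]
  | add x y _ _ hx hy => rw [kmk_add, map_add, hx, hy, add_zero]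
  | smul c x _ hx => rw [kmk_smul, ← algebraMap_smul (Env F R.Alg) c, map_smul, hx, smul_zero]

theorem inl_sub_inr_mem (R : QuadraticRelations F Q) (x : PathAlgebra F Q) :
    (R.inl x - R.inr x) • R.kgen ∈ LinearMap.range (R.koszulD 0) := by
  induction x using PathAlgebra.induction with
  | zero => simp
  | add x y hx hy =>
    rw [map_add, map_add, add_sub_add_comm, add_smul]
    exact add_mem hx hy
  | path c a b p =>
    rw [map_smul, map_smul, ← smul_sub, smul_assoc, ← algebraMap_smul (Env F R.Alg) c]
    refine Submodule.smul_mem _ _ ?_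
    induction p with
    | nil =>
      have h := (R.inl_vertex_smul_kgen a).trans (R.inr_vertex_smul_kgen a).symm
      rw [sub_smul]
      change R.inl (vertex F a) • R.kgen - R.inr (vertex F a) • R.kgen ∈ _
      rw [h, sub_self]
      exact zero_mem _
    | cons p α ih =>
      have h : (R.inl (ofPath F (p.cons α)) - R.inr (ofPath F (p.cons α))) • R.kgen =
          R.inl (arrow F α) • (R.inl (ofPath F p) - R.inr (ofPath F p)) • R.kgen +
            R.inr (ofPath F p) • R.koszulD 0 (R.kmk 1 (R.arrW α)) := by
        rw [koszulD_kmk_arrW, ofPath_cons, ← inl_mul_inl, ← inr_mul_inr, smul_smul, smul_smul,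
          ← add_smul, mul_sub, mul_sub, inl_mul_inr]
        congr 1
        abel
      rw [h]
      exact add_mem (Submodule.smul_mem _ _ ih)
        (Submodule.smul_mem _ _ (LinearMap.mem_range_self _ _))

/-- Exactness of `A ⊗_k V ⊗_k A → A ⊗_k A → A`. -/
theorem mem_range_koszulD_zero (R : QuadraticRelations F Q) (z : R.KoszulModule 0)
    (hz : R.koszulAug z = 0) : z ∈ LinearMap.range (R.koszulD 0) := by
  obtain ⟨u, rfl⟩ := R.exists_smul_kgen z
  rw [koszulAug_smul_kgen] at hz
  have key : ∀ u : Env F R.Alg, u • R.kgen -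
      Env.right F R.Alg ((Env.reg F).symm (u • Env.reg F (1 : R.Alg))) • R.kgen ∈
        LinearMap.range (R.koszulD 0) := by
    intro u
    induction u using Env.induction with
    | zero => simp
    | add x y hx hy =>
      have h := add_mem hx hy
      rw [sub_add_sub_comm, ← add_smul, ← add_smul, ← map_add, ← map_add, ← add_smul] at h
      exact h
    | of a b =>
      rw [Env.of_smul_reg, AddEquiv.symm_apply_apply, Env.of_eq', mul_one, Env.right_mul, mul_smul,
        mul_smul, ← smul_sub, ← sub_smul]
      obtain ⟨x, rfl⟩ := R.proj_surjective a
      exact Submodule.smul_mem _ _ (R.inl_sub_inr_mem x)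
  have h := key u
  rwa [hz, map_zero, map_zero, zero_smul, sub_zero] at h

/-! ### The universal derivation -/

/-- The cokernel of `A ⊗_k R ⊗_k A → A ⊗_k V ⊗_k A`. -/
abbrev Omega (R : QuadraticRelations F Q) : Type (max u v w) :=
  R.KoszulModule 1 ⧸ LinearMap.range (R.koszulD 1)

/-- The derivation of the path algebra that maps an arrow `α` to the class of `1 ⊗ α ⊗ 1`, on
paths. -/
def derivPath (R : QuadraticRelations F Q) {a : Q} : ∀ {b : Q}, Quiver.Path a b → R.Omega
  | _, .nil => 0
  | _, .cons p α => R.inr (ofPath F p) • Submodule.Quotient.mk (R.kmk 1 (R.arrW α)) +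
      R.inl (arrow F α) • derivPath R p

/-- The derivation of the path algebra that maps an arrow `α` to the class of `1 ⊗ α ⊗ 1`. -/
def deriv (R : QuadraticRelations F Q) : PathAlgebra F Q →ₗ[F] R.Omega :=
  Finsupp.linearCombination F fun p : QPath Q => R.derivPath p.2.2

theorem deriv_ofPath (R : QuadraticRelations F Q) {a b : Q} (p : Quiver.Path a b) :
    R.deriv (ofPath F p) = R.derivPath p :=
  (Finsupp.linearCombination_single F (1 : F) (⟨a, b, p⟩ : QPath Q)).trans (one_smul F _)

theorem deriv_vertex (R : QuadraticRelations F Q) (i : Q) : R.deriv (vertex F i) = 0 :=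
  R.deriv_ofPath _

theorem inl_vertex_smul_arrW (R : QuadraticRelations F Q) {a b : Q} (α : a ⟶ b) :
    R.inl (vertex F b) • R.kmk 1 (R.arrW α) = R.kmk 1 (R.arrW α) :=
  R.inl_smul_kmk 1 b _ _ (vertex_mul_arrow α).symm

theorem inr_vertex_smul_arrW (R : QuadraticRelations F Q) {a b : Q} (α : a ⟶ b) :
    R.inr (vertex F a) • R.kmk 1 (R.arrW α) = R.kmk 1 (R.arrW α) :=
  R.inr_smul_kmk 1 a _ _ (arrow_mul_vertex α).symm

theorem deriv_arrow (R : QuadraticRelations F Q) {a b : Q} (α : a ⟶ b) :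
    R.deriv (arrow F α) = Submodule.Quotient.mk (R.kmk 1 (R.arrW α)) := by
  refine (R.deriv_ofPath _).trans ?_
  change R.inr (vertex F a) • Submodule.Quotient.mk (R.kmk 1 (R.arrW α)) +
    R.inl (arrow F α) • (0 : R.Omega) = _
  rw [smul_zero, add_zero, ← Submodule.Quotient.mk_smul, inr_vertex_smul_arrW]

theorem inl_vertex_smul_derivPath (R : QuadraticRelations F Q) {a b : Q} (p : Quiver.Path a b) :
    R.inl (vertex F b) • R.derivPath p = R.derivPath p := by
  cases p with
  | nil => exact smul_zero _
  | cons p α =>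
    rw [derivPath, smul_add, smul_smul, smul_smul, inl_mul_inl, vertex_mul_arrow, inl_mul_inr,
      mul_smul (R.inr _), ← Submodule.Quotient.mk_smul, inl_vertex_smul_arrW]

theorem inr_vertex_smul_derivPath (R : QuadraticRelations F Q) {a b : Q} (p : Quiver.Path a b) :
    R.inr (vertex F a) • R.derivPath p = R.derivPath p := by
  classical
  induction p with
  | nil => exact smul_zero _
  | cons p α ih =>
    rw [derivPath, smul_add, smul_smul, smul_smul, inr_mul_inr, ofPath_mul_vertex, if_pos rfl,
      ← inl_mul_inr, mul_smul (R.inl _), ih]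

theorem derivPath_comp (R : QuadraticRelations F Q) {a b c : Q} (p : Quiver.Path b c)
    (q : Quiver.Path a b) : R.derivPath (q.comp p) =
      R.inl (ofPath F p) • R.derivPath q + R.inr (ofPath F q) • R.derivPath p := by
  induction p with
  | nil =>
    change _ = R.inl (vertex F b) • R.derivPath q + _ • (0 : R.Omega)
    rw [smul_zero, add_zero, inl_vertex_smul_derivPath]
    rfl
  | cons p α ih =>
    rw [Quiver.Path.comp_cons, derivPath, derivPath, ih, ← ofPath_mul_ofPath, ← inr_mul_inr,
      ofPath_cons, ← inl_mul_inl, smul_add, smul_add]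
    simp only [smul_smul]
    rw [inl_mul_inr]
    abel

theorem deriv_mul (R : QuadraticRelations F Q) (x y : PathAlgebra F Q) :
    R.deriv (x * y) = R.inl x • R.deriv y + R.inr y • R.deriv x := by
  induction x using PathAlgebra.induction with
  | zero => simp
  | add x x' hx hx' =>
    rw [add_mul, map_add, hx, hx', map_add, map_add, add_smul, smul_add]
    abel
  | path c a b p =>
  induction y using PathAlgebra.induction with
  | zero => simp
  | add x x' hx hx' =>
    rw [mul_add, map_add, hx, hx', map_add, map_add, add_smul, smul_add]
    abel
  | path c' a' b' q =>
    simp only [smul_mul_assoc, mul_smul_comm, map_smul, smul_assoc]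
    rw [smul_comm (R.inl _) c', smul_comm (R.inr _) c, smul_comm c' c (R.inr _ • _),
      smul_comm c' c (R.deriv _), ← smul_add, ← smul_add]
    congr 2
    rw [deriv_ofPath, deriv_ofPath]
    by_cases h : b' = a
    · subst h
      rw [ofPath_mul_ofPath, deriv_ofPath, derivPath_comp]
    · rw [ofPath_mul_ofPath_of_ne _ _ h, map_zero, ← R.inl_vertex_smul_derivPath q,
        ← R.inr_vertex_smul_derivPath p, smul_smul, smul_smul, inl_mul_inl, inr_mul_inr, vertex,
        vertex, ofPath_mul_ofPath_of_ne _ _ h, ofPath_mul_ofPath_of_ne _ _ h,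
        map_zero, map_zero, zero_smul, zero_smul, add_zero]

theorem deriv_of_mem_one (R : QuadraticRelations F Q) (x : R.W 1) :
    R.deriv (x : PathAlgebra F Q) = Submodule.Quotient.mk (R.kmk 1 x) := by
  have hx : x ∈ Submodule.span F (Set.range fun α : Arr Q => R.arrW α.2.2) :=
    R.span_arrW ▸ Submodule.mem_top
  induction hx using Submodule.span_induction with
  | mem x hx => obtain ⟨α, rfl⟩ := hx; exact R.deriv_arrow α.2.2
  | zero => rw [kmk_zero]; exact map_zero _
  | add x y _ _ hx hy => rw [kmk_add, Submodule.coe_add, map_add, hx, hy]; rfl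
  | smul c x _ hx => rw [kmk_smul, Submodule.coe_smul, map_smul, hx]; rfl

theorem deriv_of_mem_two (R : QuadraticRelations F Q) {x : PathAlgebra F Q}
    (hx : x ∈ degreePart F Q 2) : R.deriv x =
      ∑ α : Arr Q, R.inl (arrow F α.2.2) • R.deriv (leftStrip α.2.2 x) +
        ∑ α : Arr Q, R.inr (arrow F α.2.2) • R.deriv (rightStrip α.2.2 x) := by
  induction hx using Submodule.span_induction with
  | zero => simp
  | add x y _ _ hx hy =>
    simp only [map_add, smul_add, Finset.sum_add_distrib]
    rw [hx, hy]
    abel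
  | smul c x _ hx =>
    simp only [map_smul, smul_comm _ c]
    rw [hx, ← Finset.smul_sum, ← Finset.smul_sum, smul_add]
  | mem x hx =>
  obtain ⟨i, j, p, hp, rfl⟩ := hx
  obtain ⟨k, p, β, rfl⟩ := (Quiver.Path.length_ne_zero_iff_eq_cons p).1 (by lia)
  obtain ⟨l, p, α, rfl⟩ := (Quiver.Path.length_ne_zero_iff_eq_cons p).1 (by simp at hp; lia)
  have hp : p.length = 0 := by simpa using hp
  obtain rfl := Quiver.Path.eq_of_length_zero p hp
  obtain rfl := Quiver.Path.eq_nil_of_length_zero p hp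
  have e : ((Quiver.Path.nil.cons α).cons β) = α.toPath.comp (β.toPath) := rfl
  rw [Finset.sum_eq_single (⟨k, j, β⟩ : Arr Q), Finset.sum_eq_single (⟨i, k, α⟩ : Arr Q)]
  · rw [leftStrip_cons, e, rightStrip_comp, ← ofPath_mul_ofPath, deriv_mul]
    rfl
  · intro γ _ h
    rw [e, rightStrip_comp_of_ne γ.2.2 α _ h, map_zero, smul_zero]
  · exact fun h => absurd (Finset.mem_univ _) h
  · intro γ _ h
    rw [leftStrip_cons_of_ne γ.2.2 β _ h, map_zero, smul_zero]
  · exact fun h => absurd (Finset.mem_univ _) h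

theorem deriv_of_mem_carrier (R : QuadraticRelations F Q) {r : PathAlgebra F Q}
    (hr : r ∈ R.carrier) : R.deriv r = 0 := by
  have h := R.koszulD_kmk 1 ⟨r, R.mem_W_two hr⟩
  have h' : (Submodule.Quotient.mk (R.koszulD 1 (R.kmk 2 ⟨r, R.mem_W_two hr⟩)) : R.Omega) = 0 :=
    (Submodule.Quotient.mk_eq_zero _).2 (LinearMap.mem_range_self _ _)
  rw [R.deriv_of_mem_two (R.le_degree hr), ← h', h, Submodule.Quotient.mk_add]
  simp only [Nat.reduceAdd, even_two, Even.neg_pow, one_pow, one_smul]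
  congr 1
  · refine Eq.trans (Finset.sum_congr rfl fun α _ => ?_)
      (map_sum (LinearMap.range (R.koszulD 1)).mkQ _ _).symm
    rw [map_smul]
    congr 1
    exact R.deriv_of_mem_one (R.leftW 1 α.2.2 ⟨r, R.mem_W_two hr⟩)
  · refine Eq.trans (Finset.sum_congr rfl fun α _ => ?_)
      (map_sum (LinearMap.range (R.koszulD 1)).mkQ _ _).symm
    rw [map_smul]
    congr 1
    exact R.deriv_of_mem_one (R.rightW 1 α.2.2 ⟨r, R.mem_W_two hr⟩)

theorem deriv_of_mem_relIdeal (R : QuadraticRelations F Q) {x : PathAlgebra F Q}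
    (hx : R.proj x = 0) : R.deriv x = 0 := by
  have h : x ∈ R.relIdeal := R.proj_eq_zero_iff.1 hx
  clear hx
  refine R.relIdeal_induction (C := fun x => R.deriv x = 0) ?_ ?_ ?_ h
  · exact map_zero _
  · exact fun x y hx hy => by rw [map_add, hx, hy, add_zero]
  · intro u r hr v
    rw [deriv_mul, deriv_mul, R.deriv_of_mem_carrier hr, ← inl_mul_inl, R.inl_eq_zero hr,
      R.inr_eq_zero hr]
    simp

/-- The derivation `A → coker (A ⊗_k R ⊗_k A → A ⊗_k V ⊗_k A)` induced by `deriv`. -/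
def algDeriv (R : QuadraticRelations F Q) : R.Alg →ₗ[F] R.Omega :=
  (LinearMap.ker R.proj.toLinearMap).liftQ R.deriv (fun _ hx => R.deriv_of_mem_relIdeal hx) ∘ₗ
    (R.proj.toLinearMap.quotKerEquivOfSurjective R.proj_surjective).symm.toLinearMap

theorem algDeriv_proj (R : QuadraticRelations F Q) (x : PathAlgebra F Q) :
    R.algDeriv (R.proj x) = R.deriv x := by
  have h : (R.proj.toLinearMap.quotKerEquivOfSurjective R.proj_surjective).symm (R.proj x) =
      Submodule.Quotient.mk x := by
    rw [LinearEquiv.symm_apply_eq]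
    rfl
  rw [algDeriv, LinearMap.comp_apply, LinearEquiv.coe_coe, h]
  rfl

theorem algDeriv_mul (R : QuadraticRelations F Q) (a b : R.Alg) :
    R.algDeriv (a * b) = Env.left F R.Alg a • R.algDeriv b +
      Env.right F R.Alg b • R.algDeriv a := by
  obtain ⟨x, rfl⟩ := R.proj_surjective a
  obtain ⟨y, rfl⟩ := R.proj_surjective b
  rw [← map_mul, algDeriv_proj, algDeriv_proj, algDeriv_proj, deriv_mul]
  rfl

/-- The map `a ⊗ b ↦ D(a) b`, for the derivation `D`. -/
def envDeriv (R : QuadraticRelations F Q) : Env F R.Alg →ₗ[F] R.Omega :=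
  TensorProduct.lift (LinearMap.mk₂ F
    (fun (a : R.Alg) (b : R.Algᵐᵒᵖ) => Env.right F R.Alg b.unop • R.algDeriv a)
    (fun a a' b => by rw [map_add, smul_add])
    (fun c a b => by rw [map_smul, smul_comm])
    (fun a b b' => by rw [MulOpposite.unop_add, map_add, add_smul])
    (fun c a b => by rw [MulOpposite.unop_smul, map_smul, smul_assoc]))

theorem envDeriv_of (R : QuadraticRelations F Q) (a b : R.Alg) :
    R.envDeriv (Env.of F a b) = Env.right F R.Alg b • R.algDeriv a := rfl

/-- A map from `A ⊗_k A` to the cokernel of `A ⊗_k R ⊗_k A → A ⊗_k V ⊗_k A`; its composition with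
the differential of the Koszul complex is the projection. -/
def koszulHomotopy (R : QuadraticRelations F Q) : R.KoszulModule 0 →+ R.Omega :=
  R.envDeriv.toAddMonoidHom.comp (R.preMul 0 ∘ₗ R.ksec 0).toAddMonoidHom

theorem koszulHomotopy_of (R : QuadraticRelations F Q) (a b : R.Alg) :
    R.koszulHomotopy (Env.of F a b • R.kgen) = Env.right F R.Alg b • R.algDeriv a := by
  change R.envDeriv ((R.preMul 0 ∘ₗ R.ksec 0) (Env.of F a b • R.kgen)) = _
  have h : ∀ i : Q, R.algDeriv (R.e i) = 0 := fun i =>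
    (R.algDeriv_proj _).trans (R.deriv_vertex i)
  rw [map_smul, LinearMap.comp_apply, preMul_ksec_kgen, smul_eq_mul, Finset.mul_sum, map_sum]
  have h' : ∀ i : Q, R.envDeriv (Env.of F a b * R.ee i i) =
      Env.right F R.Alg (R.e i * b) • R.algDeriv a := fun i => by
    rw [ee, Env.of_mul_of, envDeriv_of, algDeriv_mul, h, smul_zero, zero_add, smul_smul,
      ← Env.right_mul, ← mul_assoc, e_mul_self]
  rw [Finset.sum_congr rfl fun i _ => h' i, ← Finset.sum_smul, ← map_sum, ← Finset.sum_mul,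
    R.sum_e, one_mul]

theorem koszulHomotopy_koszulD (R : QuadraticRelations F Q) (z : R.KoszulModule 1) :
    R.koszulHomotopy (R.koszulD 0 z) = Submodule.Quotient.mk z := by
  induction z using R.koszulModule_induction 1 with
  | zero => rw [map_zero, map_zero]; rfl
  | add x y hx hy => rw [map_add, map_add, hx, hy]; rfl
  | smul u x =>
  have hx : x ∈ Submodule.span F (Set.range fun α : Arr Q => R.arrW α.2.2) :=
    R.span_arrW ▸ Submodule.mem_top
  induction hx using Submodule.span_induction generalizing u with
  | zero => rw [kmk_zero, smul_zero, map_zero, map_zero]; rfl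
  | add x y _ _ hx hy => rw [kmk_add, smul_add, map_add, map_add, hx, hy]; rfl
  | smul c x _ hx =>
    rw [kmk_smul, ← algebraMap_smul (Env F R.Alg) c, smul_smul, hx]
  | mem x hx =>
  obtain ⟨α, rfl⟩ := hx
  rw [map_smul, koszulD_kmk_arrW, smul_smul, Submodule.Quotient.mk_smul]
  dsimp only
  rw [← deriv_arrow]
  induction u using Env.induction with
  | zero => simp
  | add x y hx hy => rw [add_mul, add_smul, map_add, hx, hy, add_smul]
  | of a b =>
    rw [mul_sub, sub_smul, map_sub, inl_eq, inr_eq, Env.left_apply, Env.right_apply,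
      Env.of_mul_of, Env.of_mul_of, koszulHomotopy_of, koszulHomotopy_of, algDeriv_mul, one_mul,
      mul_one, Env.right_mul, smul_add, smul_smul, smul_smul, add_sub_cancel_right,
      algDeriv_proj, Env.of_eq']

/-- Exactness of `A ⊗_k R ⊗_k A → A ⊗_k V ⊗_k A → A ⊗_k A`. -/
theorem mem_range_koszulD_one (R : QuadraticRelations F Q) (z : R.KoszulModule 1)
    (hz : R.koszulD 0 z = 0) : z ∈ LinearMap.range (R.koszulD 1) := by
  rw [← Submodule.Quotient.mk_eq_zero, ← R.koszulHomotopy_koszulD, hz, map_zero]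

end QuadraticRelations

/-! ### Complexes of modules -/

section Complexes

open HomologicalComplex

variable {S : Type u} [Ring S]

/-- A map `φ` from the `j`-th term of a complex to `A` gives a quasi-isomorphism from the complex to
`A` in degree `j`, if the complex is exact in the other degrees and its last part, augmented by `φ`,
is exact. -/
theorem quasiIso_mkHomToSingle {ι : Type*} [DecidableEq ι] {c : ComplexShape ι}
    (K : HomologicalComplex (ModuleCat.{v} S) c) {A : ModuleCat.{v} S} (i j : ι) (φ : K.X j ⟶ A)
    (hφ : ∀ i, c.Rel i j → K.d i j ≫ φ = 0) (hi : c.prev j = i) (hd : K.d j (c.next j) = 0)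
    (hepi : Function.Surjective φ) (hex : ∀ x, φ x = 0 → ∃ y, K.d i j y = x)
    (h : ∀ k, k ≠ j → K.ExactAt k) : QuasiIso (mkHomToSingle φ hφ) := by
  refine ⟨fun k => ?_⟩
  by_cases hk : k = j
  · subst hk
    rw [quasiIsoAt_iff' _ i k (c.next k) hi rfl, ShortComplex.quasiIso_iff_of_zeros' _ hd
      (single_obj_d c k A _ _) (single_obj_d c k A _ _), ShortComplex.moduleCat_exact_iff, ModuleCat.epi_iff_surjective]
    have e : ((shortComplexFunctor' (ModuleCat S) c i k (c.next k)).map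
      (mkHomToSingle φ hφ)).τ₂ = φ ≫ (singleObjXSelf c k A).inv := mkHomToSingle_f φ hφ
    have hinj : Function.Injective (singleObjXSelf c k A).inv :=
      (ModuleCat.mono_iff_injective _).1 inferInstance
    have hsurj : Function.Surjective (singleObjXSelf c k A).inv :=
      (ModuleCat.epi_iff_surjective _).1 inferInstance
    constructor
    · intro x hx
      refine hex x (hinj ?_)
      rw [map_zero]
      exact (ConcreteCategory.congr_hom e x).symm.trans hx
    · rw [e]
      exact hsurj.comp hepi
  · rw [quasiIsoAt_iff_exactAt _ _ (h k hk)]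
    exact exactAt_single_obj _ _ _ _ hk

end Complexes

namespace Env

open HomologicalComplex

variable {F : Type u} [Field F] {A : Type v} [Ring A] [Algebra F A]

theorem DerivedIso.symm {X Y : CochainComplex (ModuleCat.{v} (Env F A)) ℤ}
    (h : DerivedIso X Y) : DerivedIso Y X :=
  let := HasDerivedCategory.standard (ModuleCat.{v} (Env F A))
  Nonempty.elim h fun e => ⟨e.symm⟩

theorem DerivedIso.trans {X Y Z : CochainComplex (ModuleCat.{v} (Env F A)) ℤ}
    (h : DerivedIso X Y) (h' : DerivedIso Y Z) : DerivedIso X Z :=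
  let := HasDerivedCategory.standard (ModuleCat.{v} (Env F A))
  Nonempty.elim h fun e => Nonempty.elim h' fun e' => ⟨e ≪≫ e'⟩

theorem derivedIso_of_quasiIso {X Y : CochainComplex (ModuleCat.{v} (Env F A)) ℤ}
    (f : X ⟶ Y) [QuasiIso f] : DerivedIso X Y :=
  let := HasDerivedCategory.standard (ModuleCat.{v} (Env F A))
  ⟨asIso (DerivedCategory.Q.map f)⟩

theorem DerivedIso.exactAt {X Y : CochainComplex (ModuleCat.{v} (Env F A)) ℤ}
    (h : DerivedIso X Y) (p : ℤ) (hX : X.ExactAt p) : Y.ExactAt p := by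
  let := HasDerivedCategory.standard (ModuleCat.{v} (Env F A))
  obtain ⟨e⟩ := h
  rw [exactAt_iff_isZero_homology] at hX ⊢
  let i := DerivedCategory.homologyFunctorFactors (ModuleCat.{v} (Env F A)) p
  exact hX.of_iso ((i.app Y).symm ≪≫ (DerivedCategory.homologyFunctor _ p).mapIso e.symm ≪≫ i.app X)

/-- An isomorphism in the derived category whose source is a bounded above complex of projective
bimodules is represented by a quasi-isomorphism of complexes, since such a complex is
K-projective. -/
theorem exists_quasiIso_of_derivedIso {P X : CochainComplex (ModuleCat.{v} (Env F A)) ℤ}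
    (hP : ∀ i, Projective (P.X i)) (N : ℤ) [P.IsStrictlyLE N] (h : DerivedIso P X) :
    ∃ f : P ⟶ X, QuasiIso f := by
  let := HasDerivedCategory.standard (ModuleCat.{v} (Env F A))
  obtain ⟨e⟩ := h
  have := CochainComplex.isKProjective_of_projective P N
  obtain ⟨g, hg⟩ := (CochainComplex.IsKProjective.Qh_map_bijective P
    ((HomotopyCategory.quotient _ _).obj X)).surjective
      ((DerivedCategory.quotientCompQhIso _).hom.app P ≫ e.hom ≫
        (DerivedCategory.quotientCompQhIso _).inv.app X)
  obtain ⟨f, rfl⟩ := (HomotopyCategory.quotient _ _).map_surjective g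
  refine ⟨f, ?_⟩
  rw [← DerivedCategory.isIso_Q_map_iff_quasiIso]
  have : DerivedCategory.Q.map f = e.hom := by
    have h := DerivedCategory.quotientCompQhIso_hom_naturality f
    rw [hg, Category.assoc, Category.assoc, Iso.inv_hom_id_app, Category.comp_id] at h
    exact ((cancel_epi _).1 h).symm
  rw [this]
  infer_instance

variable (F A) in
/-- The bimodule `Aᵉ`, with its outer structure. -/
abbrev self : ModuleCat.{v} (Env F A) := ModuleCat.of (Env F A) (Env F A)

/-- Exactness of the dual complex in terms of homomorphisms: `b`, `a`, `c` are the consecutive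
degrees `-p - 1`, `-p`, `-p + 1` of `P`. -/
theorem dualComplex_exactAt_iff (P : CochainComplex (ModuleCat.{v} (Env F A)) ℤ) (p b a c : ℤ)
    (ha : a = -p) (hb : b + 1 = a) (hc : a + 1 = c) :
    (dualComplex P).ExactAt p ↔ ∀ f : P.X a ⟶ self F A, P.d b a ≫ f = 0 →
      ∃ g : P.X c ⟶ self F A, f = P.d a c ≫ g := by
  subst ha
  obtain rfl : b = -(p + 1) := by lia
  obtain rfl : c = -(p - 1) := by lia
  rw [(dualComplex P).exactAt_iff' (p - 1) p (p + 1) (by simp) (by simp),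
    ShortComplex.moduleCat_exact_iff]
  constructor
  · intro h f hf
    obtain ⟨g, hg⟩ := h f.hom (congrArg ModuleCat.Hom.hom hf)
    exact ⟨ModuleCat.ofHom g, ModuleCat.hom_ext hg.symm⟩
  · intro h f hf
    obtain ⟨g, hg⟩ := h (ModuleCat.ofHom f) (ModuleCat.hom_ext hf)
    exact ⟨g.hom, (congrArg ModuleCat.Hom.hom hg).symm⟩

/-- Homotopy equivalent complexes have homotopy equivalent duals; only the consequence for exactness
is needed. -/
theorem dualComplex_exactAt_of_homotopyEquiv {P P' : CochainComplex (ModuleCat.{v} (Env F A)) ℤ}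
    (e : HomotopyEquiv P P') (p : ℤ) (h : (dualComplex P).ExactAt p) :
    (dualComplex P').ExactAt p := by
  rw [dualComplex_exactAt_iff _ p (-p - 1) (-p) (-p + 1) rfl (by lia) rfl] at h ⊢
  intro f hf
  obtain ⟨g, hg⟩ := h (e.hom.f _ ≫ f) (by rw [← Category.assoc, ← e.hom.comm, Category.assoc, hf,
    Limits.comp_zero])
  have hc := e.homotopyInvHomId.comm (-p)
  rw [dNext_eq _ (show (ComplexShape.up ℤ).Rel (-p) (-p + 1) by simp),
    prevD_eq _ (show (ComplexShape.up ℤ).Rel (-p - 1) (-p) by simp), id_f, comp_f] at hc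
  refine ⟨e.inv.f _ ≫ g - e.homotopyInvHomId.hom (-p + 1) (-p) ≫ f, ?_⟩
  have h1 := congrArg (· ≫ f) hc
  simp only [Preadditive.add_comp, Category.assoc, hf, Limits.comp_zero, Category.id_comp,
    add_zero, hg] at h1
  rw [Preadditive.comp_sub, ← e.inv.comm_assoc, h1, add_sub_cancel_left]

theorem single_shift_exactAt (M : ModuleCat.{v} (Env F A)) (n : ℤ) (p : ℤ) (hp : p ≠ n) :
    (((HomologicalComplex.single _ (ComplexShape.up ℤ) 0).obj M)⟦(-n : ℤ)⟧).ExactAt p :=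
  (exactAt_single_obj (ComplexShape.up ℤ) n M p hp).of_iso
    (((CochainComplex.singleFunctors _).shiftIso (-n) n 0 (by lia)).app M).symm

theorem isZero_of_single_shift_exactAt (M : ModuleCat.{v} (Env F A)) (n : ℤ)
    (h : (((HomologicalComplex.single _ (ComplexShape.up ℤ) 0).obj M)⟦(-n : ℤ)⟧).ExactAt n) :
    Limits.IsZero M := by
  have h' : ((HomologicalComplex.single _ (ComplexShape.up ℤ) n).obj M).ExactAt n :=
    h.of_iso (((CochainComplex.singleFunctors _).shiftIso (-n) n 0 (by lia)).app M)
  exact ((exactAt_iff_isZero_homology _ _).1 h').of_iso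
    (singleObjHomologySelfIso (ComplexShape.up ℤ) n M).symm

end Env

namespace QuadraticRelations

open PathAlgebra HomologicalComplex

variable {F : Type u} [Field F] {Q : Type v} [Quiver.{w} Q] [Fintype Q]
  [∀ a b : Q, Fintype (a ⟶ b)]

theorem koszulComplex_d (R : QuadraticRelations F Q) (m : ℕ) :
    R.koszulComplex.d (m + 1) m = ModuleCat.ofHom (R.koszulD m) :=
  ChainComplex.of_d (fun m => ModuleCat.of (Env F R.Alg) (R.KoszulModule m))
    (fun m => ModuleCat.ofHom (R.koszulD m)) m

theorem koszulComplex_exactAt_succ_iff (R : QuadraticRelations F Q) (m : ℕ) :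
    R.koszulComplex.ExactAt (m + 1) ↔
      ∀ z, R.koszulD m z = 0 → z ∈ LinearMap.range (R.koszulD (m + 1)) := by
  rw [R.koszulComplex.exactAt_iff' (m + 2) (m + 1) m (by simp) (by simp),
    ShortComplex.moduleCat_exact_iff]
  have h1 := R.koszulComplex_d m
  have h2 := R.koszulComplex_d (m + 1)
  constructor
  · intro h z hz
    obtain ⟨y, hy⟩ := h z (by
      change R.koszulComplex.d (m + 1) m z = 0
      rw [h1]; exact hz)
    refine ⟨y, ?_⟩
    change R.koszulComplex.d (m + 2) (m + 1) y = z at hy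
    rw [h2] at hy
    exact hy
  · intro h z hz
    change R.koszulComplex.d (m + 1) m z = 0 at hz
    rw [h1] at hz
    obtain ⟨y, hy⟩ := h z hz
    refine ⟨y, ?_⟩
    change R.koszulComplex.d (m + 2) (m + 1) y = z
    rw [h2]
    exact hy

/-- The map from the Koszul complex to the bimodule `A`. -/
def koszulπ (R : QuadraticRelations F Q) :
    R.koszulComplex ⟶ (ChainComplex.single₀ _).obj (Env.regular F R.Alg) :=
  mkHomToSingle (K := R.koszulComplex) (ModuleCat.homEquiv.symm R.koszulAug) (by
    intro i hi
    obtain rfl : i = 1 := by simpa using hi.symm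
    rw [koszulComplex_d]
    exact ModuleCat.hom_ext R.koszulAug_koszulD)

theorem quasiIso_koszulπ (R : QuadraticRelations F Q) (hR : R.IsKoszul) :
    QuasiIso R.koszulπ := by
  refine quasiIso_mkHomToSingle R.koszulComplex 1 0 _ _ (by simp)
    (R.koszulComplex.shape _ _ (by simp)) R.koszulAug_surjective ?_ ?_
  · intro x hx
    obtain ⟨y, hy⟩ := R.mem_range_koszulD_zero x hx
    exact ⟨y, by rw [koszulComplex_d]; exact hy⟩
  · intro k hk
    obtain ⟨m, rfl⟩ := Nat.exists_eq_succ_of_ne_zero hk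
    by_cases hm : m = 0
    · subst hm
      exact (R.koszulComplex_exactAt_succ_iff 0).2 R.mem_range_koszulD_one
    · exact hR _ (by lia)

/-- The Koszul complex of a Koszul algebra is a projective resolution of the bimodule `A`. -/
def koszulResolution (R : QuadraticRelations F Q) (hR : R.IsKoszul) :
    ProjectiveResolution (Env.regular F R.Alg) where
  complex := R.koszulComplex
  projective m := inferInstanceAs (Projective (ModuleCat.of _ (R.KoszulModule m)))
  π := R.koszulπ
  quasiIso := R.quasiIso_koszulπ hR

/-- For a Koszul algebra, `K(A)` and `A` are isomorphic in the derived category. -/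
theorem exists_quasiIso_koszulCochain (R : QuadraticRelations F Q) (hR : R.IsKoszul) :
    ∃ f : R.koszulCochain ⟶ (single _ (ComplexShape.up ℤ) 0).obj (Env.regular F R.Alg),
      QuasiIso f :=
  have h : QuasiIso (R.koszulResolution hR).π' := inferInstance
  ⟨(R.koszulResolution hR).π', h⟩

instance (R : QuadraticRelations F Q) (i : ℤ) : Projective (R.koszulCochain.X i) := by
  by_cases hi : i ≤ 0
  · obtain ⟨k, rfl⟩ := Int.exists_eq_neg_ofNat hi
    have : Projective (R.koszulComplex.X k) :=
      inferInstanceAs (Projective (ModuleCat.of _ (R.KoszulModule k)))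
    exact Projective.of_iso (extendXIso _ _ (i := k) rfl).symm inferInstance
  · exact (isZero_extend_X _ _ _ fun k hk => hi (by
      rw [← hk]
      simp)).projective

instance (R : QuadraticRelations F Q) : R.koszulCochain.IsStrictlyLE 0 := by
  dsimp [koszulCochain]
  infer_instance

theorem isHomologicallySmooth_of_isZero (R : QuadraticRelations F Q) (hR : R.IsKoszul) (N : ℕ)
    (h : ∀ p, N < p → Limits.IsZero (R.koszulComplex.X p)) :
    IsHomologicallySmooth F R.Alg :=
  ⟨R.koszulResolution hR, fun p =>
    inferInstanceAs (Module.Finite (Env F R.Alg) (R.KoszulModule p)), N, h⟩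

/-- For a Koszul algebra, a projective resolution of `K(A)` is one of `A`, so that both have the same
dual. -/
theorem isCalabiYau_of_isKcCalabiYau (R : QuadraticRelations F Q) (hR : R.IsKoszul) (n : ℕ)
    (h : R.IsKcCalabiYau n) : IsCalabiYau F R.Alg n := by
  obtain ⟨⟨-, hn⟩, P, f, hf, hP, hN, hd⟩ := h
  obtain ⟨g, hg⟩ := R.exists_quasiIso_koszulCochain hR
  refine ⟨R.isHomologicallySmooth_of_isZero hR n hn, P, f ≫ g, inferInstance, hP, hN, hd.trans ?_⟩
  exact Env.derivedIso_of_quasiIso (g⟦(-n : ℤ)⟧')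

theorem rHomDualIso_koszulCochain (R : QuadraticRelations F Q) (hR : R.IsKoszul) (n : ℕ)
    (h : IsCalabiYau F R.Alg n) :
    Env.RHomDualIso R.koszulCochain (R.koszulCochain⟦(-n : ℤ)⟧) := by
  obtain ⟨-, P, f, hf, hP, ⟨N, hN⟩, hd⟩ := h
  obtain ⟨g, hg⟩ := R.exists_quasiIso_koszulCochain hR
  obtain ⟨f', hf'⟩ := Env.exists_quasiIso_of_derivedIso hP N
    ((Env.derivedIso_of_quasiIso f).trans (Env.derivedIso_of_quasiIso g).symm)
  exact ⟨P, f', hf', hP, ⟨N, hN⟩, hd.trans (Env.derivedIso_of_quasiIso (g⟦(-n : ℤ)⟧')).symm⟩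

end QuadraticRelations

/-! ### Minimality and length of the Koszul complex -/

namespace QuadraticRelations

open PathAlgebra HomologicalComplex

variable {F : Type u} [Field F] {Q : Type v} [Quiver.{w} Q] [Fintype Q]
  [∀ a b : Q, Fintype (a ⟶ b)]

/-- The character of the enveloping algebra at a pair of vertices. -/
def pairChar (R : QuadraticRelations F Q) (i j : Q) : Env F R.Alg →ₐ[F] F :=
  Env.char (R.aug i) (R.aug j)

theorem pairChar_inl_arrow (R : QuadraticRelations F Q) (i j : Q) {a b : Q} (α : a ⟶ b) :
    R.pairChar i j (R.inl (arrow F α)) = 0 := by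
  refine (Env.char_of _ _ _ _).trans ?_
  exact (congrArg (· * _) (R.aug_ar i α)).trans (zero_mul _)

theorem pairChar_inr_arrow (R : QuadraticRelations F Q) (i j : Q) {a b : Q} (α : a ⟶ b) :
    R.pairChar i j (R.inr (arrow F α)) = 0 := by
  refine (Env.char_of _ _ _ _).trans ?_
  exact (congrArg (_ * ·) (R.aug_ar j α)).trans (mul_zero _)

open scoped Classical in
theorem pairChar_ee (R : QuadraticRelations F Q) (i j a b : Q) :
    R.pairChar i j (R.ee a b) = if i = a ∧ j = b then 1 else 0 := by
  refine (Env.char_of _ _ _ _).trans ?_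
  rw [e, e, aug_proj, aug_proj, augVertex_vertex, augVertex_vertex]
  rw [eq_comm (a := i), eq_comm (a := j)]
  by_cases h : a = i <;> by_cases h' : b = j <;> simp [h, h']

/-- The Koszul complex is minimal: the differential lands in the radical. -/
theorem map_koszulD_eq_zero (R : QuadraticRelations F Q) (m : ℕ) (i j : Q)
    (ψ : R.KoszulModule m →+ F) (hψ : ∀ u x, ψ (u • x) = R.pairChar i j u * ψ x)
    (z : R.KoszulModule (m + 1)) : ψ (R.koszulD m z) = 0 := by
  induction z using R.koszulModule_induction (m + 1) with
  | zero => rw [map_zero, map_zero]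
  | add x y hx hy => rw [map_add, map_add, hx, hy, add_zero]
  | smul u x =>
    rw [map_smul, hψ, koszulD_kmk, map_add, map_zsmul, map_sum, map_sum,
      Finset.sum_eq_zero fun α _ => by rw [hψ, pairChar_inl_arrow, zero_mul],
      Finset.sum_eq_zero fun α _ => by rw [hψ, pairChar_inr_arrow, zero_mul], smul_zero, add_zero,
      mul_zero]

/-- The homomorphism of bimodules `A ⊗_k W_m ⊗_k A → A ⊗ A` given by a linear form on `W_m`. -/
def coeffHom (R : QuadraticRelations F Q) (m : ℕ) (φ : R.W m →ₗ[F] F) :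
    R.KoszulModule m →ₗ[Env F R.Alg] Env F R.Alg :=
  (TensorProduct.AlgebraTensorModule.rid F (Env F R.Alg) (Env F R.Alg)).toLinearMap ∘ₗ
    TensorProduct.AlgebraTensorModule.map LinearMap.id φ ∘ₗ R.ksec m

theorem coeffHom_kmk (R : QuadraticRelations F Q) (m : ℕ) (φ : R.W m →ₗ[F] F) (x : R.W m) :
    R.coeffHom m φ (R.kmk m x) = ∑ a : Q, ∑ b : Q, φ (R.cut m a b x) • R.ee a b := by
  rw [coeffHom, LinearMap.comp_apply, LinearMap.comp_apply, ksec_kmk]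
  simp

theorem pairChar_coeffHom (R : QuadraticRelations F Q) (m : ℕ) (φ : R.W m →ₗ[F] F) (i j : Q)
    (x : R.W m) : R.pairChar i j (R.coeffHom m φ (R.kmk m x)) = φ (R.cut m i j x) := by
  classical
  rw [coeffHom_kmk, map_sum, Finset.sum_eq_single i, map_sum, Finset.sum_eq_single j]
  · rw [map_smul, pairChar_ee, if_pos ⟨rfl, rfl⟩, smul_eq_mul, mul_one]
  · intro b _ hb
    rw [map_smul, pairChar_ee, if_neg fun h => hb h.2.symm, smul_zero]
  · exact fun h => absurd (Finset.mem_univ _) h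
  · intro a _ ha
    rw [map_sum]
    refine Finset.sum_eq_zero fun b _ => ?_
    rw [map_smul, pairChar_ee, if_neg fun h => ha h.1.symm, smul_zero]
  · exact fun h => absurd (Finset.mem_univ _) h

theorem isZero_koszulComplex_X_iff (R : QuadraticRelations F Q) (m : ℕ) :
    Limits.IsZero (R.koszulComplex.X m) ↔ ∀ z : R.KoszulModule m, z = 0 := by
  refine (ModuleCat.isZero_of_iff_subsingleton (M := R.KoszulModule m)).trans ?_
  exact ⟨fun h z => Subsingleton.elim _ _, fun h => ⟨fun x y => (h x).trans (h y).symm⟩⟩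

/-- If no linear form is detected by the characters, the term of the Koszul complex is zero. -/
theorem isZero_koszulComplex_X (R : QuadraticRelations F Q) (m : ℕ)
    (h : ∀ (φ : R.W m →ₗ[F] F) (i j : Q) (z : R.KoszulModule m),
      R.pairChar i j (R.coeffHom m φ z) = 0) :
    Limits.IsZero (R.koszulComplex.X m) := by
  have hW : ∀ x : R.W m, x = 0 := by
    intro x
    rw [← R.sum_cut m x]
    refine Finset.sum_eq_zero fun i _ => Finset.sum_eq_zero fun j _ => ?_
    refine (Module.forall_dual_apply_eq_zero_iff F _).1 fun φ => ?_
    rw [← R.pairChar_coeffHom m φ]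
    exact h φ i j _
  rw [isZero_koszulComplex_X_iff]
  intro z
  induction z using R.koszulModule_induction m with
  | zero => rfl
  | add x y hx hy => rw [hx, hy, add_zero]
  | smul u x => rw [hW x, kmk_zero, smul_zero]

/-- The differential of the dual of the Koszul complex is only onto a term that is zero, since it
lands in the radical as well. -/
theorem isZero_koszulComplex_X_of_factor (R : QuadraticRelations F Q) (m : ℕ)
    (h : ∀ f : R.KoszulModule (m + 1) →ₗ[Env F R.Alg] Env F R.Alg,
      ∃ g : R.KoszulModule m →ₗ[Env F R.Alg] Env F R.Alg, f = g ∘ₗ R.koszulD m) :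
    Limits.IsZero (R.koszulComplex.X (m + 1)) := by
  refine R.isZero_koszulComplex_X _ fun φ i j z => ?_
  obtain ⟨g, hg⟩ := h (R.coeffHom _ φ)
  rw [hg]
  exact R.map_koszulD_eq_zero m i j ((R.pairChar i j : _ →+ F).comp g.toAddMonoidHom)
    (fun u x => by simp) z

/-- If the identity of a term of the Koszul complex is homotopic to zero, the term is zero, since the
differential lands in the radical. -/
theorem isZero_koszulComplex_X_of_homotopy (R : QuadraticRelations F Q) (m : ℕ)
    (s : R.KoszulModule m →ₗ[Env F R.Alg] R.KoszulModule (m + 1))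
    (t : R.KoszulModule (m + 1) →ₗ[Env F R.Alg] R.KoszulModule (m + 2))
    (h : s ∘ₗ R.koszulD m + R.koszulD (m + 1) ∘ₗ t + LinearMap.id = 0) :
    Limits.IsZero (R.koszulComplex.X (m + 1)) := by
  refine R.isZero_koszulComplex_X _ fun φ i j z => ?_
  let ψ : R.KoszulModule (m + 1) →+ F :=
    (R.pairChar i j : _ →+ F).comp (R.coeffHom _ φ).toAddMonoidHom
  have hψ : ∀ u x, ψ (u • x) = R.pairChar i j u * ψ x := fun u x => by simp [ψ]
  have h1 : ψ (s (R.koszulD m z)) = 0 :=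
    R.map_koszulD_eq_zero m i j (ψ.comp s.toAddMonoidHom) (fun u x => by
      change ψ (s (u • x)) = _ * ψ (s x)
      rw [map_smul, hψ]) z
  have h2 : ψ (R.koszulD (m + 1) (t z)) = 0 := R.map_koszulD_eq_zero (m + 1) i j ψ hψ _
  have h3 : ψ (s (R.koszulD m z) + R.koszulD (m + 1) (t z) + z) = ψ 0 :=
    congrArg ψ (LinearMap.congr_fun h z)
  rw [map_zero, map_add, map_add, h1, h2, zero_add, zero_add] at h3
  exact h3

/-- The Koszul complex is not longer than any other projective resolution of the bimodule `A`. -/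
theorem isZero_koszulComplex_X_of_resolution (R : QuadraticRelations F Q) (hR : R.IsKoszul)
    (P : ProjectiveResolution (Env.regular F R.Alg)) (m : ℕ)
    (h : Limits.IsZero (P.complex.X (m + 1))) : Limits.IsZero (R.koszulComplex.X (m + 1)) := by
  let e : HomotopyEquiv P.complex R.koszulComplex := P.homotopyEquiv (R.koszulResolution hR)
  have hc := e.homotopyInvHomId.comm (m + 1)
  rw [dNext_eq _ (show (ComplexShape.down ℕ).Rel (m + 1) m by simp),
    prevD_eq _ (show (ComplexShape.down ℕ).Rel (m + 2) (m + 1) by simp), id_f, comp_f,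
    h.eq_of_tgt (e.inv.f (m + 1)) 0, Limits.zero_comp, koszulComplex_d, koszulComplex_d] at hc
  exact R.isZero_koszulComplex_X_of_homotopy m (e.homotopyInvHomId.hom m (m + 1)).hom
    (e.homotopyInvHomId.hom (m + 1) (m + 2)).hom (congrArg ModuleCat.Hom.hom hc).symm

/-- The terms of the Koszul cochain complex. -/
def koszulCochainXIso (R : QuadraticRelations F Q) (m : ℕ) (i : ℤ) (h : -(m : ℤ) = i) :
    R.koszulCochain.X i ≅ ModuleCat.of (Env F R.Alg) (R.KoszulModule m) :=
  extendXIso R.koszulComplex ComplexShape.embeddingDownNat h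

theorem koszulCochain_d (R : QuadraticRelations F Q) (m : ℕ) (i j : ℤ) (hi : -(m + 1 : ℕ) = i)
    (hj : -(m : ℤ) = j) : R.koszulCochain.d i j =
      (R.koszulCochainXIso (m + 1) i hi).hom ≫ ModuleCat.ofHom (R.koszulD m) ≫
        (R.koszulCochainXIso m j hj).inv := by
  rw [← koszulComplex_d]
  exact extend_d_eq R.koszulComplex ComplexShape.embeddingDownNat hi hj

theorem exists_factor (R : QuadraticRelations F Q) (m : ℕ)
    (h : (Env.dualComplex R.koszulCochain).ExactAt (m + 1 : ℕ))
    (f : R.KoszulModule (m + 1) →ₗ[Env F R.Alg] Env F R.Alg) (hf : f ∘ₗ R.koszulD (m + 1) = 0) :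
    ∃ g : R.KoszulModule m →ₗ[Env F R.Alg] Env F R.Alg, f = g ∘ₗ R.koszulD m := by
  rw [Env.dualComplex_exactAt_iff _ _ (-(m + 2 : ℕ)) (-(m + 1 : ℕ)) (-(m : ℤ)) rfl
    (by push_cast; ring) (by push_cast; ring)] at h
  obtain ⟨g, hg⟩ := h ((R.koszulCochainXIso (m + 1) _ rfl).hom ≫ ModuleCat.ofHom f) (by
    rw [R.koszulCochain_d (m + 1) _ _ rfl rfl, Category.assoc, Category.assoc,
      Iso.inv_hom_id_assoc, ← ModuleCat.ofHom_comp, hf]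
    exact Limits.comp_zero)
  rw [R.koszulCochain_d m _ _ rfl rfl, Category.assoc, Category.assoc, Iso.cancel_iso_hom_left] at hg
  exact ⟨((R.koszulCochainXIso m _ rfl).inv ≫ g).hom, congrArg ModuleCat.Hom.hom hg⟩

theorem dualComplex_koszulCochain_exactAt_of_isZero (R : QuadraticRelations F Q) (m : ℕ)
    (h : Limits.IsZero (R.koszulComplex.X m)) :
    (Env.dualComplex R.koszulCochain).ExactAt (m : ℤ) := by
  rw [Env.dualComplex_exactAt_iff _ _ (-(m : ℤ) - 1) (-(m : ℤ)) (-(m : ℤ) + 1) rfl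
    (by ring) (by ring)]
  intro f _
  exact ⟨0, (h.of_iso (R.koszulCochainXIso m _ rfl)).eq_of_src _ _⟩

theorem nontrivial_alg [Nonempty Q] (R : QuadraticRelations F Q) : Nontrivial R.Alg := by
  obtain ⟨i⟩ := ‹Nonempty Q›
  refine ⟨R.e i, 0, fun h => ?_⟩
  have h' := R.aug_e_self i
  rw [h, map_zero] at h'
  exact zero_ne_one h'

/-- The Koszul complex of a Koszul and `n`-Calabi–Yau algebra has length `n`. Its dual has cohomology
`A` in degree `n` only, so that its `n`-th term is not zero; and its last nonzero term is not above
`n`, because the dual of the differential would be onto there. -/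
theorem hasLength_of_isCalabiYau [Nonempty Q] (R : QuadraticRelations F Q) (hR : R.IsKoszul)
    (n : ℕ) (h : IsCalabiYau F R.Alg n) : R.HasLength n := by
  obtain ⟨P, f, hf, hP, ⟨N, hN⟩, hd⟩ := R.rHomDualIso_koszulCochain hR n h
  obtain ⟨g, hg⟩ := R.exists_quasiIso_koszulCochain hR
  have hd' := hd.trans (Env.derivedIso_of_quasiIso (g⟦(-n : ℤ)⟧'))
  have := CochainComplex.isKProjective_of_projective P N
  have := CochainComplex.isKProjective_of_projective R.koszulCochain 0
  obtain ⟨e, -⟩ := (CochainComplex.IsKProjective.quasiIso_iff f).1 hf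
  have hex : ∀ p : ℤ, p ≠ n → (Env.dualComplex R.koszulCochain).ExactAt p := fun p hp =>
    Env.dualComplex_exactAt_of_homotopyEquiv e p
      (hd'.symm.exactAt p (Env.single_shift_exactAt _ _ _ hp))
  have hn : ¬ (Env.dualComplex R.koszulCochain).ExactAt n := by
    intro h0
    have h1 := Env.isZero_of_single_shift_exactAt _ _
      (hd'.exactAt n (Env.dualComplex_exactAt_of_homotopyEquiv e.symm n h0))
    have h2 := R.nontrivial_alg
    have h3 : Subsingleton R.Alg := ModuleCat.subsingleton_of_isZero h1
    exact not_subsingleton R.Alg h3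
  refine ⟨fun h0 => hn (R.dualComplex_koszulCochain_exactAt_of_isZero n h0), ?_⟩
  obtain ⟨S, -, M, hM⟩ := h.1
  -- descending induction: the term above `m + 1` is zero
  have key : ∀ k m : ℕ, n < m + 1 → M < m + 1 + k → Limits.IsZero (R.koszulComplex.X (m + 1)) := by
    intro k
    induction k with
    | zero => exact fun m _ hm => R.isZero_koszulComplex_X_of_resolution hR S m (hM _ (by lia))
    | succ k ih =>
      intro m hm hk
      refine R.isZero_koszulComplex_X_of_factor m fun f => ?_
      refine R.exists_factor m (hex _ (by lia)) f (LinearMap.ext fun z => ?_)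
      rw [(R.isZero_koszulComplex_X_iff (m + 2)).1 (ih (m + 1) (by lia) (by lia)) z, map_zero,
        map_zero]
  intro p hp
  obtain ⟨m, rfl⟩ := Nat.exists_eq_succ_of_ne_zero (show p ≠ 0 by lia)
  exact key (M + 1) m hp (by lia)

theorem isKcCalabiYau_iff_isCalabiYau [Nonempty Q] (R : QuadraticRelations F Q)
    (hR : R.IsKoszul) (n : ℕ) : R.IsKcCalabiYau n ↔ IsCalabiYau F R.Alg n :=
  ⟨R.isCalabiYau_of_isKcCalabiYau hR n, fun h =>
    ⟨R.hasLength_of_isCalabiYau hR n h, R.rHomDualIso_koszulCochain hR n h⟩⟩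

end QuadraticRelations

/-! ### The enveloping algebra -/

namespace Env

variable {F : Type u} [Field F] {A : Type v} [Ring A] [Algebra F A]

theorem of_zero_left (b : A) : of F 0 b = 0 :=
  TensorProduct.zero_tmul _ _

theorem of_zero_right (a : A) : of F a 0 = 0 :=
  TensorProduct.tmul_zero _ _

variable (F A) in
/-- The anti-automorphism `a ⊗ b ↦ b ⊗ a` of the enveloping algebra. -/
def flip : Env F A →ₗ[F] Env F A where
  toFun u := (swap F A u).unop
  map_add' u v := by rw [map_add, MulOpposite.unop_add]
  map_smul' c u := by
    induction u using Env.induction with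
    | zero => simp
    | add x y hx hy => rw [smul_add, map_add, map_add, MulOpposite.unop_add, hx, hy, ← smul_add]; rfl
    | of a b =>
      change (swap F A (of F (c • a) b)).unop = c • (swap F A (of F a b)).unop
      rw [swap_of, swap_of]
      exact (TensorProduct.tmul_smul c b (MulOpposite.op a))

theorem flip_of (a b : A) : flip F A (of F a b) = of F b a := rfl

theorem flip_mul (u v : Env F A) : flip F A (u * v) = flip F A v * flip F A u := by
  change (swap F A (u * v)).unop = _
  rw [map_mul]
  rfl

theorem flip_flip (u : Env F A) : flip F A (flip F A u) = u := by
  induction u using Env.induction with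
  | zero => simp
  | add x y hx hy => rw [map_add, map_add, hx, hy]
  | of a b => rfl

/-- Contraction of the second factor of the enveloping algebra with a linear form. -/
def contract (l : A →ₗ[F] F) : Env F A →ₗ[F] A :=
  (TensorProduct.rid F A).toLinearMap ∘ₗ
    (l ∘ₗ (MulOpposite.opLinearEquiv F).symm.toLinearMap).lTensor A

theorem contract_of (l : A →ₗ[F] F) (a b : A) : contract l (of F a b) = l b • a := rfl

theorem contract_zero (u : Env F A) : contract (0 : A →ₗ[F] F) u = 0 := by
  induction u using Env.induction with
  | zero => rw [map_zero]
  | add x y hx hy => rw [map_add, hx, hy, add_zero]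
  | of a b => rw [contract_of, LinearMap.zero_apply, zero_smul]

theorem eq_zero_of_contract (u : Env F A) (h : ∀ l : A →ₗ[F] F, contract l u = 0) : u = 0 := by
  classical
  let b := Module.Basis.ofVectorSpace F Aᵐᵒᵖ
  let e : Env F A ≃ₗ[F] _ := TensorProduct.equivFinsuppOfBasisRight (M := A) b
  refine e.map_eq_zero_iff.1 (Finsupp.ext fun i => ?_)
  rw [Finsupp.zero_apply, ← h (b.coord i ∘ₗ (MulOpposite.opLinearEquiv F).toLinearMap)]
  clear h
  induction u using Env.induction with
  | zero => simp
  | add x y hx hy => rw [map_add, map_add, Finsupp.add_apply, hx, hy]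
  | of x y =>
    rw [contract_of]
    exact TensorProduct.equivFinsuppOfBasisRight_apply_tmul_apply b x (MulOpposite.op y) i

end Env

namespace QuadraticRelations

open PathAlgebra

variable {F : Type u} [Field F] {Q : Type v} [Quiver.{w} Q] [Fintype Q]

/-- The element `∑ e_i ⊗ e_i` of the enveloping algebra; the bimodule `A ⊗_k A` is the left ideal that
it generates. -/
def omega (R : QuadraticRelations F Q) : Env F R.Alg := ∑ i : Q, R.ee i i

/-- The element `α ⊗ 1 - 1 ⊗ α` of the enveloping algebra. -/
def del (R : QuadraticRelations F Q) {a b : Q} (α : a ⟶ b) : Env F R.Alg :=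
  R.inl (arrow F α) - R.inr (arrow F α)

theorem flip_ee (R : QuadraticRelations F Q) (i j : Q) :
    Env.flip F R.Alg (R.ee i j) = R.ee j i := rfl

theorem flip_omega (R : QuadraticRelations F Q) : Env.flip F R.Alg R.omega = R.omega := by
  rw [omega, map_sum]
  rfl

theorem flip_del (R : QuadraticRelations F Q) {a b : Q} (α : a ⟶ b) :
    Env.flip F R.Alg (R.del α) = -R.del α := by
  rw [del, map_sub, neg_sub]
  rfl

theorem ee_mul_self (R : QuadraticRelations F Q) (i j : Q) :
    R.ee i j * R.ee i j = R.ee i j := by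
  rw [ee, Env.of_mul_of, e_mul_self, e_mul_self]

theorem sum_inl_vertex (R : QuadraticRelations F Q) : ∑ i : Q, R.inl (vertex F i) = 1 := by
  rw [← map_sum, ← one_def', inl_one]

/-- An element on which the vertices act in the same way from both sides is fixed by `omega`. -/
theorem omega_smul (R : QuadraticRelations F Q) {M : Type*} [AddCommGroup M]
    [Module (Env F R.Alg) M] (x : M)
    (h : ∀ i, R.inl (vertex F i) • x = R.inr (vertex F i) • x) : R.omega • x = x := by
  have h' : ∀ i, R.ee i i • x = R.inl (vertex F i) • x := fun i => by
    rw [ee_eq, mul_smul, ← h, smul_smul, inl_mul_inl, vertex_mul_self]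
  rw [omega, Finset.sum_smul, Finset.sum_congr rfl fun i _ => h' i, ← Finset.sum_smul,
    sum_inl_vertex, one_smul]

theorem omega_smul_one (R : QuadraticRelations F Q) :
    R.omega • Env.reg F (1 : R.Alg) = Env.reg F 1 := by
  refine R.omega_smul _ fun i => ?_
  rw [inl_eq, inr_eq, Env.left_apply, Env.right_apply, Env.of_smul_reg, Env.of_smul_reg, one_mul,
    mul_one, one_mul, mul_one]

theorem del_smul_one (R : QuadraticRelations F Q) {a b : Q} (α : a ⟶ b) :
    R.del α • Env.reg F (1 : R.Alg) = 0 := by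
  rw [del, sub_smul, inl_eq, inr_eq, Env.left_apply, Env.right_apply, Env.of_smul_reg,
    Env.of_smul_reg, one_mul, mul_one, one_mul, mul_one, sub_self]

theorem ar_mul_e_of_ne (R : QuadraticRelations F Q) {a b i : Q} (α : a ⟶ b) (h : i ≠ a) :
    R.ar α * R.e i = 0 := by
  rw [← R.ar_mul_e α, mul_assoc, R.e_mul_of_ne (Ne.symm h), mul_zero]

theorem e_mul_ar_of_ne (R : QuadraticRelations F Q) {a b i : Q} (α : a ⟶ b) (h : i ≠ b) :
    R.e i * R.ar α = 0 := by
  rw [← R.e_mul_ar α, ← mul_assoc, R.e_mul_of_ne h, zero_mul]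

theorem inl_arrow (R : QuadraticRelations F Q) {a b : Q} (α : a ⟶ b) :
    R.inl (arrow F α) = Env.of F (R.ar α) 1 := rfl

theorem inr_arrow (R : QuadraticRelations F Q) {a b : Q} (α : a ⟶ b) :
    R.inr (arrow F α) = Env.of F 1 (R.ar α) := rfl

theorem del_mul_omega (R : QuadraticRelations F Q) {a b : Q} (α : a ⟶ b) :
    R.del α * R.omega = R.ee b a * R.del α := by
  have h1 : R.inl (arrow F α) * R.omega = R.ee b a * R.inl (arrow F α) := by
    rw [omega, Finset.mul_sum, Finset.sum_eq_single a]
    · rw [inl_arrow, ee, ee, Env.of_mul_of, Env.of_mul_of, ar_mul_e, e_mul_ar, one_mul, mul_one]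
    · intro i _ hi
      rw [inl_arrow, ee, Env.of_mul_of, R.ar_mul_e_of_ne α hi, Env.of_zero_left]
    · exact fun h => absurd (Finset.mem_univ _) h
  have h2 : R.inr (arrow F α) * R.omega = R.ee b a * R.inr (arrow F α) := by
    rw [omega, Finset.mul_sum, Finset.sum_eq_single b]
    · rw [inr_arrow, ee, ee, Env.of_mul_of, Env.of_mul_of, ar_mul_e, e_mul_ar, one_mul, mul_one]
    · intro i _ hi
      rw [inr_arrow, ee, Env.of_mul_of, R.e_mul_ar_of_ne α hi, Env.of_zero_right]
    · exact fun h => absurd (Finset.mem_univ _) h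
  rw [del, sub_mul, mul_sub, h1, h2]

theorem omega_mul_del (R : QuadraticRelations F Q) {a b : Q} (α : a ⟶ b) :
    R.omega * R.del α = R.del α * R.ee a b := by
  have h := congrArg (Env.flip F R.Alg) (R.del_mul_omega α)
  rw [Env.flip_mul, Env.flip_mul, flip_omega, flip_del, flip_ee, mul_neg, neg_mul] at h
  exact neg_injective h

/-- An element of `A ⊗ A` that is balanced over all arrows is zero, as soon as the right socle of
`A` is zero: among its components with respect to the degree of the second factor, the one of lowest
degree would be annihilated by all arrows. -/
theorem eq_zero_of_mul_del (R : QuadraticRelations F Q)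
    (hs : ∀ z : R.Alg, (∀ α : Arr Q, z * R.ar α.2.2 = 0) → z = 0) (u : Env F R.Alg)
    (hu : ∀ α : Arr Q, u * R.del α.2.2 = 0) : u = 0 := by
  have hinl : ∀ (l : R.Alg →ₗ[F] F) (α : Arr Q) (u : Env F R.Alg),
      Env.contract l (u * R.inl (arrow F α.2.2)) = Env.contract l u * R.ar α.2.2 := by
    intro l α u
    induction u using Env.induction with
    | zero => simp
    | add x y hx hy => rw [add_mul, map_add, hx, hy, map_add, add_mul]
    | of a b =>
      rw [inl_arrow, Env.of_mul_of, one_mul, Env.contract_of, Env.contract_of, smul_mul_assoc]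
  have hinr : ∀ (l : R.Alg →ₗ[F] F) (α : Arr Q) (u : Env F R.Alg),
      Env.contract l (u * R.inr (arrow F α.2.2)) =
        Env.contract (l ∘ₗ LinearMap.mulLeft F (R.ar α.2.2)) u := by
    intro l α u
    induction u using Env.induction with
    | zero => simp
    | add x y hx hy => rw [add_mul, map_add, hx, hy, map_add]
    | of a b =>
      rw [inr_arrow, Env.of_mul_of, mul_one, Env.contract_of, Env.contract_of]
      rfl
  have hc : ∀ (n : ℕ) (l : R.Alg →ₗ[F] F), Env.contract (l ∘ₗ R.comp n) u = 0 := by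
    intro n
    induction n with
    | zero =>
      intro l
      refine hs _ fun α => ?_
      have h := congrArg (Env.contract (l ∘ₗ R.comp 0)) (hu α)
      rw [del, mul_sub, map_sub, map_zero, sub_eq_zero, hinl, hinr] at h
      have h0 : (l ∘ₗ R.comp 0) ∘ₗ LinearMap.mulLeft F (R.ar α.2.2) = 0 := by
        ext x
        obtain ⟨N, -, hx⟩ := R.exists_eq_sum_comp x
        change l (R.comp 0 (R.ar α.2.2 * x)) = 0
        rw [hx, Finset.mul_sum, map_sum, Finset.sum_eq_zero fun k _ => R.comp_of_mem_ne (by lia)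
          (R.deg_mul_mem (R.ar_mem_deg α.2.2) (R.comp_mem k x)), map_zero]
      rw [h, h0, Env.contract_zero]
    | succ n ih =>
      intro l
      refine hs _ fun α => ?_
      have h := congrArg (Env.contract (l ∘ₗ R.comp (n + 1))) (hu α)
      rw [del, mul_sub, map_sub, map_zero, sub_eq_zero, hinl, hinr] at h
      have h0 : (l ∘ₗ R.comp (n + 1)) ∘ₗ LinearMap.mulLeft F (R.ar α.2.2) =
          (l ∘ₗ LinearMap.mulLeft F (R.ar α.2.2)) ∘ₗ R.comp n := by
        ext x
        exact congrArg l (R.mul_comp_of_mem n x (R.ar_mem_deg α.2.2))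
      rw [h, h0, ih]
  -- every form is, on the finitely many components of `u`, a sum of forms of the above kind
  have hN : ∀ u : Env F R.Alg, ∃ N : ℕ, ∀ M, N ≤ M → ∀ l : R.Alg →ₗ[F] F,
      Env.contract l u = ∑ n ∈ Finset.range M, Env.contract (l ∘ₗ R.comp n) u := by
    intro u
    induction u using Env.induction with
    | zero => exact ⟨0, by simp⟩
    | add x y hx hy =>
      obtain ⟨N, hx⟩ := hx
      obtain ⟨N', hy⟩ := hy
      refine ⟨max N N', fun M hM l => ?_⟩
      simp only [map_add, Finset.sum_add_distrib]
      rw [hx M (by lia), hy M (by lia)]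
    | of a b =>
      obtain ⟨N, hN, hb⟩ := R.exists_eq_sum_comp b
      refine ⟨N, fun M hM l => ?_⟩
      simp only [Env.contract_of]
      rw [← Finset.sum_smul]
      congr 1
      rw [← Finset.sum_subset (Finset.range_mono hM) (fun n _ hn => by
        rw [LinearMap.comp_apply, hN n (by simpa using hn), map_zero])]
      conv_lhs => rw [hb, map_sum]
      rfl
  refine Env.eq_zero_of_contract u fun l => ?_
  obtain ⟨N, hN⟩ := hN u
  rw [hN N le_rfl l]
  exact Finset.sum_eq_zero fun n _ => hc n l

/-! ### Coordinates on the terms of the Koszul complex -/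

/-- The homomorphism from `A ⊗_k A` to `A ⊗ A` that maps the generator to `omega * u`. -/
def genHom (R : QuadraticRelations F Q) (u : Env F R.Alg) :
    R.KoszulModule 0 →ₗ[Env F R.Alg] Env F R.Alg :=
  LinearMap.toSpanSingleton _ _ u ∘ₗ R.preMul 0 ∘ₗ R.ksec 0

theorem genHom_kgen (R : QuadraticRelations F Q) (u : Env F R.Alg) :
    R.genHom u R.kgen = R.omega * u := by
  rw [genHom, LinearMap.comp_apply, LinearMap.comp_apply, preMul_ksec_kgen]
  rfl

theorem mul_omega_eq_zero (R : QuadraticRelations F Q) {u : Env F R.Alg}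
    (h : u • R.kgen = 0) : u * R.omega = 0 := by
  have h' := congrArg (R.genHom 1) h
  rwa [map_smul, genHom_kgen, map_zero, mul_one] at h'

theorem koszulModule_zero_hom_ext (R : QuadraticRelations F Q) {M : Type*} [AddCommGroup M]
    [Module (Env F R.Alg) M] {f g : R.KoszulModule 0 →ₗ[Env F R.Alg] M}
    (h : f R.kgen = g R.kgen) : f = g := by
  refine LinearMap.ext fun z => ?_
  obtain ⟨u, rfl⟩ := R.exists_smul_kgen z
  rw [map_smul, map_smul, h]

variable [∀ a b : Q, Fintype (a ⟶ b)]

/-- The class of `1 ⊗ α ⊗ 1` in the Koszul complex. -/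
def karr (R : QuadraticRelations F Q) {a b : Q} (α : a ⟶ b) : R.KoszulModule 1 :=
  R.kmk 1 (R.arrW α)

theorem koszulD_karr (R : QuadraticRelations F Q) {a b : Q} (α : a ⟶ b) :
    R.koszulD 0 (R.karr α) = R.del α • R.kgen := R.koszulD_kmk_arrW α

theorem ee_smul_karr (R : QuadraticRelations F Q) {a b : Q} (α : a ⟶ b) :
    R.ee b a • R.karr α = R.karr α := by
  rw [karr, ee_eq, mul_smul, inr_vertex_smul_arrW, inl_vertex_smul_arrW]

theorem exists_sum_karr (R : QuadraticRelations F Q) (z : R.KoszulModule 1) :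
    ∃ u : Arr Q → Env F R.Alg, z = ∑ α : Arr Q, u α • R.karr α.2.2 := by
  classical
  induction z using R.koszulModule_induction 1 with
  | zero => exact ⟨0, by simp⟩
  | add x y hx hy =>
    obtain ⟨u, rfl⟩ := hx
    obtain ⟨u', rfl⟩ := hy
    exact ⟨u + u', by simp [add_smul, Finset.sum_add_distrib]⟩
  | smul u x =>
    have hx : x ∈ Submodule.span F (Set.range fun α : Arr Q => R.arrW α.2.2) :=
      R.span_arrW ▸ Submodule.mem_top
    induction hx using Submodule.span_induction with
    | zero => exact ⟨0, by simp [kmk_zero]⟩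
    | add x y _ _ hx hy =>
      obtain ⟨v, hv⟩ := hx
      obtain ⟨v', hv'⟩ := hy
      exact ⟨v + v', by simp [kmk_add, hv, hv', add_smul, Finset.sum_add_distrib]⟩
    | smul c x _ hx =>
      obtain ⟨v, hv⟩ := hx
      refine ⟨fun α => c • v α, ?_⟩
      rw [kmk_smul, smul_comm, hv, Finset.smul_sum]
      exact Finset.sum_congr rfl fun α _ => (smul_assoc _ _ _).symm
    | mem x hx =>
      obtain ⟨β, rfl⟩ := hx
      refine ⟨Pi.single β u, ?_⟩
      rw [Finset.sum_eq_single β]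
      · rw [Pi.single_eq_same]; rfl
      · intro α _ h
        rw [Pi.single_eq_of_ne h, zero_smul]
      · exact fun h => absurd (Finset.mem_univ _) h

theorem koszulModule_one_hom_ext (R : QuadraticRelations F Q) {M : Type*} [AddCommGroup M]
    [Module (Env F R.Alg) M] {f g : R.KoszulModule 1 →ₗ[Env F R.Alg] M}
    (h : ∀ α : Arr Q, f (R.karr α.2.2) = g (R.karr α.2.2)) : f = g := by
  refine LinearMap.ext fun z => ?_
  obtain ⟨u, rfl⟩ := R.exists_sum_karr z
  simp only [map_sum, map_smul, h]

/-- The coefficient of an arrow, as a linear form on `V`. -/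
def arrForm (R : QuadraticRelations F Q) (α : Arr Q) : R.W 1 →ₗ[F] F :=
  (augVertex F α.1).toLinearMap ∘ₗ leftStrip α.2.2 ∘ₗ (R.W 1).subtype

theorem arrForm_arrW (R : QuadraticRelations F Q) (α : Arr Q) :
    R.arrForm α (R.arrW α.2.2) = 1 := by
  classical
  change augVertex F α.1 (leftStrip α.2.2 (arrow F α.2.2)) = 1
  rw [leftStrip_arrow, if_pos rfl, augVertex_vertex, if_pos rfl]

theorem arrForm_arrW_of_ne (R : QuadraticRelations F Q) {α β : Arr Q} (h : α ≠ β) :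
    R.arrForm α (R.arrW β.2.2) = 0 := by
  classical
  change augVertex F α.1 (leftStrip α.2.2 (arrow F β.2.2)) = 0
  rw [leftStrip_arrow, if_neg h, map_zero]

open scoped Classical in
theorem cut_arrW (R : QuadraticRelations F Q) (i j : Q) {a b : Q} (α : a ⟶ b) :
    R.cut 1 i j (R.arrW α) = if i = b ∧ j = a then R.arrW α else 0 := by
  refine Subtype.ext ?_
  rw [cut_coe]
  change vertex F i * ofPath F _ * vertex F j = _
  rw [vertex_mul_ofPath]
  by_cases hi : i = b
  · rw [if_pos hi, ofPath_mul_vertex]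
    by_cases hj : j = a
    · rw [if_pos hj, if_pos ⟨hi, hj⟩]; rfl
    · rw [if_neg hj, if_neg fun h => hj h.2]; rfl
  · rw [if_neg hi, if_neg fun h => hi h.1, zero_mul]; rfl

theorem coeffHom_karr (R : QuadraticRelations F Q) (φ : R.W 1 →ₗ[F] F) {a b : Q} (α : a ⟶ b) :
    R.coeffHom 1 φ (R.karr α) = φ (R.arrW α) • R.ee b a := by
  classical
  rw [karr, coeffHom_kmk, Finset.sum_eq_single b, Finset.sum_eq_single a]
  · rw [cut_arrW, if_pos ⟨rfl, rfl⟩]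
  · intro j _ hj
    rw [cut_arrW, if_neg fun h => hj h.2, map_zero, zero_smul]
  · exact fun h => absurd (Finset.mem_univ _) h
  · intro i _ hi
    refine Finset.sum_eq_zero fun j _ => ?_
    rw [cut_arrW, if_neg fun h => hi h.1, map_zero, zero_smul]
  · exact fun h => absurd (Finset.mem_univ _) h

/-- The homomorphism from `A ⊗_k V ⊗_k A` to `A ⊗ A` that maps the generator of the arrow `α` from
`i` to `j` to `(e_j ⊗ e_i) * y α`. -/
def arrHom (R : QuadraticRelations F Q) (y : Arr Q → Env F R.Alg) :
    R.KoszulModule 1 →ₗ[Env F R.Alg] Env F R.Alg :=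
  ∑ α : Arr Q, LinearMap.toSpanSingleton _ _ (y α) ∘ₗ R.coeffHom 1 (R.arrForm α)

theorem arrHom_karr (R : QuadraticRelations F Q) (y : Arr Q → Env F R.Alg) (α : Arr Q) :
    R.arrHom y (R.karr α.2.2) = R.ee α.2.1 α.1 * y α := by
  rw [arrHom, LinearMap.sum_apply, Finset.sum_eq_single α]
  · rw [LinearMap.comp_apply, coeffHom_karr, arrForm_arrW, one_smul]; rfl
  · intro β _ h
    rw [LinearMap.comp_apply, coeffHom_karr, arrForm_arrW_of_ne _ h, zero_smul, map_zero]
  · exact fun h => absurd (Finset.mem_univ _) h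

theorem mul_ee_eq_zero (R : QuadraticRelations F Q) {u : Arr Q → Env F R.Alg}
    (h : ∑ α : Arr Q, u α • R.karr α.2.2 = 0) (β : Arr Q) : u β * R.ee β.2.1 β.1 = 0 := by
  have h' := congrArg (R.coeffHom 1 (R.arrForm β)) h
  rw [map_zero, map_sum, Finset.sum_eq_single β] at h'
  · rwa [map_smul, coeffHom_karr, arrForm_arrW, one_smul] at h'
  · intro α _ hα
    rw [map_smul, coeffHom_karr, arrForm_arrW_of_ne _ (Ne.symm hα), zero_smul, smul_zero]
  · exact fun h => absurd (Finset.mem_univ _) h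

end QuadraticRelations

/-! ### The Koszul complex of a preprojective algebra in degree two -/

namespace PathAlgebra

variable {F : Type u} [Field F] {Q : Type v} [Quiver.{w} Q] [Fintype Q]
  [∀ a b : Q, Fintype (a ⟶ b)]

theorem sum_arrow_mul_leftStrip (m : ℕ) {x : PathAlgebra F Q}
    (hx : x ∈ degreePart F Q (m + 1)) :
    ∑ α : Arr Q, arrow F α.2.2 * leftStrip α.2.2 x = x := by
  induction hx using Submodule.span_induction with
  | zero => simp
  | add x y _ _ hx hy => simp only [map_add, mul_add, Finset.sum_add_distrib, hx, hy]
  | smul c x _ hx => simp only [map_smul, mul_smul_comm, ← Finset.smul_sum, hx]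
  | mem x hx =>
    obtain ⟨i, j, p, hp, rfl⟩ := hx
    obtain ⟨k, p, β, rfl⟩ := (Quiver.Path.length_ne_zero_iff_eq_cons p).1 (by lia)
    rw [Finset.sum_eq_single (⟨k, j, β⟩ : Arr Q)]
    · rw [leftStrip_cons, ofPath_cons]
    · intro γ _ h
      rw [leftStrip_cons_of_ne γ.2.2 β _ h, mul_zero]
    · exact fun h => absurd (Finset.mem_univ _) h

end PathAlgebra

namespace Preproj

open PathAlgebra QuadraticRelations

variable {F : Type u} [Field F] {Q : Type v} [Quiver.{w} Q] [Fintype Q]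
  [∀ a b : Q, Fintype (a ⟶ b)]

/-- The relations of the preprojective algebra. -/
local notation "𝐏" => preprojective F Q

theorem sum_rev {M : Type*} [AddCommMonoid M] (g : Arr (Quiver.Symmetrify Q) → M) :
    ∑ α, g (rev α) = ∑ α, g α :=
  Equiv.sum_comp (Function.Involutive.toPerm rev rev_rev) g

variable (F Q) in
/-- The sum of the preprojective relations, as a generator of the bimodule `A ⊗_k R ⊗_k A`. -/
def ksig : (𝐏).KoszulModule 2 := (𝐏).kmk 2 ⟨sigma F Q, (𝐏).mem_W_two sigma_mem_carrier⟩

theorem inl_vertex_smul_ksig (k : Quiver.Symmetrify Q) :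
    (𝐏).inl (vertex F k) • ksig F Q = (𝐏).kmk 2 ⟨preprojectiveRelation F Q k,
      (𝐏).mem_W_two (preprojectiveRelation_mem k)⟩ :=
  (𝐏).inl_smul_kmk 2 k _ _ (vertex_mul_sigma k).symm

theorem inr_vertex_smul_ksig (k : Quiver.Symmetrify Q) :
    (𝐏).inr (vertex F k) • ksig F Q = (𝐏).kmk 2 ⟨preprojectiveRelation F Q k,
      (𝐏).mem_W_two (preprojectiveRelation_mem k)⟩ :=
  (𝐏).inr_smul_kmk 2 k _ _ ((vertex_mul_sigma k).symm.trans (sigma_mul_vertex k).symm)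

theorem omega_smul_ksig : (𝐏).omega • ksig F Q = ksig F Q :=
  (𝐏).omega_smul _ fun k => (inl_vertex_smul_ksig k).trans (inr_vertex_smul_ksig k).symm

theorem mem_carrier_of_mem_W {x : PathAlgebra F (Quiver.Symmetrify Q)} (hx : x ∈ (𝐏).W 2) :
    x ∈ (𝐏).carrier := by
  simp only [W, Submodule.mem_inf, Submodule.mem_iInf] at hx
  exact (mul_le_mul' (𝐏).left_mul_le le_rfl).trans (𝐏).right_mul_le (hx.2 0 0 rfl)

theorem exists_smul_ksig (z : (𝐏).KoszulModule 2) :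
    ∃ u : Env F (𝐏).Alg, z = u • ksig F Q := by
  induction z using (𝐏).koszulModule_induction 2 with
  | zero => exact ⟨0, (zero_smul _ _).symm⟩
  | add x y hx hy =>
    obtain ⟨u, rfl⟩ := hx
    obtain ⟨u', rfl⟩ := hy
    exact ⟨u + u', (add_smul _ _ _).symm⟩
  | smul u x =>
    obtain ⟨x, hxW⟩ := x
    have hx := mem_carrier_of_mem_W hxW
    rw [preprojective_carrier] at hx
    induction hx using Submodule.span_induction with
    | mem x hx =>
      obtain ⟨k, rfl⟩ := hx
      exact ⟨u * (𝐏).inl (vertex F (show Quiver.Symmetrify Q from k)),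
        (congrArg (u • ·) (inl_vertex_smul_ksig k).symm).trans (mul_smul _ _ _).symm⟩
    | zero => exact ⟨0, ((congrArg (u • ·) ((𝐏).kmk_zero 2)).trans (smul_zero u)).trans
        (zero_smul _ _).symm⟩
    | add x y hx' hy' hx hy =>
      rw [← preprojective_carrier] at hx' hy'
      obtain ⟨v, hv⟩ := hx ((𝐏).mem_W_two hx')
      obtain ⟨v', hv'⟩ := hy ((𝐏).mem_W_two hy')
      refine ⟨v + v', ?_⟩
      rw [add_smul, ← hv, ← hv', ← smul_add, ← kmk_add]
      rfl
    | smul c x hx' hx =>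
      rw [← preprojective_carrier] at hx'
      obtain ⟨v, hv⟩ := hx ((𝐏).mem_W_two hx')
      refine ⟨c • v, ?_⟩
      rw [smul_assoc, ← hv, smul_comm, ← kmk_smul]
      rfl

theorem koszulModule_two_hom_ext {M : Type*} [AddCommGroup M]
    [Module (Env F (𝐏).Alg) M] {f g : (𝐏).KoszulModule 2 →ₗ[Env F (𝐏).Alg] M}
    (h : f (ksig F Q) = g (ksig F Q)) : f = g := by
  refine LinearMap.ext fun z => ?_
  obtain ⟨u, rfl⟩ := exists_smul_ksig z
  rw [map_smul, map_smul, h]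

theorem leftStrip_sigma (β : Arr (Quiver.Symmetrify Q)) :
    leftStrip β.2.2 (sigma F Q) = sgn F β • arrow F (rev β).2.2 := by
  classical
  rw [sigma, map_sum, Finset.sum_eq_single β]
  · rw [map_smul, leftStrip_mul _ 0 (arrow_mem _), leftStrip_arrow, if_pos rfl]
    congr 1
    exact vertex_mul_arrow (rev β).2.2
  · intro α _ h
    rw [map_smul, leftStrip_mul _ 0 (arrow_mem _), leftStrip_arrow, if_neg (Ne.symm h), zero_mul,
      smul_zero]
  · exact fun h => absurd (Finset.mem_univ _) h

theorem koszulD_ksig : (𝐏).koszulD 1 (ksig F Q) =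
    ∑ β : Arr (Quiver.Symmetrify Q), (-sgn F β) • (𝐏).del (rev β).2.2 • (𝐏).karr β.2.2 := by
  have h1 : ∀ α : Arr (Quiver.Symmetrify Q),
      (𝐏).leftW 1 α.2.2 ⟨sigma F Q, (𝐏).mem_W_two sigma_mem_carrier⟩ =
        sgn F α • (𝐏).arrW (rev α).2.2 := fun α => Subtype.ext (leftStrip_sigma α)
  have h2 : ∀ α : Arr (Quiver.Symmetrify Q),
      (𝐏).rightW 1 α.2.2 ⟨sigma F Q, (𝐏).mem_W_two sigma_mem_carrier⟩ =
        (-sgn F α) • (𝐏).arrW (rev α).2.2 := fun α => Subtype.ext (by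
    have h := rightStrip_sigma (F := F) (rev α)
    rw [sgn_rev] at h
    refine Eq.trans ?_ h
    exact congrArg (fun γ : Arr (Quiver.Symmetrify Q) => rightStrip γ.2.2 (sigma F Q))
      (rev_rev α).symm)
  have h3 : ∀ α : Arr (Quiver.Symmetrify Q), (𝐏).del (rev (rev α)).2.2 = (𝐏).del α.2.2 := fun α =>
    congrArg (fun γ : Arr (Quiver.Symmetrify Q) => (𝐏).del γ.2.2) (rev_rev α)
  rw [ksig, koszulD_kmk, Finset.smul_sum, ← Finset.sum_add_distrib]
  refine (Finset.sum_congr rfl fun α _ => ?_).trans (sum_rev _)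
  rw [h1, h2, h3, kmk_smul, kmk_smul, sgn_rev, neg_neg, del, smul_comm _ (sgn F α),
    smul_comm _ (-sgn F α), sub_smul, smul_sub, sub_eq_add_neg, neg_smul]
  simp only [Nat.reduceAdd, even_two, Even.neg_pow, one_pow, one_smul]
  rfl

/-- A linear form on the relations that takes the value `1` at all preprojective relations. -/
def sigForm (c : Quiver.Symmetrify Q → Arr (Quiver.Symmetrify Q)) : (𝐏).W 2 →ₗ[F] F :=
  ∑ k : Quiver.Symmetrify Q, sgn F (c k) • ((augVertex F (c k).1).toLinearMap ∘ₗ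
    leftStrip (c k).2.2 ∘ₗ rightStrip (rev (c k)).2.2 ∘ₗ ((𝐏).W 2).subtype)

theorem sigForm_eq_one (c : Quiver.Symmetrify Q → Arr (Quiver.Symmetrify Q))
    (hc : ∀ k, (c k).2.1 = k) (k : Quiver.Symmetrify Q) (x : (𝐏).W 2)
    (hx : (x : PathAlgebra F (Quiver.Symmetrify Q)) = vertex F k * sigma F Q) :
    sigForm c x = 1 := by
  classical
  have h : ∀ i, augVertex F (c i).1 (leftStrip (c i).2.2 (rightStrip (rev (c i)).2.2
      (vertex F k * sigma F Q))) = if i = k then sgn F (c i) else 0 := by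
    intro i
    rw [rightStrip_vertex_mul, rightStrip_sigma, mul_smul_comm, map_smul, map_smul,
      leftStrip_vertex_mul, leftStrip_arrow, if_pos rfl, hc i]
    by_cases hik : i = k
    · subst hik
      rw [if_pos rfl, if_pos rfl, augVertex_vertex, if_pos rfl, smul_eq_mul, mul_one]
    · rw [if_neg hik, if_neg (Ne.symm hik), map_zero, smul_zero]
  rw [sigForm, LinearMap.sum_apply, Finset.sum_eq_single k]
  · rw [LinearMap.smul_apply]
    refine (congrArg (sgn F (c k) • ·) ?_).trans (sgn_mul_self F (c k))
    refine Eq.trans ?_ ((h k).trans (if_pos rfl))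
    rw [← hx]
    rfl
  · intro i _ hi
    rw [LinearMap.smul_apply]
    refine (congrArg (sgn F (c i) • ·) ?_).trans (smul_zero _)
    refine Eq.trans ?_ ((h i).trans (if_neg hi))
    rw [← hx]
    rfl
  · exact fun h => absurd (Finset.mem_univ _) h

theorem coeffHom_ksig (c : Quiver.Symmetrify Q → Arr (Quiver.Symmetrify Q))
    (hc : ∀ k, (c k).2.1 = k) : (𝐏).coeffHom 2 (sigForm c) (ksig F Q) = (𝐏).omega := by
  classical
  rw [ksig, coeffHom_kmk, omega]
  refine Finset.sum_congr rfl fun i _ => ?_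
  rw [Finset.sum_eq_single i]
  · rw [sigForm_eq_one c hc i _ (by
      rw [cut_coe, mul_assoc, sigma_mul_vertex, ← mul_assoc, vertex_mul_self]), one_smul]
  · intro j _ hj
    have h0 : (𝐏).cut 2 i j ⟨sigma F Q, (𝐏).mem_W_two sigma_mem_carrier⟩ = 0 :=
      Subtype.ext (by
        rw [cut_coe, mul_assoc, sigma_mul_vertex, ← mul_assoc, vertex_mul_vertex_of_ne (Ne.symm hj),
          zero_mul]
        rfl)
    rw [h0, map_zero, zero_smul]
  · exact fun h => absurd (Finset.mem_univ _) h

end Preproj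

/-! ### Koszulity of preprojective algebras -/

namespace Preproj

open PathAlgebra QuadraticRelations

variable {F : Type u} [Field F] {Q : Type v} [Quiver.{w} Q] [Fintype Q]
  [∀ a b : Q, Fintype (a ⟶ b)]

/-- The relations of the preprojective algebra. -/
local notation "𝐏" => preprojective F Q

variable (F Q) in
/-- The right socle of the preprojective algebra is zero: no nonzero element is annihilated by all
arrows. -/
def SocleFree : Prop :=
  ∀ z : (𝐏).Alg, (∀ α : Arr (Quiver.Symmetrify Q), z * (𝐏).ar α.2.2 = 0) → z = 0

theorem SocleFree.exists_arrow (hs : SocleFree F Q) :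
    ∃ c : Quiver.Symmetrify Q → Arr (Quiver.Symmetrify Q), ∀ k, (c k).2.1 = k := by
  suffices h : ∀ k : Quiver.Symmetrify Q, ∃ α : Arr (Quiver.Symmetrify Q), α.2.1 = k by
    choose c hc using h
    exact ⟨c, hc⟩
  intro k
  by_contra! h
  have h0 : (𝐏).e k = 0 := hs _ fun α => (𝐏).e_mul_ar_of_ne α.2.2 (Ne.symm (h α))
  have h1 := (𝐏).aug_e_self k
  rw [h0, map_zero] at h1
  exact zero_ne_one h1

theorem mul_omega_eq_zero_of_smul_ksig (hs : SocleFree F Q) {u : Env F (𝐏).Alg}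
    (h : u • ksig F Q = 0) : u * (𝐏).omega = 0 := by
  obtain ⟨c, hc⟩ := hs.exists_arrow
  have h' := congrArg ((𝐏).coeffHom 2 (sigForm c)) h
  rwa [map_smul, coeffHom_ksig c hc, map_zero] at h'

theorem koszulD_smul_ksig (u : Env F (𝐏).Alg) : (𝐏).koszulD 1 (u • ksig F Q) =
    ∑ β : Arr (Quiver.Symmetrify Q),
      ((-sgn F β) • (u * (𝐏).del (rev β).2.2)) • (𝐏).karr β.2.2 := by
  rw [map_smul, koszulD_ksig, Finset.smul_sum]
  refine Finset.sum_congr rfl fun β _ => ?_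
  rw [smul_comm u, smul_assoc, mul_smul]

/-- The differential `A ⊗_k R ⊗_k A → A ⊗_k V ⊗_k A` is injective. -/
theorem eq_zero_of_koszulD_one (hs : SocleFree F Q) (z : (𝐏).KoszulModule 2)
    (hz : (𝐏).koszulD 1 z = 0) : z = 0 := by
  obtain ⟨u, rfl⟩ := exists_smul_ksig z
  rw [koszulD_smul_ksig] at hz
  have h : u * (𝐏).omega = 0 := by
    refine (𝐏).eq_zero_of_mul_del hs _ fun α => ?_
    have h1 := (𝐏).mul_ee_eq_zero hz (rev α)
    have h2 : (𝐏).del (rev (rev α)).2.2 * (𝐏).ee (rev α).2.1 (rev α).1 =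
        (𝐏).omega * (𝐏).del α.2.2 :=
      (congrArg (fun γ : Arr (Quiver.Symmetrify Q) =>
        (𝐏).del γ.2.2 * (𝐏).ee (rev α).2.1 (rev α).1) (rev_rev α)).trans
        ((𝐏).omega_mul_del α.2.2).symm
    rw [smul_mul_assoc, mul_assoc, h2, sgn_rev, neg_neg] at h1
    have h3 := congrArg (sgn F α • ·) h1
    simp only [smul_smul, sgn_mul_self, one_smul, smul_zero] at h3
    rw [mul_assoc, h3]
  rw [← omega_smul_ksig, smul_smul, h, zero_smul]

/-- An element of `W_3` lies in `V R`, hence is of the form `v σ` with `v` in `V`; as it lies in `R V`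
as well, `v` is annihilated by all arrows in `A`. -/
theorem eq_zero_of_mem_W_three (hs : SocleFree F Q) {x : PathAlgebra F (Quiver.Symmetrify Q)}
    (hx : x ∈ (𝐏).W 3) : x = 0 := by
  have hx1 : x ∈ degreePart F (Quiver.Symmetrify Q) 1 * (𝐏).carrier := by
    simp only [W, Submodule.mem_inf, Submodule.mem_iInf] at hx
    have h := hx.2 1 0 rfl
    rw [mul_assoc] at h
    exact mul_le_mul' le_rfl (𝐏).right_mul_le h
  have hx2 : x ∈ (𝐏).carrier * degreePart F (Quiver.Symmetrify Q) 1 := by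
    simp only [W, Submodule.mem_inf, Submodule.mem_iInf] at hx
    exact mul_le_mul' (𝐏).left_mul_le le_rfl (hx.2 0 1 rfl)
  obtain ⟨v, hv, rfl⟩ : ∃ v ∈ degreePart F (Quiver.Symmetrify Q) 1, x = v * sigma F Q := by
    clear hx hx2
    induction hx1 using Submodule.mul_induction_on' with
    | add y _ z _ hy hz =>
      obtain ⟨v, hv, rfl⟩ := hy
      obtain ⟨v', hv', rfl⟩ := hz
      exact ⟨v + v', add_mem hv hv', (add_mul _ _ _).symm⟩
    | mem_mul_mem y hy r hr =>
      rw [preprojective_carrier] at hr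
      induction hr using Submodule.span_induction with
      | zero => exact ⟨0, zero_mem _, by rw [mul_zero, zero_mul]⟩
      | add r r' _ _ hr hr' =>
        obtain ⟨v, hv, h⟩ := hr
        obtain ⟨v', hv', h'⟩ := hr'
        exact ⟨v + v', add_mem hv hv', by rw [mul_add, h, h', add_mul]⟩
      | smul c r _ hr =>
        obtain ⟨v, hv, h⟩ := hr
        exact ⟨c • v, Submodule.smul_mem _ _ hv, by rw [mul_smul_comm, h, smul_mul_assoc]⟩
      | mem r hr =>
        obtain ⟨k, rfl⟩ := hr
        exact ⟨y * vertex F (show Quiver.Symmetrify Q from k), mul_vertex_mem_degreePart _ hy,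
          (congrArg (y * ·) (vertex_mul_sigma k).symm).trans (mul_assoc _ _ _).symm⟩
  have hstrip : ∀ (x : PathAlgebra F (Quiver.Symmetrify Q)),
      x ∈ (𝐏).carrier * degreePart F (Quiver.Symmetrify Q) 1 →
      ∀ β : Arr (Quiver.Symmetrify Q), (𝐏).proj (rightStrip β.2.2 x) = 0 := by
    intro x hx β
    induction hx using Submodule.mul_induction_on' with
    | add y _ z _ hy hz => rw [map_add, map_add, hy, hz, add_zero]
    | mem_mul_mem r hr y hy =>
      rw [rightStrip_mul β.2.2 0 r hy, map_mul, (𝐏).proj_eq_zero hr, zero_mul]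
  have hv0 : (𝐏).proj v = 0 := hs _ fun β => by
    have h := hstrip _ hx2 (rev β)
    rw [rightStrip_mul _ 1 _ sigma_mem, rightStrip_sigma, mul_smul_comm, map_smul, map_mul] at h
    have h' := congrArg (sgn F β • ·) h
    simp only [smul_smul, sgn_mul_self, one_smul, smul_zero] at h'
    exact h'
  rw [eq_zero_of_proj_eq_zero (𝐏) (by lia : 1 < 2) hv hv0, zero_mul]

theorem eq_zero_of_mem_W (hs : SocleFree F Q) (m : ℕ) {x : PathAlgebra F (Quiver.Symmetrify Q)}
    (hx : x ∈ (𝐏).W (m + 3)) : x = 0 := by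
  induction m generalizing x with
  | zero => exact eq_zero_of_mem_W_three hs hx
  | succ m ih =>
    have hx' : x ∈ degreePart F (Quiver.Symmetrify Q) (m + 3 + 1) := hx.1
    rw [← sum_arrow_mul_leftStrip _ hx']
    refine Finset.sum_eq_zero fun α _ => ?_
    rw [ih ((𝐏).leftStrip_mem_W (m + 3) α.2.2 hx), mul_zero]

theorem isZero_koszulComplex_X_of_two_lt (hs : SocleFree F Q) (p : ℕ) (hp : 2 < p) :
    Limits.IsZero ((𝐏).koszulComplex.X p) := by
  obtain ⟨m, rfl⟩ := Nat.exists_eq_add_of_le' (show 3 ≤ p from hp)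
  rw [isZero_koszulComplex_X_iff]
  intro z
  induction z using (𝐏).koszulModule_induction (m + 3) with
  | zero => rfl
  | add x y hx hy => rw [hx, hy, add_zero]
  | smul u x =>
    rw [show x = 0 from Subtype.ext (eq_zero_of_mem_W hs m x.2), kmk_zero, smul_zero]

theorem isKoszul (hs : SocleFree F Q) : (𝐏).IsKoszul := by
  intro p hp
  by_cases h : p = 2
  · subst h
    refine ((𝐏).koszulComplex_exactAt_succ_iff 1).2 fun z hz => ?_
    rw [eq_zero_of_koszulD_one hs z hz]
    exact zero_mem _
  · exact ShortComplex.exact_of_isZero_X₂ _ (isZero_koszulComplex_X_of_two_lt hs p (by lia))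

theorem hasLength [Nonempty Q] (hs : SocleFree F Q) : (𝐏).HasLength 2 := by
  refine ⟨fun h => ?_, isZero_koszulComplex_X_of_two_lt hs⟩
  rw [isZero_koszulComplex_X_iff] at h
  have h0 := mul_omega_eq_zero_of_smul_ksig hs (u := 1) (by rw [one_smul]; exact h _)
  rw [one_mul] at h0
  have h1 := (𝐏).omega_smul_one
  rw [h0, zero_smul] at h1
  have : Nonempty (Quiver.Symmetrify Q) := ‹Nonempty Q›
  have := (𝐏).nontrivial_alg
  exact zero_ne_one (α := (𝐏).Alg) ((Env.reg F).injective ((map_zero _).trans h1))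

/-! ### The dual of the Koszul complex of a preprojective algebra -/

theorem sgn_smul_sgn_smul {M : Type*} [AddCommGroup M] [Module F M]
    (α : Arr (Quiver.Symmetrify Q)) (x : M) : sgn F α • sgn F α • x = x := by
  rw [smul_smul, sgn_mul_self, one_smul]

/-- Exactness of the dual complex in degree zero. -/
theorem eq_zero_of_comp_koszulD_zero (hs : SocleFree F Q)
    (f : (𝐏).KoszulModule 0 →ₗ[Env F (𝐏).Alg] Env F (𝐏).Alg) (hf : f ∘ₗ (𝐏).koszulD 0 = 0) :
    f = 0 := by
  refine (𝐏).koszulModule_zero_hom_ext ?_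
  rw [LinearMap.zero_apply, ← Env.flip_flip (f _)]
  refine (congrArg (Env.flip F _) ?_).trans (map_zero _)
  refine (𝐏).eq_zero_of_mul_del hs _ fun α => ?_
  have h := LinearMap.congr_fun hf ((𝐏).karr α.2.2)
  rw [LinearMap.comp_apply, koszulD_karr, map_smul, smul_eq_mul, LinearMap.zero_apply] at h
  have h' := congrArg (Env.flip F (𝐏).Alg) h
  rw [Env.flip_mul, flip_del, map_zero, mul_neg] at h'
  exact neg_eq_zero.1 h'

/-- Exactness of the dual complex in degree one. The involution `flip`, together with the bijection
`α ↦ α*` of the arrows, exchanges cocycles of the dual complex and cycles of the Koszul complex, up to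
signs. -/
theorem exists_factor_koszulD_zero
    (f : (𝐏).KoszulModule 1 →ₗ[Env F (𝐏).Alg] Env F (𝐏).Alg) (hf : f ∘ₗ (𝐏).koszulD 1 = 0) :
    ∃ g : (𝐏).KoszulModule 0 →ₗ[Env F (𝐏).Alg] Env F (𝐏).Alg, f = g ∘ₗ (𝐏).koszulD 0 := by
  have h := LinearMap.congr_fun hf (ksig F Q)
  rw [LinearMap.comp_apply, koszulD_ksig, map_sum, LinearMap.zero_apply, ← sum_rev] at h
  have hrev : ∀ α : Arr (Quiver.Symmetrify Q), (𝐏).del (rev (rev α)).2.2 = (𝐏).del α.2.2 := fun α =>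
    congrArg (fun γ : Arr (Quiver.Symmetrify Q) => (𝐏).del γ.2.2) (rev_rev α)
  -- the cycle of the Koszul complex that corresponds to the cocycle `f`
  let w : (𝐏).KoszulModule 1 := ∑ α : Arr (Quiver.Symmetrify Q),
    (sgn F α • Env.flip F (𝐏).Alg (f ((𝐏).karr (rev α).2.2))) • (𝐏).karr α.2.2
  have hw : (𝐏).koszulD 0 w = 0 := by
    have h' := congrArg (Env.flip F (𝐏).Alg) h
    rw [map_sum, map_zero] at h'
    rw [map_sum]
    have e : ∀ α : Arr (Quiver.Symmetrify Q), (𝐏).koszulD 0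
        ((sgn F α • Env.flip F (𝐏).Alg (f ((𝐏).karr (rev α).2.2))) • (𝐏).karr α.2.2) =
        -(Env.flip F (𝐏).Alg (f ((-sgn F (rev α)) • (𝐏).del (rev (rev α)).2.2 •
          (𝐏).karr (rev α).2.2)) • (𝐏).kgen) := by
      intro α
      rw [map_smul, koszulD_karr, hrev, sgn_rev, neg_neg, ← algebraMap_smul (Env F (𝐏).Alg)
        (sgn F α) ((𝐏).del α.2.2 • _), map_smul, map_smul f, algebraMap_smul, map_smul, smul_eq_mul,
        Env.flip_mul, flip_del, smul_smul, mul_neg, smul_mul_assoc, smul_neg, neg_smul, neg_neg]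
    rw [Finset.sum_congr rfl fun α _ => e α, Finset.sum_neg_distrib, ← Finset.sum_smul, h',
      zero_smul, neg_zero]
  obtain ⟨z, hz⟩ := (𝐏).mem_range_koszulD_one w hw
  obtain ⟨u, rfl⟩ := exists_smul_ksig z
  refine ⟨(𝐏).genHom (Env.flip F (𝐏).Alg u), (𝐏).koszulModule_one_hom_ext fun α => ?_⟩
  rw [koszulD_smul_ksig, ← sub_eq_zero, ← Finset.sum_sub_distrib] at hz
  simp only [← sub_smul] at hz
  have h1 := (𝐏).mul_ee_eq_zero hz (rev α)
  have h2 : (𝐏).karr (rev (rev α)).2.2 = (𝐏).karr α.2.2 :=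
    congrArg (fun γ : Arr (Quiver.Symmetrify Q) => (𝐏).karr γ.2.2) (rev_rev α)
  rw [hrev, h2, sgn_rev, neg_neg, neg_smul, sub_neg_eq_add, ← smul_add, smul_mul_assoc] at h1
  have h3 := congrArg (sgn F α • ·) h1
  simp only [sgn_smul_sgn_smul, smul_zero] at h3
  have h4 := congrArg (Env.flip F (𝐏).Alg) h3
  rw [Env.flip_mul, map_add, Env.flip_flip, Env.flip_mul, flip_del, flip_ee, map_zero, neg_mul,
    neg_add_eq_sub, mul_sub, sub_eq_zero, ← mul_assoc] at h4
  rw [LinearMap.comp_apply, koszulD_karr, map_smul, genHom_kgen, smul_eq_mul, ← mul_assoc,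
    del_mul_omega]
  refine Eq.trans ?_ h4
  refine Eq.trans ?_ (map_smul f _ _)
  exact congrArg f ((𝐏).ee_smul_karr α.2.2).symm

/-- Exactness of the dual complex in degree two, where it is augmented by `A`. -/
theorem exists_factor_koszulD_one
    (f : (𝐏).KoszulModule 2 →ₗ[Env F (𝐏).Alg] Env F (𝐏).Alg)
    (hf : Env.flip F (𝐏).Alg (f (ksig F Q)) • Env.reg F (1 : (𝐏).Alg) = 0) :
    ∃ g : (𝐏).KoszulModule 1 →ₗ[Env F (𝐏).Alg] Env F (𝐏).Alg, f = g ∘ₗ (𝐏).koszulD 1 := by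
  set u := Env.flip F (𝐏).Alg (f (ksig F Q)) with hu
  obtain ⟨z, hz⟩ := (𝐏).mem_range_koszulD_zero (u • (𝐏).kgen) (by rw [koszulAug_smul_kgen, hf])
  obtain ⟨v, rfl⟩ := (𝐏).exists_sum_karr z
  have h1 : (∑ α : Arr (Quiver.Symmetrify Q), v α * (𝐏).ee α.2.1 α.1 * (𝐏).del α.2.2 - u) •
      (𝐏).kgen = 0 := by
    rw [sub_smul, sub_eq_zero, ← hz, map_sum, Finset.sum_smul]
    refine Finset.sum_congr rfl fun α _ => ?_
    rw [mul_smul, ← koszulD_karr, ← map_smul, mul_smul, ee_smul_karr]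
  have h2 := (𝐏).mul_omega_eq_zero h1
  rw [sub_mul, sub_eq_zero] at h2
  have h3 := congrArg (Env.flip F (𝐏).Alg) h2
  have h4 : (𝐏).omega * f (ksig F Q) = f (ksig F Q) := by
    rw [← smul_eq_mul, ← map_smul, omega_smul_ksig]
  rw [Env.flip_mul, Env.flip_mul, flip_omega, hu, Env.flip_flip, h4, map_sum] at h3
  refine ⟨(𝐏).arrHom fun β => sgn F β • Env.flip F (𝐏).Alg (v (rev β)),
    koszulModule_two_hom_ext ?_⟩
  rw [LinearMap.comp_apply, koszulD_ksig, map_sum, ← h3, Finset.mul_sum, ← sum_rev]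
  refine Finset.sum_congr rfl fun β _ => ?_
  rw [← algebraMap_smul (Env F (𝐏).Alg) (-sgn F β), map_smul, map_smul, arrHom_karr,
    algebraMap_smul, mul_smul_comm, smul_eq_mul, mul_smul_comm, smul_smul, neg_mul, sgn_mul_self,
    neg_one_smul, Env.flip_mul, Env.flip_mul, flip_del, flip_ee, neg_mul, mul_neg, ← mul_assoc,
    omega_mul_del, ← mul_assoc, mul_assoc ((𝐏).del (rev β).2.2)]
  rw [ee_mul_self, mul_assoc]
  rfl

end Preproj

/-! ### The Calabi–Yau property of preprojective algebras -/

namespace Env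

variable {F : Type u} [Field F] {A : Type v} [Ring A] [Algebra F A]

/-- The homomorphism of bimodules `Hom_{Aᵉ}(N, Aᵉ) → A` that evaluates at `x` and multiplies the
two factors of the result in the opposite order. -/
def dualEval (N : ModuleCat.{v} (Env F A)) (x : N) : Dual N →ₗ[Env F A] regular F A where
  toFun f := flip F A ((show N →ₗ[Env F A] Env F A from f) x) • reg F (1 : A)
  map_add' f g := by
    refine Eq.trans ?_ (add_smul _ _ _)
    exact congrArg (· • reg F (1 : A)) (map_add (flip F A) _ _)
  map_smul' u f := by
    have h : (show N →ₗ[Env F A] Env F A from u • f) x =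
        (show N →ₗ[Env F A] Env F A from f) x * flip F A u := rfl
    rw [h, flip_mul, flip_flip, mul_smul]
    rfl

end Env

namespace Preproj

open PathAlgebra QuadraticRelations HomologicalComplex

variable {F : Type u} [Field F] {Q : Type v} [Quiver.{w} Q] [Fintype Q]
  [∀ a b : Q, Fintype (a ⟶ b)]

/-- The relations of the preprojective algebra. -/
local notation "𝐏" => preprojective F Q

variable (F Q) in
/-- The evaluation of `Hom_{Aᵉ}(K(A)_2, Aᵉ)` at the sum of the preprojective relations. -/
def dualAug : (Env.dualComplex (𝐏).koszulCochain).X 2 ⟶ Env.regular F (𝐏).Alg :=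
  ModuleCat.homEquiv.symm (Env.dualEval ((𝐏).koszulCochain.X (-2))
    (((𝐏).koszulCochainXIso 2 (-2) rfl).inv (ksig F Q)))

theorem dualAug_apply (f : (𝐏).KoszulModule 2 →ₗ[Env F (𝐏).Alg] Env F (𝐏).Alg) :
    dualAug F Q (((𝐏).koszulCochainXIso 2 (-2) rfl).hom ≫ ModuleCat.ofHom f).hom =
      Env.flip F (𝐏).Alg (f (ksig F Q)) • Env.reg F (1 : (𝐏).Alg) := by
  refine congrArg (fun z => Env.flip F (𝐏).Alg (f z) • Env.reg F (1 : (𝐏).Alg)) ?_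
  exact ConcreteCategory.congr_hom ((𝐏).koszulCochainXIso 2 (-2) rfl).inv_hom_id (ksig F Q)

/-- The homomorphisms from a term of the Koszul cochain complex to `Aᵉ`, in terms of those from
`A ⊗_k W_m ⊗_k A`. -/
theorem exists_eq_comp (m : ℕ) (i : ℤ) (h : -(m : ℤ) = i)
    (f : (𝐏).koszulCochain.X i ⟶ Env.self F (𝐏).Alg) :
    ∃ g : (𝐏).KoszulModule m →ₗ[Env F (𝐏).Alg] Env F (𝐏).Alg,
      f = ((𝐏).koszulCochainXIso m i h).hom ≫ ModuleCat.ofHom g :=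
  ⟨(((𝐏).koszulCochainXIso m i h).inv ≫ f).hom, by
    rw [ModuleCat.ofHom_hom, Iso.hom_inv_id_assoc]⟩

theorem flip_koszulD_ksig (g : (𝐏).KoszulModule 1 →ₗ[Env F (𝐏).Alg] Env F (𝐏).Alg) :
    Env.flip F (𝐏).Alg (g ((𝐏).koszulD 1 (ksig F Q))) • Env.reg F (1 : (𝐏).Alg) = 0 := by
  rw [koszulD_ksig, map_sum, map_sum, Finset.sum_smul]
  refine Finset.sum_eq_zero fun β _ => ?_
  rw [← algebraMap_smul (Env F (𝐏).Alg) (-sgn F β), map_smul g, map_smul g, algebraMap_smul,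
    map_smul (Env.flip F (𝐏).Alg), smul_eq_mul, Env.flip_mul, flip_del, Algebra.smul_def, mul_smul,
    mul_smul, neg_smul, del_smul_one, neg_zero, smul_zero, smul_zero]

theorem comp_koszulCochain_d (m : ℕ) (i j : ℤ) (hi : -(m + 1 : ℕ) = i) (hj : -(m : ℤ) = j)
    (g : (𝐏).KoszulModule m →ₗ[Env F (𝐏).Alg] Env F (𝐏).Alg) :
    (𝐏).koszulCochain.d i j ≫ ((𝐏).koszulCochainXIso m j hj).hom ≫ ModuleCat.ofHom g =
      ((𝐏).koszulCochainXIso (m + 1) i hi).hom ≫ ModuleCat.ofHom (g ∘ₗ (𝐏).koszulD m) := by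
  rw [(𝐏).koszulCochain_d m i j hi hj, Category.assoc, Category.assoc, Iso.inv_hom_id_assoc,
    ← ModuleCat.ofHom_comp]

theorem eq_zero_of_comp_eq_zero (m : ℕ) (i : ℤ) (h : -(m : ℤ) = i)
    (g : (𝐏).KoszulModule m →ₗ[Env F (𝐏).Alg] Env F (𝐏).Alg)
    (hg : ((𝐏).koszulCochainXIso m i h).hom ≫ ModuleCat.ofHom g = 0) : g = 0 := by
  have h1 : ModuleCat.ofHom g = 0 := by
    rw [← cancel_epi ((𝐏).koszulCochainXIso m i h).hom, hg, Limits.comp_zero]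
  exact congrArg ModuleCat.Hom.hom h1

theorem d_comp_dualAug :
    (Env.dualComplex (𝐏).koszulCochain).d 1 2 ≫ dualAug F Q = 0 := by
  refine ModuleCat.hom_ext (LinearMap.ext fun f => ?_)
  obtain ⟨g, hg⟩ := exists_eq_comp 1 (-1) rfl (ModuleCat.ofHom f)
  have h1 : (Env.dualComplex (𝐏).koszulCochain).d 1 2 f =
      (((𝐏).koszulCochainXIso 2 (-2) rfl).hom ≫ ModuleCat.ofHom (g ∘ₗ (𝐏).koszulD 1)).hom := by
    refine Eq.trans ?_ (congrArg ModuleCat.Hom.hom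
      (comp_koszulCochain_d 1 (-2) (-1) rfl rfl g))
    rw [← hg]
    rfl
  refine (congrArg (dualAug F Q) h1).trans ?_
  exact (dualAug_apply _).trans (flip_koszulD_ksig g)

theorem dualAug_surjective (hs : SocleFree F Q) : Function.Surjective (dualAug F Q) := by
  intro b
  obtain ⟨a, rfl⟩ := (Env.reg F).surjective b
  obtain ⟨c, hc⟩ := hs.exists_arrow
  let f : (𝐏).KoszulModule 2 →ₗ[Env F (𝐏).Alg] Env F (𝐏).Alg :=
    LinearMap.toSpanSingleton _ _ (Env.of F 1 a) ∘ₗ (𝐏).coeffHom 2 (sigForm c)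
  refine ⟨_, (dualAug_apply f).trans ?_⟩
  have h : f (ksig F Q) = (𝐏).omega * Env.of F 1 a := by
    rw [LinearMap.comp_apply, coeffHom_ksig c hc]
    rfl
  rw [h, Env.flip_mul, flip_omega, mul_smul, omega_smul_one, Env.flip_of, Env.of_smul_reg, mul_one,
    mul_one]

theorem exists_of_dualAug_eq_zero (x : (Env.dualComplex (𝐏).koszulCochain).X 2)
    (hx : dualAug F Q x = 0) : ∃ y, (Env.dualComplex (𝐏).koszulCochain).d 1 2 y = x := by
  obtain ⟨f, hf⟩ := exists_eq_comp 2 (-2) rfl (ModuleCat.ofHom x)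
  have hx' : x = (((𝐏).koszulCochainXIso 2 (-2) rfl).hom ≫ ModuleCat.ofHom f).hom :=
    congrArg ModuleCat.Hom.hom hf
  obtain ⟨g, rfl⟩ := exists_factor_koszulD_one f
    ((dualAug_apply f).symm.trans ((congrArg (dualAug F Q) hx'.symm).trans hx))
  refine ⟨(((𝐏).koszulCochainXIso 1 (-1) rfl).hom ≫ ModuleCat.ofHom g).hom, ?_⟩
  rw [hx']
  exact congrArg ModuleCat.Hom.hom (comp_koszulCochain_d 1 (-2) (-1) rfl rfl g)

theorem dualComplex_exactAt (hs : SocleFree F Q) (k : ℤ) (hk : k ≠ 2) :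
    (Env.dualComplex (𝐏).koszulCochain).ExactAt k := by
  obtain hk0 | hk0 := lt_or_ge k 0
  · rw [Env.dualComplex_exactAt_iff _ k (-k - 1) (-k) (-k + 1) rfl (by ring) rfl]
    intro f _
    refine ⟨0, (isZero_extend_X _ _ _ fun m hm => ?_).eq_of_src _ _⟩
    rw [ComplexShape.embeddingDownNat_f] at hm
    lia
  obtain ⟨m, rfl⟩ := Int.eq_ofNat_of_zero_le hk0
  match m, hk with
  | 0, _ =>
    rw [Env.dualComplex_exactAt_iff _ _ (-1) 0 1 (by simp) (by simp) (by simp)]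
    intro f hf
    obtain ⟨f, rfl⟩ := exists_eq_comp 0 0 rfl f
    rw [comp_koszulCochain_d 0 (-1) 0 rfl rfl] at hf
    rw [eq_zero_of_comp_koszulD_zero hs f (eq_zero_of_comp_eq_zero 1 (-1) rfl _ hf)]
    exact ⟨0, by rw [ModuleCat.ofHom_zero, Limits.comp_zero, Limits.comp_zero]⟩
  | 1, _ =>
    rw [Env.dualComplex_exactAt_iff _ _ (-2) (-1) 0 (by simp) (by simp) (by simp)]
    intro f hf
    obtain ⟨f, rfl⟩ := exists_eq_comp 1 (-1) rfl f
    rw [comp_koszulCochain_d 1 (-2) (-1) rfl rfl] at hf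
    obtain ⟨g, rfl⟩ := exists_factor_koszulD_zero f (eq_zero_of_comp_eq_zero 2 (-2) rfl _ hf)
    exact ⟨_, (comp_koszulCochain_d 0 (-1) 0 rfl rfl g).symm⟩
  | 2, hk => exact absurd rfl hk
  | m + 3, _ =>
    exact (𝐏).dualComplex_koszulCochain_exactAt_of_isZero _
      (isZero_koszulComplex_X_of_two_lt hs _ (by lia))

/-- The dual of the Koszul complex is, by `dualAug`, quasi-isomorphic to `A` in degree two. -/
theorem isKcCalabiYau [Nonempty Q] (hs : SocleFree F Q) : (𝐏).IsKcCalabiYau 2 := by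
  obtain ⟨g, hg⟩ := (𝐏).exists_quasiIso_koszulCochain (isKoszul hs)
  have h0 : ∀ i, (ComplexShape.up ℤ).Rel i 2 →
      (Env.dualComplex (𝐏).koszulCochain).d i 2 ≫ dualAug F Q = 0 := fun i hi => by
    obtain rfl : i = 1 := by simp only [ComplexShape.up_Rel] at hi; lia
    exact d_comp_dualAug
  have hq : QuasiIso (mkHomToSingle (dualAug F Q) h0) := by
    refine quasiIso_mkHomToSingle _ 1 2 _ _ (by simp) ?_ (dualAug_surjective hs)
      exists_of_dualAug_eq_zero (dualComplex_exactAt hs)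
    have h3 : (𝐏).koszulCochain.d (-3) (-2) = 0 :=
      ((isZero_koszulComplex_X_of_two_lt hs 3 (by lia)).of_iso
        ((𝐏).koszulCochainXIso 3 (-3) rfl)).eq_of_src _ _
    have h4 : (Env.dualComplex (𝐏).koszulCochain).d 2 3 = 0 := by
      refine ModuleCat.hom_ext (LinearMap.ext fun f => ?_)
      have h5 : ∀ f : (𝐏).koszulCochain.X (-2) ⟶ Env.self F (𝐏).Alg,
          (𝐏).koszulCochain.d (-3) (-2) ≫ f = 0 := fun f => by rw [h3, Limits.zero_comp]
      exact congrArg ModuleCat.Hom.hom (h5 (ModuleCat.ofHom f))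
    rw [show (ComplexShape.up ℤ).next 2 = 3 by simp]
    exact h4
  refine ⟨hasLength hs, (𝐏).koszulCochain, 𝟙 _, inferInstance, inferInstance, ⟨0, inferInstance⟩, ?_⟩
  have h1 := Env.derivedIso_of_quasiIso (mkHomToSingle (K := Env.dualComplex (𝐏).koszulCochain)
    (dualAug F Q) h0)
  have h2 := Env.derivedIso_of_quasiIso
    (((CochainComplex.singleFunctors (ModuleCat (Env F (𝐏).Alg))).shiftIso (-2) 2 0 (by lia)).app
      (Env.regular F (𝐏).Alg)).inv
  have h3 := (Env.derivedIso_of_quasiIso (g⟦(-2 : ℤ)⟧')).symm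
  exact (h1.trans h2).trans h3

theorem isCalabiYau [Nonempty Q] (hs : SocleFree F Q) : IsCalabiYau F (𝐏).Alg 2 :=
  (𝐏).isCalabiYau_of_isKcCalabiYau (isKoszul hs) 2 (isKcCalabiYau hs)

theorem socleFree (hQ : IsConnectedQuiver Q) (δ : Q → ℕ) (hδ0 : ∃ a, δ a ≠ 0)
    (hδ : ∀ a, 2 * δ a ≤ ∑ b, (Fintype.card (a ⟶ b) + Fintype.card (b ⟶ a)) * δ b) :
    SocleFree F Q := eq_zero_of_mul_ar_eq_zero hQ δ hδ0 hδ

end Preproj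

/-! ### Multigraphs without subadditive weights -/

namespace Multigraph

variable {V : Type*} [Fintype V]

/-- A multigraph on `V` is given by the numbers `N a b` of edges between `a` and `b`, where loops
are counted twice. It has no weight if there is no nonzero function `δ` such that twice the value
of `δ` at a vertex is at most the sum of its values at the neighbours. -/
def HasNoWeight (N : V → V → ℕ) : Prop :=
  ∀ δ : V → ℕ, (∀ a, 2 * δ a ≤ ∑ b, N a b * δ b) → ∀ a, δ a = 0

/-- The vertices `v 1, …, v n` form a path without repetitions. -/
def IsPath (N : V → V → ℕ) (n : ℕ) (v : ℕ → V) : Prop :=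
  (∀ s t, 1 ≤ s → s ≤ n → 1 ≤ t → t ≤ n → v s = v t → s = t) ∧
    ∀ t, 1 ≤ t → t < n → 1 ≤ N (v t) (v (t + 1))

variable {N : V → V → ℕ}

theorem HasNoWeight.loop (hN : HasNoWeight N) (a : V) : N a a ≤ 1 := by
  classical
  by_contra! h
  have h1 := hN (Pi.single a 1) (fun b => ?_) a
  · simp at h1
  · by_cases hb : b = a
    · subst hb
      have e : ∑ c, N b c * (Pi.single b 1 : V → ℕ) c = N b b := by simp [Pi.single_apply]
      rw [e, Pi.single_eq_same]
      lia
    · simp [hb]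

/-- The test weights: a weight `c` along a path, and weights `p` and `q` at two further vertices. The
value `c 0 = 0` and the values `c t = 0` for `t > n` stand for the missing neighbours of the ends of
the path. -/
theorem HasNoWeight.test (hN : HasNoWeight N) (hsymm : ∀ a b, N a b = N b a) {n : ℕ} {v : ℕ → V}
    (hv : IsPath N n v) (c : ℕ → ℕ) (hc0 : c 0 = 0) (hcn : ∀ t, n < t → c t = 0) (w w' : V)
    (p q : ℕ) (hw : ∀ t, c t ≠ 0 → p ≠ 0 → v t ≠ w) (hw' : ∀ t, c t ≠ 0 → q ≠ 0 → v t ≠ w')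
    (hww : q ≠ 0 → w' ≠ w)
    (h1 : ∀ t, 1 ≤ t → t ≤ n → c t ≠ 0 →
      2 * c t ≤ c (t - 1) + c (t + 1) + N (v t) w * p + N (v t) w' * q)
    (h2 : 2 * p ≤ ∑ s ∈ Finset.Icc 1 n, N w (v s) * c s + N w w' * q)
    (h3 : 2 * q ≤ ∑ s ∈ Finset.Icc 1 n, N w' (v s) * c s + N w' w * p) (t : ℕ) : c t = 0 := by
  classical
  by_contra ht
  let δ : V → ℕ := fun a => ∑ s ∈ Finset.Icc 1 n, (if v s = a then c s else 0) +
    (if w = a then p else 0) + if w' = a then q else 0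
  have hsum : ∀ a, ∑ b, N a b * δ b =
      ∑ s ∈ Finset.Icc 1 n, N a (v s) * c s + N a w * p + N a w' * q := by
    intro a
    simp only [δ, mul_add, Finset.sum_add_distrib, Finset.mul_sum, mul_ite, mul_zero]
    rw [Finset.sum_comm]
    simp
  have hmem : ∀ s, c s ≠ 0 → 1 ≤ s ∧ s ≤ n := fun s hs =>
    ⟨Nat.one_le_iff_ne_zero.2 fun h => hs (h ▸ hc0), not_lt.1 fun h => hs (hcn s h)⟩
  have hpath : ∀ s, c s ≠ 0 → ∑ r ∈ Finset.Icc 1 n, (if v r = v s then c r else 0) = c s := by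
    intro s hs
    obtain ⟨hs1, hsn⟩ := hmem s hs
    rw [Finset.sum_eq_single s, if_pos rfl]
    · intro r hr hrs
      rw [Finset.mem_Icc] at hr
      exact if_neg fun h => hrs (hv.1 r s hr.1 hr.2 hs1 hsn h)
    · exact fun h => absurd (Finset.mem_Icc.2 ⟨hs1, hsn⟩) h
  have hoff : ∀ a, (∀ s, c s ≠ 0 → v s ≠ a) →
      ∑ r ∈ Finset.Icc 1 n, (if v r = a then c r else 0) = 0 := by
    intro a ha
    refine Finset.sum_eq_zero fun r _ => ?_
    by_cases hr : c r = 0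
    · rw [hr, ite_self]
    · exact if_neg (ha r hr)
  have hnb : ∀ s, 1 ≤ s → s ≤ n →
      c (s - 1) + c (s + 1) ≤ ∑ r ∈ Finset.Icc 1 n, N (v s) (v r) * c r := by
    intro s hs1 hsn
    have e1 : ∀ r, 1 ≤ N (v s) (v r) → c r ≤ N (v s) (v r) * c r := fun r hr =>
      Nat.le_mul_of_pos_left _ hr
    have e2 : s + 1 ≤ n → 1 ≤ N (v s) (v (s + 1)) := fun h => hv.2 s hs1 h
    have e3 : 1 ≤ s - 1 → 1 ≤ N (v s) (v (s - 1)) := fun h => by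
      have := hv.2 (s - 1) h (by lia)
      rwa [show s - 1 + 1 = s by lia, hsymm] at this
    by_cases ha : 1 ≤ s - 1 <;> by_cases hb : s + 1 ≤ n
    · refine (Nat.add_le_add (e1 _ (e3 ha)) (e1 _ (e2 hb))).trans ?_
      rw [← Finset.sum_pair (f := fun r => N (v s) (v r) * c r) (show s - 1 ≠ s + 1 by lia)]
      refine Finset.sum_le_sum_of_subset fun r hr => ?_
      rw [Finset.mem_insert, Finset.mem_singleton] at hr
      rw [Finset.mem_Icc]
      lia
    · rw [hcn (s + 1) (by lia), add_zero]
      exact (e1 _ (e3 ha)).trans (Finset.single_le_sum (f := fun r => N (v s) (v r) * c r)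
        (fun _ _ => Nat.zero_le _) (Finset.mem_Icc.2 ⟨ha, by lia⟩))
    · rw [show s - 1 = 0 by lia, hc0, zero_add]
      exact (e1 _ (e2 hb)).trans (Finset.single_le_sum (f := fun r => N (v s) (v r) * c r)
        (fun _ _ => Nat.zero_le _) (Finset.mem_Icc.2 ⟨by lia, hb⟩))
    · rw [hcn (s + 1) (by lia), show s - 1 = 0 by lia, hc0]
      exact Nat.zero_le _
  have key := hN δ (fun a => ?_) (v t)
  · have h5 : δ (v t) ≥ c t := by
      have := hpath t ht
      simp only [δ]
      lia
    lia
  rw [hsum]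
  by_cases hap : w = a ∧ p ≠ 0
  · obtain ⟨rfl, hp⟩ := hap
    have e : δ w = p := by
      have := hoff w fun s hs => hw s hs hp
      simp only [δ, this, if_true]
      by_cases hq : q = 0
      · simp [hq]
      · simp [hww hq]
    rw [e]
    lia
  have hap' : (if w = a then p else 0) = 0 := by
    by_cases h : w = a
    · rw [if_pos h]
      by_contra h'
      exact hap ⟨h, h'⟩
    · rw [if_neg h]
  by_cases haq : w' = a ∧ q ≠ 0
  · obtain ⟨rfl, hq⟩ := haq
    have e : δ w' = q := by
      have := hoff w' fun s hs => hw' s hs hq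
      simp only [δ, this, hap', if_true, zero_add]
    rw [e]
    lia
  have haq' : (if w' = a then q else 0) = 0 := by
    by_cases h : w' = a
    · rw [if_pos h]
      by_contra h'
      exact haq ⟨h, h'⟩
    · rw [if_neg h]
  by_cases hs : ∃ s, c s ≠ 0 ∧ v s = a
  · obtain ⟨s, hs, rfl⟩ := hs
    obtain ⟨hs1, hsn⟩ := hmem s hs
    have e : δ (v s) = c s := by
      simp only [δ, hpath s hs, hap', haq', add_zero]
    have := h1 s hs1 hsn hs
    have := hnb s hs1 hsn
    rw [e]
    lia
  · have e : δ a = 0 := by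
      simp only [δ, hap', haq', add_zero]
      exact hoff a fun s hs' h => hs ⟨s, hs', h⟩
    rw [e]
    exact Nat.zero_le _

theorem le_sum_path {n : ℕ} {v : ℕ → V} (c : ℕ → ℕ) {w : V} {i : ℕ} (hi : 1 ≤ i) (hin : i ≤ n)
    (h : 1 ≤ N w (v i)) : c i ≤ ∑ s ∈ Finset.Icc 1 n, N w (v s) * c s :=
  (Nat.le_mul_of_pos_left (c i) h).trans (Finset.single_le_sum (f := fun r => N w (v r) * c r)
    (fun _ _ => Nat.zero_le _) (Finset.mem_Icc.2 ⟨hi, hin⟩))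

section

variable (hN : HasNoWeight N) (hsymm : ∀ a b, N a b = N b a)
include hN hsymm

theorem HasNoWeight.edge {a b : V} (h : a ≠ b) : N a b ≤ 1 := by
  by_contra! hab
  have hv : IsPath N 1 fun _ => a := ⟨fun s t _ _ _ _ _ => by lia, fun t _ _ => by lia⟩
  have := hN.test hsymm hv (fun t => if t = 1 then 1 else 0) rfl (fun t ht => if_neg (by lia)) b b
    1 0 (fun _ _ _ => h) (fun _ _ h => absurd rfl h) (fun h => absurd rfl h)
    (fun t _ _ hc => by
      have : t = 1 := by by_contra h'; exact hc (if_neg h')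
      subst this
      simp
      lia)
    (by simp [hsymm b a]; lia) (by simp) 1
  simp at this

/-- There is no cycle. -/
theorem HasNoWeight.cycle {n : ℕ} {v : ℕ → V} (hv : IsPath N n v) {w : V} {i j : ℕ} (hi : 1 ≤ i)
    (hij : i < j) (hj : j ≤ n) (hw : ∀ t, i ≤ t → t ≤ j → v t ≠ w) (hwi : 1 ≤ N w (v i))
    (hwj : 1 ≤ N w (v j)) : False := by
  let c : ℕ → ℕ := fun t => if i ≤ t ∧ t ≤ j then 1 else 0
  have hc1 : ∀ t, i ≤ t → t ≤ j → c t = 1 := fun t h h' => if_pos ⟨h, h'⟩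
  have hc2 : ∀ t, c t ≠ 0 → i ≤ t ∧ t ≤ j := fun t h => by
    by_contra h'
    exact h (if_neg h')
  have := hN.test hsymm hv c (if_neg (by lia)) (fun t ht => if_neg (by lia)) w w 1 0
    (fun t ht _ => hw t (hc2 t ht).1 (hc2 t ht).2) (fun _ _ h => absurd rfl h)
    (fun h => absurd rfl h) (fun t ht htn hc => ?_) ?_ (by simp) i
  · rw [hc1 i le_rfl hij.le] at this
    exact one_ne_zero this
  · obtain ⟨h1, h2⟩ := hc2 t hc
    rw [hc1 t h1 h2]
    rw [hsymm] at hwi hwj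
    obtain rfl | h3 := h1.eq_or_lt
    · rw [hc1 (i + 1) (by lia) (by lia)]
      lia
    rw [hc1 (t - 1) (by lia) (by lia)]
    obtain rfl | h4 := h2.eq_or_lt
    · lia
    rw [hc1 (t + 1) (by lia) (by lia)]
    lia
  · have h1 := Finset.sum_le_sum_of_subset (f := fun s => N w (v s) * c s)
      (show {i, j} ⊆ Finset.Icc 1 n by
        intro r hr
        rw [Finset.mem_insert, Finset.mem_singleton] at hr
        rw [Finset.mem_Icc]
        lia)
    rw [Finset.sum_pair hij.ne] at h1
    simp only [hc1 i le_rfl hij.le, hc1 j hij.le le_rfl] at h1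
    lia

/-- The graph does not contain an extended Dynkin graph of type `D`. -/
theorem HasNoWeight.typeD {n : ℕ} {v : ℕ → V} (hv : IsPath N n v) {w w' : V} {i j : ℕ} (hi : 2 ≤ i)
    (hij : i ≤ j) (hj : j + 1 ≤ n) (hw : ∀ t, 1 ≤ t → t ≤ n → v t ≠ w)
    (hw' : ∀ t, 1 ≤ t → t ≤ n → v t ≠ w') (hww : w' ≠ w) (hwi : 1 ≤ N w (v i))
    (hwj : 1 ≤ N w' (v j)) : False := by
  let c : ℕ → ℕ := fun t => if i ≤ t ∧ t ≤ j then 2 else if t + 1 = i ∨ t = j + 1 then 1 else 0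
  have hc0 : ∀ t, c t ≠ 0 → 1 ≤ t ∧ t ≤ n := fun t ht => by
    by_contra h
    exact ht (by simp only [c]; rw [if_neg (by lia), if_neg (by lia)])
  have hci : ∀ t, i ≤ t → t ≤ j → c t = 2 := fun t h h' => if_pos ⟨h, h'⟩
  have := hN.test hsymm hv c (by simp only [c]; rw [if_neg (by lia), if_neg (by lia)])
    (fun t ht => by simp only [c]; rw [if_neg (by lia), if_neg (by lia)]) w w' 1 1
    (fun t ht _ => hw t (hc0 t ht).1 (hc0 t ht).2) (fun t ht _ => hw' t (hc0 t ht).1 (hc0 t ht).2)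
    (fun _ => hww) (fun t ht htn hc => ?_)
    (by have := le_sum_path (N := N) c (show 1 ≤ i by lia) (show i ≤ n by lia) hwi
        rw [hci i le_rfl hij] at this
        lia)
    (by have := le_sum_path (N := N) c (show 1 ≤ j by lia) (show j ≤ n by lia) hwj
        rw [hci j hij le_rfl] at this
        lia) i
  · rw [hci i le_rfl hij] at this
    exact two_ne_zero this
  · rw [hsymm] at hwi hwj
    have hl : ∀ t, t = i → 1 ≤ N (v t) w := by rintro _ rfl; exact hwi
    have hr : ∀ t, t = j → 1 ≤ N (v t) w' := by rintro _ rfl; exact hwj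
    have hl := hl t
    have hr := hr t
    rw [mul_one, mul_one]
    simp only [c] at hc ⊢
    split_ifs at hc ⊢ <;> lia

/-- The graph does not contain an extended Dynkin graph of type `E₆`. -/
theorem HasNoWeight.typeE₆ {n : ℕ} {v : ℕ → V} (hv : IsPath N n v) {w w' : V} {i : ℕ} (hi : 3 ≤ i)
    (hin : i + 2 ≤ n) (hw : ∀ t, 1 ≤ t → t ≤ n → v t ≠ w) (hw' : ∀ t, 1 ≤ t → t ≤ n → v t ≠ w')
    (hww : w' ≠ w) (hwi : 1 ≤ N w (v i)) (hww' : 1 ≤ N w' w) : False := by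
  -- the weights `1, 2, 3, 2, 1` at the vertices `i - 2, …, i + 2`
  let c : ℕ → ℕ := fun t => min (t + 3 - i) (i + 3 - t)
  have hci : c i = 3 := by simp only [c]; lia
  have hc0 : ∀ t, c t ≠ 0 → 1 ≤ t ∧ t ≤ n := fun t ht => by simp only [c] at ht; lia
  have := hN.test hsymm hv c (by simp only [c]; lia) (fun t ht => by simp only [c]; lia) w w' 2 1
    (fun t ht _ => hw t (hc0 t ht).1 (hc0 t ht).2) (fun t ht _ => hw' t (hc0 t ht).1 (hc0 t ht).2)
    (fun _ => hww) (fun t ht htn hc => ?_)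
    (by have := le_sum_path (N := N) c (show 1 ≤ i by lia) (show i ≤ n by lia) hwi
        rw [hsymm] at hww'
        lia) (by lia) i
  · lia
  · rw [hsymm] at hwi
    have hl : ∀ t, t = i → 1 ≤ N (v t) w := by rintro _ rfl; exact hwi
    have hl := hl t
    simp only [c] at hc ⊢
    by_cases h : t = i <;> lia

/-- The graph does not contain an extended Dynkin graph of type `E₇`. -/
theorem HasNoWeight.typeE₇ {n : ℕ} {v : ℕ → V} (hv : IsPath N n v) {w : V} {i : ℕ} (hi : 4 ≤ i)
    (hin : i + 3 ≤ n) (hw : ∀ t, 1 ≤ t → t ≤ n → v t ≠ w) (hwi : 1 ≤ N w (v i)) : False := by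
  -- the weights `1, 2, 3, 4, 3, 2, 1` at the vertices `i - 3, …, i + 3`
  let c : ℕ → ℕ := fun t => min (t + 4 - i) (i + 4 - t)
  have hci : c i = 4 := by simp only [c]; lia
  have hc0 : ∀ t, c t ≠ 0 → 1 ≤ t ∧ t ≤ n := fun t ht => by simp only [c] at ht; lia
  have := hN.test hsymm hv c (by simp only [c]; lia) (fun t ht => by simp only [c]; lia) w w 2 0
    (fun t ht _ => hw t (hc0 t ht).1 (hc0 t ht).2) (fun _ _ h => absurd rfl h)
    (fun h => absurd rfl h) (fun t ht htn hc => ?_)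
    (by have := le_sum_path (N := N) c (show 1 ≤ i by lia) (show i ≤ n by lia) hwi
        lia) (by lia) i
  · lia
  · rw [hsymm] at hwi
    have hl : ∀ t, t = i → 1 ≤ N (v t) w := by rintro _ rfl; exact hwi
    have hl := hl t
    simp only [c] at hc ⊢
    by_cases h : t = i <;> lia

/-- The graph does not contain an extended Dynkin graph of type `E₈`. -/
theorem HasNoWeight.typeE₈ {n : ℕ} {v : ℕ → V} (hv : IsPath N n v) {w : V} {i : ℕ} (hi : 3 ≤ i)
    (hin : i + 5 ≤ n) (hw : ∀ t, 1 ≤ t → t ≤ n → v t ≠ w) (hwi : 1 ≤ N w (v i)) : False := by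
  -- the weights `2, 4, 6, 5, 4, 3, 2, 1` at the vertices `i - 2, …, i + 5`
  let c : ℕ → ℕ := fun t => min (2 * (t + 3 - i)) (i + 6 - t)
  have hci : c i = 6 := by simp only [c]; lia
  have hc0 : ∀ t, c t ≠ 0 → 1 ≤ t ∧ t ≤ n := fun t ht => by simp only [c] at ht; lia
  have := hN.test hsymm hv c (by simp only [c]; lia) (fun t ht => by simp only [c]; lia) w w 3 0
    (fun t ht _ => hw t (hc0 t ht).1 (hc0 t ht).2) (fun _ _ h => absurd rfl h)
    (fun h => absurd rfl h) (fun t ht htn hc => ?_)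
    (by have := le_sum_path (N := N) c (show 1 ≤ i by lia) (show i ≤ n by lia) hwi
        lia) (by lia) i
  · lia
  · rw [hsymm] at hwi
    have hl : ∀ t, t = i → 1 ≤ N (v t) w := by rintro _ rfl; exact hwi
    have hl := hl t
    simp only [c] at hc ⊢
    by_cases h : t = i <;> lia

end

/-! ### Longest paths -/

theorem IsPath.suffix {n : ℕ} {v : ℕ → V} (hv : IsPath N n v) {i : ℕ} (hi : 1 ≤ i) (hin : i ≤ n) :
    IsPath N (n + 1 - i) fun t => v (t + (i - 1)) := by
  refine ⟨fun s t h1 h2 h3 h4 h => ?_, fun t h1 h2 => ?_⟩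
  · have := hv.1 _ _ (by lia) (by lia) (by lia) (by lia) h
    lia
  · have := hv.2 (t + (i - 1)) (by lia) (by lia)
    rwa [show t + (i - 1) + 1 = t + 1 + (i - 1) by lia] at this

theorem IsPath.cons {n : ℕ} {v : ℕ → V} (hv : IsPath N n v) {u : V}
    (hu : ∀ t, 1 ≤ t → t ≤ n → v t ≠ u) (h : 1 ≤ N u (v 1)) :
    IsPath N (n + 1) fun t => if t = 1 then u else v (t - 1) := by
  refine ⟨fun s t h1 h2 h3 h4 he => ?_, fun t h1 h2 => ?_⟩
  · by_cases hs : s = 1 <;> by_cases ht : t = 1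
    · lia
    · simp only [hs, if_true, if_neg ht] at he
      exact absurd he.symm (hu _ (by lia) (by lia))
    · simp only [ht, if_true, if_neg hs] at he
      exact absurd he (hu _ (by lia) (by lia))
    · simp only [if_neg hs, if_neg ht] at he
      have := hv.1 _ _ (by lia) (by lia) (by lia) (by lia) he
      lia
  · by_cases ht : t = 1
    · subst ht
      simpa using h
    · have := hv.2 (t - 1) (by lia) (by lia)
      rw [show t - 1 + 1 = t by lia] at this
      simpa [ht, show t ≠ 0 by lia] using this

theorem IsPath.reverse (hsymm : ∀ a b, N a b = N b a) {n : ℕ} {v : ℕ → V} (hv : IsPath N n v) :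
    IsPath N n fun t => v (n + 1 - t) := by
  refine ⟨fun s t h1 h2 h3 h4 he => ?_, fun t h1 h2 => ?_⟩
  · have := hv.1 _ _ (by lia) (by lia) (by lia) (by lia) he
    lia
  · have := hv.2 (n - t) (by lia) (by lia)
    rw [hsymm, show n - t + 1 = n + 1 - t by lia] at this
    change 1 ≤ N (v (n + 1 - t)) (v (n + 1 - (t + 1)))
    rwa [show n + 1 - (t + 1) = n - t by lia]

theorem IsPath.le_card {n : ℕ} {v : ℕ → V} (hv : IsPath N n v) : n ≤ Fintype.card V := by
  rw [← Fintype.card_fin n]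
  refine Fintype.card_le_of_injective (fun k : Fin n => v (k + 1)) fun k l h => Fin.ext ?_
  have := hv.1 _ _ (by lia) (by lia) (by lia) (by lia) h
  lia

/-- A path of maximal length. -/
structure IsLongest (N : V → V → ℕ) (n : ℕ) (v : ℕ → V) : Prop where
  isPath : IsPath N n v
  le : ∀ m u, IsPath N m u → m ≤ n

theorem exists_isLongest [Nonempty V] (N : V → V → ℕ) : ∃ n v, 1 ≤ n ∧ IsLongest N n v := by
  classical
  let P : ℕ → Prop := fun n => ∃ v, IsPath N n v
  have h1 : P 1 := ⟨fun _ => Classical.arbitrary V, fun s t _ _ _ _ _ => by lia,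
    fun t _ _ => by lia⟩
  have hb : ∀ n, P n → n ≤ Fintype.card V := fun n ⟨v, hv⟩ => hv.le_card
  obtain ⟨v, hv⟩ : P (Nat.findGreatest P (Fintype.card V)) := Nat.findGreatest_spec (hb 1 h1) h1
  exact ⟨_, v, Nat.le_findGreatest (hb 1 h1) h1, hv, fun m u hu =>
    Nat.le_findGreatest (hb m ⟨u, hu⟩) ⟨u, hu⟩⟩

theorem IsLongest.reverse (hsymm : ∀ a b, N a b = N b a) {n : ℕ} {v : ℕ → V}
    (hv : IsLongest N n v) : IsLongest N n fun t => v (n + 1 - t) :=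
  ⟨hv.isPath.reverse hsymm, hv.le⟩

/-- A longest path cannot be extended at its first vertex. -/
theorem IsLongest.two_le {n : ℕ} {v : ℕ → V} (hv : IsLongest N n v) {w : V}
    (hw : ∀ t, 1 ≤ t → t ≤ n → v t ≠ w) {i : ℕ} (hi : 1 ≤ i) (hin : i ≤ n) (h : 1 ≤ N w (v i)) :
    2 ≤ i := by
  have h1 := (hv.isPath.suffix hi hin).cons (u := w) (fun t h1 h2 => hw _ (by lia) (by lia))
    (by rwa [show 1 + (i - 1) = i by lia])
  have := hv.le _ _ h1
  lia

/-- A branch of two vertices at `v i` is not longer than the part of a longest path before `v i`. -/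
theorem IsLongest.three_le {n : ℕ} {v : ℕ → V} (hv : IsLongest N n v) {w w' : V}
    (hw : ∀ t, 1 ≤ t → t ≤ n → v t ≠ w) (hw' : ∀ t, 1 ≤ t → t ≤ n → v t ≠ w') (hww : w' ≠ w)
    {i : ℕ} (hi : 1 ≤ i) (hin : i ≤ n) (h : 1 ≤ N w (v i)) (h' : 1 ≤ N w' w) : 3 ≤ i := by
  have h1 := (hv.isPath.suffix hi hin).cons (u := w) (fun t h1 h2 => hw _ (by lia) (by lia))
    (by rwa [show 1 + (i - 1) = i by lia])
  have h2 := h1.cons (u := w') (fun t h1 h2 => by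
    by_cases ht : t = 1
    · rw [if_pos ht]; exact hww.symm
    · rw [if_neg ht]; exact hw' _ (by lia) (by lia)) (by rwa [if_pos rfl])
  have := hv.le _ _ h2
  lia

theorem IsLongest.le_sub (hsymm : ∀ a b, N a b = N b a) {n : ℕ} {v : ℕ → V}
    (hv : IsLongest N n v) {w : V} (hw : ∀ t, 1 ≤ t → t ≤ n → v t ≠ w) {i : ℕ} (hi : 1 ≤ i)
    (hin : i ≤ n) (h : 1 ≤ N w (v i)) : i + 1 ≤ n := by
  have := (hv.reverse hsymm).two_le (w := w) (i := n + 1 - i)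
    (fun t _ _ => hw _ (by lia) (by lia)) (by lia) (by lia)
    (by rwa [show n + 1 - (n + 1 - i) = i by lia])
  lia

section

variable (hN : HasNoWeight N) (hsymm : ∀ a b, N a b = N b a)
include hN hsymm

/-- A longest path misses at most one vertex. -/
theorem HasNoWeight.eq_or_eq
    (hconn : ∀ S : Set V, S.Nonempty → (∀ a ∈ S, ∀ b, 1 ≤ N b a → b ∈ S) → ∀ a, a ∈ S) {n : ℕ}
    {v : ℕ → V} (hv : IsLongest N n v) {w : V} (hw : ∀ t, 1 ≤ t → t ≤ n → v t ≠ w) {i : ℕ}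
    (hi : 1 ≤ i) (hin : i ≤ n) (h : 1 ≤ N w (v i)) (a : V) :
    a = w ∨ ∃ t, 1 ≤ t ∧ t ≤ n ∧ v t = a := by
  refine hconn {a | a = w ∨ ∃ t, 1 ≤ t ∧ t ≤ n ∧ v t = a} ⟨w, Or.inl rfl⟩ ?_ a
  intro a ha w' hb
  by_contra hw'
  simp only [Set.mem_ofPred_eq, not_or, not_exists, not_and] at hw'
  obtain ⟨hww, hw'⟩ := hw'
  have h1 := hv.two_le hw hi hin h
  have h2 := hv.le_sub hsymm hw hi hin h
  obtain rfl | ⟨j, hj, hjn, rfl⟩ := ha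
  · have h3 := hv.three_le hw hw' hww hi hin h hb
    have h4 := (hv.reverse hsymm).three_le (w := a) (w' := w') (i := n + 1 - i)
      (fun t _ _ => hw _ (by lia) (by lia)) (fun t _ _ => hw' _ (by lia) (by lia)) hww (by lia)
      (by lia) (by rwa [show n + 1 - (n + 1 - i) = i by lia]) hb
    exact hN.typeE₆ hsymm hv.isPath h3 (by lia) hw hw' hww h hb
  · have h3 := hv.two_le hw' hj hjn hb
    have h4 := hv.le_sub hsymm hw' hj hjn hb
    obtain hij | hij := le_total i j
    · exact hN.typeD hsymm hv.isPath h1 hij h4 hw hw' hww h hb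
    · exact hN.typeD hsymm hv.isPath h3 hij h2 hw' hw (Ne.symm hww) hb h

/-- A path has no chords. -/
theorem HasNoWeight.path_apply {n : ℕ} {v : ℕ → V} (hv : IsPath N n v) (heven : ∀ a, Even (N a a))
    {s t : ℕ} (hs : 1 ≤ s) (hsn : s ≤ n) (ht : 1 ≤ t) (htn : t ≤ n) :
    N (v s) (v t) = if s + 1 = t ∨ t + 1 = s then 1 else 0 := by
  wlog h : s ≤ t generalizing s t
  · rw [hsymm, this ht htn hs hsn (by lia)]
    exact if_congr or_comm rfl rfl
  obtain rfl | h := h.eq_or_lt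
  · rw [if_neg (by lia)]
    have := hN.loop (v s)
    obtain ⟨k, hk⟩ := heven (v s)
    lia
  by_cases h' : s + 1 = t
  · subst h'
    rw [if_pos (Or.inl rfl)]
    have h1 := hv.2 s hs (by lia)
    have h2 := hN.edge hsymm (a := v s) (b := v (s + 1)) fun he => by
      have := hv.1 _ _ hs hsn ht htn he
      lia
    lia
  · rw [if_neg (by lia)]
    by_contra h0
    refine hN.cycle hsymm hv (w := v t) (i := s) (j := t - 1) hs (by lia) (by lia)
      (fun r hr hr' he => ?_) (by rw [hsymm]; lia) ?_
    · have := hv.1 _ _ (by lia) (by lia) ht htn he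
      lia
    · have := hv.2 (t - 1) (by lia) (by lia)
      rwa [hsymm, show t - 1 + 1 = t by lia] at this

/-- A vertex outside a path is joined to at most one vertex of it. -/
theorem HasNoWeight.apply_path {n : ℕ} {v : ℕ → V} (hv : IsPath N n v) {w : V}
    (hw : ∀ t, 1 ≤ t → t ≤ n → v t ≠ w) {i : ℕ} (hi : 1 ≤ i) (hin : i ≤ n) (h : 1 ≤ N w (v i))
    {t : ℕ} (ht : 1 ≤ t) (htn : t ≤ n) : N w (v t) = if t = i then 1 else 0 := by
  split_ifs with hti
  · subst hti
    have := hN.edge hsymm (hw t ht htn).symm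
    lia
  · by_contra h0
    obtain hlt | hlt := lt_or_gt_of_ne hti
    · exact hN.cycle hsymm hv ht hlt hin (fun r _ _ => hw r (by lia) (by lia)) (by lia) h
    · exact hN.cycle hsymm hv hi hlt htn (fun r _ _ => hw r (by lia) (by lia)) h (by lia)

end

end Multigraph

/-! ### The graph of a quiver -/

section

open Multigraph

variable {Q : Type v} [Quiver.{w} Q] [∀ a b : Q, Fintype (a ⟶ b)]

variable (Q) in
/-- The numbers of edges of the underlying graph, where loops are counted twice. -/
def edges (a b : Q) : ℕ := Fintype.card (a ⟶ b) + Fintype.card (b ⟶ a)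

theorem edges_comm (a b : Q) : edges Q a b = edges Q b a := Nat.add_comm _ _

theorem even_edges_self (a : Q) : Even (edges Q a a) := ⟨_, rfl⟩

theorem hasGraph_of_bijective {m : ℕ} {C : Matrix (Fin m) (Fin m) ℤ} (g : Fin m → Q)
    (hg : Function.Bijective g)
    (h : ∀ k l, C k l = (if k = l then 2 else 0) - (edges Q (g k) (g l) : ℤ)) : HasGraph Q C := by
  classical
  refine ⟨(Equiv.ofBijective g hg).symm, fun a b => ?_⟩
  obtain ⟨k, rfl⟩ := hg.2 a
  obtain ⟨l, rfl⟩ := hg.2 b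
  have e : ∀ k, (Equiv.ofBijective g hg).symm (g k) = k :=
    (Equiv.ofBijective g hg).symm_apply_apply
  rw [e, e, h, graphCartan, Matrix.of_apply, edges]
  simp only [hg.1.eq_iff, Nat.cast_add]

/-- A nonempty set of vertices that is closed under adjacency contains all vertices. -/
theorem IsConnectedQuiver.mem_of_closed (hQ : IsConnectedQuiver Q) (S : Set Q) (hS : S.Nonempty)
    (h : ∀ a ∈ S, ∀ b, 1 ≤ edges Q b a → b ∈ S) (a : Q) : a ∈ S := by
  obtain ⟨b, hb⟩ := hS
  have key : ∀ c : Quiver.Symmetrify Q, Quiver.Path (show Quiver.Symmetrify Q from b) c →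
      (show Q from c) ∈ S := by
    intro c p
    induction p with
    | nil => exact hb
    | cons p α ih =>
      refine h _ ih _ ?_
      rcases α with α | α
      · exact Nat.le_add_left_of_le (Fintype.card_pos_iff.2 ⟨α⟩)
      · exact Nat.le_add_right_of_le (Fintype.card_pos_iff.2 ⟨α⟩)
  exact key a (hQ.2 b a).some

variable [Fintype Q]

/-- The number of edges between two vertices of the tree that consists of the path `1, …, n` and of
a vertex `0` joined to `i`. -/
def combEdges (i s t : ℕ) : ℕ :=
  if s = 0 then if t = i then 1 else 0
  else if t = 0 then if s = i then 1 else 0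
  else if s + 1 = t ∨ t + 1 = s then 1 else 0

/-- If the vertices are those of a path and one further vertex `w` joined to `v i`, the graph is
determined by `combEdges`. A Cartan matrix is compared to it through a labelling `σ` of its rows, with
`0` for `w` and `t` for `v t`. -/
theorem hasGraph_of_comb (hN : HasNoWeight (edges Q)) {n : ℕ} {v : ℕ → Q}
    (hv : IsPath (edges Q) n v) {w : Q} (hw : ∀ t, 1 ≤ t → t ≤ n → v t ≠ w) {i : ℕ} (hi : 1 ≤ i)
    (hin : i ≤ n) (h : 1 ≤ edges Q w (v i)) (hs : ∀ a, a = w ∨ ∃ t, 1 ≤ t ∧ t ≤ n ∧ v t = a)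
    {C : Matrix (Fin (n + 1)) (Fin (n + 1)) ℤ} (σ : Fin (n + 1) → ℕ) (hσ : ∀ k, σ k ≤ n)
    (hinj : Function.Injective σ)
    (hC : ∀ k l, C k l = (if k = l then 2 else 0) - (combEdges i (σ k) (σ l) : ℤ)) :
    HasGraph Q C := by
  let u : ℕ → Q := fun t => if t = 0 then w else v t
  have hu : ∀ s t, s ≤ n → t ≤ n → u s = u t → s = t := by
    intro s t hsn htn he
    by_cases h1 : s = 0 <;> by_cases h2 : t = 0
    · lia
    · simp only [u, if_pos h1, if_neg h2] at he
      exact absurd he.symm (hw t (by lia) htn)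
    · simp only [u, if_pos h2, if_neg h1] at he
      exact absurd he (hw s (by lia) hsn)
    · simp only [u, if_neg h2, if_neg h1] at he
      exact hv.1 s t (by lia) hsn (by lia) htn he
  have hsurj : ∀ t ≤ n, ∃ k, σ k = t := by
    intro t ht
    let σ' : Fin (n + 1) → Fin (n + 1) := fun k => ⟨σ k, by have := hσ k; lia⟩
    have hσ' : Function.Injective σ' := fun k l hkl => hinj (congrArg Fin.val hkl)
    obtain ⟨k, hk⟩ := Finite.injective_iff_surjective.1 hσ' ⟨t, by lia⟩
    exact ⟨k, congrArg Fin.val hk⟩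
  refine hasGraph_of_bijective (fun k => u (σ k))
    ⟨fun k l hkl => hinj (hu _ _ (hσ k) (hσ l) hkl), fun a => ?_⟩ fun k l => ?_
  · obtain rfl | ⟨t, ht, htn, rfl⟩ := hs a
    · obtain ⟨k, hk⟩ := hsurj 0 (by lia)
      exact ⟨k, if_pos hk⟩
    · obtain ⟨k, hk⟩ := hsurj t htn
      exact ⟨k, by simp only [hk, u]; exact if_neg (by lia)⟩
  · rw [hC]
    congr 2
    have hk := hσ k
    have hl := hσ l
    by_cases h1 : σ k = 0 <;> by_cases h2 : σ l = 0
    · simp only [u, h1, h2, combEdges, if_true]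
      rw [if_neg (by lia)]
      have := hN.loop w
      obtain ⟨r, hr⟩ := even_edges_self w
      lia
    · simp only [u, h1, h2, combEdges, if_true, if_false]
      exact (hN.apply_path edges_comm hv hw hi hin h (by lia) hl).symm
    · simp only [u, h1, h2, combEdges, if_true, if_false]
      rw [edges_comm]
      exact (hN.apply_path edges_comm hv hw hi hin h (by lia) hk).symm
    · simp only [u, h1, h2, combEdges, if_false]
      exact (hN.path_apply edges_comm hv even_edges_self (by lia) hk (by lia) hl).symm

theorem hasGraph_A (hN : HasNoWeight (edges Q)) {n : ℕ} {v : ℕ → Q}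
    (hv : IsPath (edges Q) n v) (hs : ∀ a, ∃ t, 1 ≤ t ∧ t ≤ n ∧ v t = a) :
    HasGraph Q (CartanMatrix.A n) := by
  refine hasGraph_of_bijective (fun k : Fin n => v (k + 1)) ⟨fun k l hkl => ?_, fun a => ?_⟩
    fun k l => ?_
  · have := hv.1 _ _ (by lia) (by lia) (by lia) (by lia) hkl
    exact Fin.ext (by lia)
  · obtain ⟨t, ht, htn, rfl⟩ := hs a
    exact ⟨⟨t - 1, by lia⟩, by simp only [show t - 1 + 1 = t by lia]⟩
  · rw [hN.path_apply edges_comm hv even_edges_self (by lia) (by lia) (by lia) (by lia)]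
    simp only [CartanMatrix.A, Matrix.of_apply, Fin.ext_iff]
    split_ifs <;> simp <;> lia

theorem hasGraph_D (hN : HasNoWeight (edges Q)) {n : ℕ} {v : ℕ → Q}
    (hv : IsPath (edges Q) n v) {w : Q} (hw : ∀ t, 1 ≤ t → t ≤ n → v t ≠ w) (hn : 3 ≤ n)
    (h : 1 ≤ edges Q w (v (n - 1))) (hs : ∀ a, a = w ∨ ∃ t, 1 ≤ t ∧ t ≤ n ∧ v t = a) :
    HasGraph Q (CartanMatrix.D (n + 1)) := by
  refine hasGraph_of_comb hN hv hw (by lia) (by lia) h hs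
    (fun k => if (k : ℕ) < n then k + 1 else 0) (fun k => ?_) (fun k l hkl => ?_) fun k l => ?_
  · split_ifs <;> lia
  · refine Fin.ext ?_
    dsimp only at hkl
    split_ifs at hkl <;> lia
  · simp only [CartanMatrix.D, Matrix.of_apply, Fin.ext_iff, combEdges]
    have := k.2
    have := l.2
    by_cases hk : (k : ℕ) < n <;> by_cases hl : (l : ℕ) < n <;>
      simp only [hk, hl, if_true, if_false] <;> split_ifs <;> simp <;> lia

/-- The labelling of the vertices of the diagrams of type `E` in Bourbaki's order, where `0` stands
for the vertex outside the longest path. -/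
def labelE (m : ℕ) (k : Fin m) : ℕ := if k.1 = 0 then 1 else if k.1 = 1 then 0 else k

theorem labelE_injective (m : ℕ) : Function.Injective (labelE m) := by
  intro k l h
  refine Fin.ext ?_
  simp only [labelE] at h
  split_ifs at h <;> lia

theorem E₆_eq : CartanMatrix.E₆ = Matrix.of fun k l =>
    (if k = l then 2 else 0) - (combEdges 3 (labelE 6 k) (labelE 6 l) : ℤ) := by
  decide

theorem E₇_eq : CartanMatrix.E₇ = Matrix.of fun k l =>
    (if k = l then 2 else 0) - (combEdges 3 (labelE 7 k) (labelE 7 l) : ℤ) := by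
  decide

theorem E₈_eq : CartanMatrix.E₈ = Matrix.of fun k l =>
    (if k = l then 2 else 0) - (combEdges 3 (labelE 8 k) (labelE 8 l) : ℤ) := by
  decide

/-- A path of at least five vertices with one further vertex joined to the third is of type `E`. -/
theorem isDynkinADE_of_three (hN : HasNoWeight (edges Q)) {n : ℕ} {v : ℕ → Q}
    (hv : IsPath (edges Q) n v) {w : Q} (hw : ∀ t, 1 ≤ t → t ≤ n → v t ≠ w) (hn : 5 ≤ n)
    (h : 1 ≤ edges Q w (v 3)) (hs : ∀ a, a = w ∨ ∃ t, 1 ≤ t ∧ t ≤ n ∧ v t = a) :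
    IsDynkinADE Q := by
  have hn8 : n < 8 := by
    by_contra! h8
    exact hN.typeE₈ edges_comm hv le_rfl h8 hw h
  have hl : ∀ k : Fin (n + 1), labelE (n + 1) k ≤ n := fun k => by
    simp only [labelE]
    split_ifs <;> lia
  obtain rfl | rfl | rfl : n = 5 ∨ n = 6 ∨ n = 7 := by lia
  · exact Or.inr (Or.inr (Or.inl (hasGraph_of_comb hN hv hw (by lia) (by lia) h hs _ hl
      (labelE_injective _) fun k l => congrFun₂ E₆_eq k l)))
  · exact Or.inr (Or.inr (Or.inr (Or.inl (hasGraph_of_comb hN hv hw (by lia) (by lia) h hs _ hl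
      (labelE_injective _) fun k l => congrFun₂ E₇_eq k l))))
  · exact Or.inr (Or.inr (Or.inr (Or.inr (hasGraph_of_comb hN hv hw (by lia) (by lia) h hs _ hl
      (labelE_injective _) fun k l => congrFun₂ E₈_eq k l))))

/-- A connected graph without weights is a Dynkin graph. A longest path misses at most one vertex
`w`; the type depends on the position of the vertex of the path to which `w` is joined. -/
theorem isDynkinADE_of_hasNoWeight (hQ : IsConnectedQuiver Q) (hN : HasNoWeight (edges Q)) :
    IsDynkinADE Q := by
  have := hQ.1
  obtain ⟨n, v, hn, hv⟩ := exists_isLongest (edges Q)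
  by_cases hs : ∀ a, ∃ t, 1 ≤ t ∧ t ≤ n ∧ v t = a
  · exact Or.inl ⟨n, hn, hasGraph_A hN hv.isPath hs⟩
  obtain ⟨w, hw, i, hi, hin, h⟩ : ∃ w, (∀ t, 1 ≤ t → t ≤ n → v t ≠ w) ∧
      ∃ i, 1 ≤ i ∧ i ≤ n ∧ 1 ≤ edges Q w (v i) := by
    by_contra! hno
    refine hs fun a => hQ.mem_of_closed {a | ∃ t, 1 ≤ t ∧ t ≤ n ∧ v t = a}
      ⟨v 1, 1, le_rfl, hn, rfl⟩ ?_ a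
    rintro _ ⟨t, ht, htn, rfl⟩ b hb
    by_contra hb'
    have := hno b (fun s hs hsn he => hb' ⟨s, hs, hsn, he⟩) t ht htn
    lia
  have hall := hN.eq_or_eq edges_comm hQ.mem_of_closed hv hw hi hin h
  have h2 := hv.two_le hw hi hin h
  have h2' := hv.le_sub edges_comm hw hi hin h
  have hw' : ∀ t, 1 ≤ t → t ≤ n → v (n + 1 - t) ≠ w := fun t _ _ => hw _ (by lia) (by lia)
  have hall' : ∀ a, a = w ∨ ∃ t, 1 ≤ t ∧ t ≤ n ∧ v (n + 1 - t) = a := fun a => by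
    obtain ha | ⟨t, ht, htn, ha⟩ := hall a
    · exact Or.inl ha
    · exact Or.inr ⟨n + 1 - t, by lia, by lia, by rwa [show n + 1 - (n + 1 - t) = t by lia]⟩
  have hr := hv.isPath.reverse edges_comm
  by_cases h3 : i + 1 = n
  · exact Or.inr (Or.inl ⟨n + 1, by lia, hasGraph_D hN hv.isPath hw (by lia)
      (by rwa [show n - 1 = i by lia]) hall⟩)
  by_cases h4 : i = 2
  · exact Or.inr (Or.inl ⟨n + 1, by lia, hasGraph_D hN hr hw' (by lia)
      (by rwa [show n + 1 - (n - 1) = i by lia]) hall'⟩)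
  by_cases h5 : i = 3
  · exact isDynkinADE_of_three hN hv.isPath hw (by lia) (by rwa [← h5]) hall
  by_cases h6 : i + 2 = n
  · exact isDynkinADE_of_three hN hr hw' (by lia) (by rwa [show n + 1 - 3 = i by lia]) hall'
  exact (hN.typeE₇ edges_comm hv.isPath (by lia) (by lia) hw h).elim

/-- A connected graph that is not a Dynkin graph has a nonzero weight. -/
theorem exists_weight (hQ : IsConnectedQuiver Q) (h : ¬ IsDynkinADE Q) :
    ∃ δ : Q → ℕ, (∃ a, δ a ≠ 0) ∧
      ∀ a, 2 * δ a ≤ ∑ b, (Fintype.card (a ⟶ b) + Fintype.card (b ⟶ a)) * δ b := by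
  by_contra! hno
  refine h (isDynkinADE_of_hasNoWeight hQ fun δ hδ a => ?_)
  by_contra ha
  obtain ⟨b, hb⟩ := hno δ ⟨a, ha⟩
  exact absurd (hδ b) (not_le.2 hb)

end

end QuiverKoszul

end

theorem mainTheorem6 (F : Type u) [Field F] (Q : Type v) [Quiver.{w} Q] [Fintype Q]
    [∀ a b : Q, Fintype (a ⟶ b)] [Nonempty Q] :
    (∀ (R : QuiverKoszul.QuadraticRelations F Q) (n : ℕ), R.IsKoszul →
      (R.IsKcCalabiYau n ↔ QuiverKoszul.IsCalabiYau F R.Alg n)) ∧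
    (QuiverKoszul.IsConnectedQuiver Q → ¬ QuiverKoszul.IsDynkinADE Q →
      QuiverKoszul.IsCalabiYau F (QuiverKoszul.preprojective F Q).Alg 2) := by
  refine ⟨fun R n hR => R.isKcCalabiYau_iff_isCalabiYau hR n, fun hQ h => ?_⟩
  obtain ⟨δ, hδ0, hδ⟩ := QuiverKoszul.exists_weight hQ h
  exact QuiverKoszul.Preproj.isCalabiYau (QuiverKoszul.Preproj.socleFree hQ δ hδ0 hδ)
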